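/- Let $(M,\omega)$ be a symplectic manifold of dimension $2n$ (a smooth, Hausdorff, second countable manifold without boundary, with a smooth closed nondegenerate $2$-form), equipped with a continuous Riemannian metric and with a distance $\rho$ on $TM$ that induces the topology of $TM$. For $C^1$ maps $f,g$ into $M$ put $$d_{C^1}(f,g)=\sup\{\rho(Tf\,v,\,Tg\,v): v \text{ a tangent vector of the domain},\ \|v\|\le 1\}.$$ Let $\iota: W\hookrightarrow M$ be a $C^1$ (injectively immersed) Lagrangian submanifold, i.e. $W$ is an $n$-dimensional $C^1$ manifold, $\iota$ is a $C^1$ injective immersion and $\iota^*\omega=0$, and let $z\in W$. Equip $W$ with the induced Riemannian metric, let $B_W(z,r)$ be the ball of the corresponding intrinsic distance of $W$ (infimum of lengths of $C^1$ paths in $W$), and let closures, boundaries and interiors of subsets of $W$ be taken in $W$. Then there is $R>0$ such that for every $r_0\in(0,R]$ the disk $D=\overline{B_W(z,r_0)}$ is compact and has the following property. For every neighborhood $U\subset M$ of $D$ and every $\varepsilon>0$ there exists $\delta>0$ such that, for every $C^1$ diffeomorphism $\psi:D\to D$ satisfying (a) $\psi=\mathrm{Id}$ on a neighborhood of $\partial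 D$ in $D$, and (b) $d_{C^1}(\psi,\mathrm{Id})<\delta$ (as maps $D\to M$), there exists a $C^1$ symplectomorphism $\varphi$ of $M$ (a $C^1$ diffeomorphism with $\varphi^*\omega=\omega$) such that 1. $\varphi=\mathrm{Id}$ on $M\setminus U$, 2. $\varphi=\psi$ on $D$, and 3. $d_{C^1}(\varphi,\mathrm{Id})<\varepsilon$. -/

import Mathlib

open Set Filter Topology Manifold Bundle
open scoped ContDiff ENNReal

noncomputable section

/-- A differential `2`-form on a `d`-dimensional manifold: an alternating bilinear form on every
tangent space (regularity is imposed separately). -/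
abbrev TwoForm (d : ℕ) (M : Type*) [TopologicalSpace M]
    [ChartedSpace (EuclideanSpace ℝ (Fin d)) M] : Type _ :=
  ∀ x : M, (TangentSpace (𝓡 d) x) [⋀^Fin 2]→L[ℝ] ℝ

/-- The coordinate expression of a `2`-form in a chart `e`, i.e. its pull-back by `e⁻¹`, a `2`-form
on Euclidean space that is meaningful on `e.target`. -/
def TwoForm.inChart {d : ℕ} {M : Type*} [TopologicalSpace M]
    [ChartedSpace (EuclideanSpace ℝ (Fin d)) M] (Ω : TwoForm d M)
    (e : OpenPartialHomeomorph M (EuclideanSpace ℝ (Fin d))) :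
    EuclideanSpace ℝ (Fin d) → (EuclideanSpace ℝ (Fin d)) [⋀^Fin 2]→L[ℝ] ℝ :=
  fun y => (Ω (e.symm y)).compContinuousLinearMap (mfderiv (𝓡 d) (𝓡 d) e.symm y)

/-- A symplectic form: a smooth, closed, nondegenerate `2`-form. Smoothness and closedness are
expressed in the charts of the atlas. -/
structure TwoForm.IsSymplectic {d : ℕ} {M : Type*} [TopologicalSpace M]
    [ChartedSpace (EuclideanSpace ℝ (Fin d)) M] (Ω : TwoForm d M) : Prop where
  smooth : ∀ e ∈ atlas (EuclideanSpace ℝ (Fin d)) M, ContDiffOn ℝ ∞ (Ω.inChart e) e.target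
  closed : ∀ e ∈ atlas (EuclideanSpace ℝ (Fin d)) M, ∀ y ∈ e.target,
    extDeriv (Ω.inChart e) y = 0
  nondegenerate : ∀ (x : M) (v : TangentSpace (𝓡 d) x),
    (∀ w : TangentSpace (𝓡 d) x, Ω x ![v, w] = 0) → v = 0

/-- A `C¹` diffeomorphism `φ` is a symplectomorphism if `φ^* Ω = Ω`. -/
def IsSymplecto {d : ℕ} {M : Type*} [TopologicalSpace M]
    [ChartedSpace (EuclideanSpace ℝ (Fin d)) M] (Ω : TwoForm d M)
    (φ : M ≃ₘ^1⟮𝓡 d, 𝓡 d⟯ M) : Prop :=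
  ∀ (x : M) (v w : TangentSpace (𝓡 d) x),
    Ω (φ x) ![mfderiv (𝓡 d) (𝓡 d) φ x v, mfderiv (𝓡 d) (𝓡 d) φ x w] = Ω x ![v, w]

/-- `ι : W → M` presents the `n`-dimensional manifold `W` as a `C¹` (injectively immersed)
Lagrangian submanifold of the `2n`-dimensional manifold `M` with `2`-form `Ω`. -/
structure IsLagrangianSubmanifold {n : ℕ} {M W : Type*} [TopologicalSpace M]
    [ChartedSpace (EuclideanSpace ℝ (Fin (2 * n))) M] [TopologicalSpace W]
    [ChartedSpace (EuclideanSpace ℝ (Fin n)) W] (Ω : TwoForm (2 * n) M) (ι : W → M) : Prop where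
  contMDiff : ContMDiff (𝓡 n) (𝓡 (2 * n)) 1 ι
  injective : Function.Injective ι
  injective_mfderiv : ∀ w : W, Function.Injective (mfderiv (𝓡 n) (𝓡 (2 * n)) ι w)
  isotropic : ∀ (w : W) (u v : TangentSpace (𝓡 n) w),
    Ω (ι w) ![mfderiv (𝓡 n) (𝓡 (2 * n)) ι w u, mfderiv (𝓡 n) (𝓡 (2 * n)) ι w v] = 0

/-- The intrinsic distance of the submanifold `ι : W → M`: the infimum of the lengths, for the
Riemannian metric of `M`, of the `C¹` paths in `W` (it is `∞` between different components). -/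
def intrinsicEDist {m n : ℕ} {M W : Type*} [TopologicalSpace M]
    [ChartedSpace (EuclideanSpace ℝ (Fin m)) M]
    [RiemannianBundle (fun x : M => TangentSpace (𝓡 m) x)]
    [TopologicalSpace W] [ChartedSpace (EuclideanSpace ℝ (Fin n)) W]
    (ι : W → M) (x y : W) : ℝ≥0∞ :=
  ⨅ (γ : ℝ → W) (_ : ContMDiffOn 𝓘(ℝ) (𝓡 n) 1 γ (Icc 0 1)) (_ : γ 0 = x) (_ : γ 1 = y),
    pathELength (𝓡 m) (ι ∘ γ) 0 1

/-- The disk `D = closure (B_W(z, r))` of `W`, where `B_W(z, r)` is the ball of the intrinsic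
distance and the closure is taken in `W`. -/
def intrinsicDisk {m n : ℕ} {M W : Type*} [TopologicalSpace M]
    [ChartedSpace (EuclideanSpace ℝ (Fin m)) M]
    [RiemannianBundle (fun x : M => TangentSpace (𝓡 m) x)]
    [TopologicalSpace W] [ChartedSpace (EuclideanSpace ℝ (Fin n)) W]
    (ι : W → M) (z : W) (r : ℝ) : Set W :=
  closure {w : W | intrinsicEDist (m := m) (n := n) ι z w < ENNReal.ofReal r}

/-- `ψ` restricts to a `C¹` diffeomorphism of `D ⊆ W` onto itself. The values of `ψ` off `D` are
irrelevant. -/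
def IsC1DiffeoOfSet {n : ℕ} {W : Type*} [TopologicalSpace W]
    [ChartedSpace (EuclideanSpace ℝ (Fin n)) W] (D : Set W) (ψ : W → W) : Prop :=
  MapsTo ψ D D ∧ ContMDiffOn (𝓡 n) (𝓡 n) 1 ψ D ∧
    ∃ ψ' : W → W, MapsTo ψ' D D ∧ ContMDiffOn (𝓡 n) (𝓡 n) 1 ψ' D ∧ InvOn ψ' ψ D D

/-- The topology of the tangent bundle as a manifold (a named copy of Mathlib's instance). -/
abbrev tangentBundleTopology (m : ℕ) (M : Type*) [TopologicalSpace M]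
    [ChartedSpace (EuclideanSpace ℝ (Fin m)) M] [IsManifold (𝓡 m) 1 M] :
    TopologicalSpace (TangentBundle (𝓡 m) M) :=
  inferInstance

/-- The `C¹` distance of `f, g : N → M` over a set `B` of tangent vectors of `N`:
`sup_{v ∈ B} ρ (Tf v, Tg v)`, where `ρ` is a distance on `TM`. As `B` one takes the vectors of norm
at most `1`; zero vectors account for the `C⁰` part. -/
def c1EDist {k m : ℕ} {N M : Type*} [TopologicalSpace N]
    [ChartedSpace (EuclideanSpace ℝ (Fin k)) N] [TopologicalSpace M]
    [ChartedSpace (EuclideanSpace ℝ (Fin m)) M]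
    (ρ : MetricSpace (TangentBundle (𝓡 m) M)) (B : Set (TangentBundle (𝓡 k) N))
    (f g : N → M) : ℝ≥0∞ :=
  ⨆ v ∈ B, ρ.edist (tangentMap (𝓡 k) (𝓡 m) f v) (tangentMap (𝓡 k) (𝓡 m) g v)

/-- The distance `ρ` on the tangent bundle `TM` induces the manifold topology of `TM`. -/
def IsCompatibleDist {m : ℕ} {M : Type*} [TopologicalSpace M]
    [ChartedSpace (EuclideanSpace ℝ (Fin m)) M] [IsManifold (𝓡 m) 1 M]
    (ρ : MetricSpace (TangentBundle (𝓡 m) M)) : Prop :=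
  ρ.toUniformSpace.toTopologicalSpace = tangentBundleTopology m M

/-- The unit disk bundle of a Riemannian manifold. -/
def unitDiskBundle {m : ℕ} (M : Type*) [TopologicalSpace M]
    [ChartedSpace (EuclideanSpace ℝ (Fin m)) M]
    [RiemannianBundle (fun x : M => TangentSpace (𝓡 m) x)] : Set (TangentBundle (𝓡 m) M) :=
  {v | ‖v.2‖ ≤ 1}

/-- The unit disk bundle, for the Riemannian metric induced by `ι : W → M`, over the interior of a
set `D ⊆ W`. For `C¹` maps on a set `D` that is the closure of its interior, a supremum over `D`
is the same as the one over the interior, where derivatives are unambiguous. -/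
def inducedUnitDiskBundle {m n : ℕ} {M W : Type*} [TopologicalSpace M]
    [ChartedSpace (EuclideanSpace ℝ (Fin m)) M]
    [RiemannianBundle (fun x : M => TangentSpace (𝓡 m) x)]
    [TopologicalSpace W] [ChartedSpace (EuclideanSpace ℝ (Fin n)) W]
    (ι : W → M) (D : Set W) : Set (TangentBundle (𝓡 n) W) :=
  {v | v.1 ∈ interior D ∧ ‖mfderiv (𝓡 n) (𝓡 m) ι v.1 v.2‖ ≤ 1}

end

noncomputable section

set_option maxSynthPendingDepth 3

set_option linter.unusedSectionVars false

open MeasureTheory Metric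

/-! ### Differentiation under an integral over a compact set -/

section ParametricIntegral

variable {H Y G : Type*} [NormedAddCommGroup H] [NormedSpace ℝ H] [FiniteDimensional ℝ H]
  [TopologicalSpace Y] [SecondCountableTopology Y] [MeasurableSpace Y] [OpensMeasurableSpace Y]
  [NormedAddCommGroup G] [NormedSpace ℝ G]
  {μ : Measure Y} [IsFiniteMeasureOnCompacts μ] {k : Set Y}

/-! Suitable coordinates near `z` turn the statement into one about the zero section of `V × V`,
with `V = ℝⁿ`. The Darboux theorem and a linear change of coordinates carry `Ω` to the standard form
and make the submanifold tangent to `V × 0`. There it is the graph of a `C¹` map `α`; isotropy says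
that `Dα` is symmetric, so the shear `(q, p) ↦ (q, p - α q)` is symplectic and flattens the graph
(`exists_adapted_charts`). Short paths cannot leave the chart, hence small intrinsic disks are
compact and lie in it (`exists_intrinsicDisk_subset`). In the chart `ψ` reads `q ↦ q + v q`, with
`v` small in `C¹` and zero off the disk (`exists_displacement_le`).

To extend `q ↦ q + v q`, take a generating function `F` and the map `(q, p + ∂_q F) ↦ (q + ∂_p F,
p)`. It is a symplectic `C¹` diffeomorphism once `F` is `C²`-small
(`exists_symplectic_of_generating`), and it does what is wanted on the zero section if `∂_q F = 0`
and `∂_p F = v` along `p = 0`. The obvious choice `∑ pᵢ vᵢ(q)` is only `C¹`. The main point is to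
replace `vᵢ(q)` by its average around `q` at scale `pᵢ`, that is, to use `χ(p) ∑ pᵢ ∫ vᵢ(q + pᵢ y)
η(y) dy`. Integration by parts moves a derivative from `vᵢ` to `η` at the cost of a factor `1 / pᵢ`,
which the factor `pᵢ` absorbs: `DF` involves only the values of `v`, and `D²F` at most `Dv`. So `F`
is `C²`, its `C²` size is controlled by the `C¹` size of `v`, and its first derivatives along `p =
0` are those of the naive choice. The averaging radius is at most `‖p‖`, so the support stays near
the disk (`exists_symplectic_extension`).

The result is extended by the identity outside the chart (`exists_symplecto_displacement`). The
Darboux theorem (`exists_darboux`) is proved by Moser's method, the flow coming from the inverse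
function theorem in a space of paths (`exists_flow`). -/

theorem hasFDerivAt_setIntegral_of_continuous {f : H → Y → G} {f' : H → Y → H →L[ℝ] G}
    (hf : Continuous (Function.uncurry f)) (hf' : Continuous (Function.uncurry f'))
    (h : ∀ x y, HasFDerivAt (fun x => f x y) (f' x y) x) (hk : IsCompact k)
    (hkm : MeasurableSet k) (x₀ : H) :
    HasFDerivAt (fun x => ∫ y in k, f x y ∂μ) (∫ y in k, f' x₀ y ∂μ) x₀ := by
  -- Finite dimension makes the unit ball about `x₀` compact, so `f'` is bounded on its product with
  -- `k`; the bound serves as dominating function.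
  obtain ⟨C, hC⟩ := ((isCompact_closedBall x₀ (1 : ℝ)).prod hk).exists_bound_of_continuousOn
    (hf'.continuousOn)
  have hcx : ∀ x, Continuous (f x) := fun x => hf.comp (Continuous.prodMk_right x)
  have hcx' : ∀ x, Continuous (f' x) := fun x => hf'.comp (Continuous.prodMk_right x)
  refine hasFDerivAt_integral_of_dominated_of_fderiv_le (bound := fun _ => C)
    (s := closedBall x₀ 1) (closedBall_mem_nhds x₀ one_pos) ?_ ?_ ?_ ?_ ?_ ?_
  · exact Eventually.of_forall fun x => (hcx x).aestronglyMeasurable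
  · exact (hcx x₀).continuousOn.integrableOn_compact' hk hkm
  · exact (hcx' x₀).aestronglyMeasurable
  · exact (ae_restrict_mem hkm).mono fun y hy x hx => hC (x, y) ⟨hx, hy⟩
  · exact continuousOn_const.integrableOn_compact' hk hkm
  · exact Eventually.of_forall fun y x _ => h x y

theorem contDiff_one_setIntegral_of_continuous [LocallyCompactSpace Y]
    {f : H → Y → G} {f' : H → Y → H →L[ℝ] G}
    (hf : Continuous (Function.uncurry f)) (hf' : Continuous (Function.uncurry f'))
    (h : ∀ x y, HasFDerivAt (fun x => f x y) (f' x y) x) (hk : IsCompact k)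
    (hkm : MeasurableSet k) : ContDiff ℝ 1 (fun x => ∫ y in k, f x y ∂μ) :=
  contDiff_one_iff_hasFDerivAt.2 ⟨_, continuous_parametric_integral_of_continuous hf' hk,
    hasFDerivAt_setIntegral_of_continuous hf hf' h hk hkm⟩

end ParametricIntegral

/-! ### Mollification of a `C¹` function at the scale of a parameter -/

section Mollify

variable {V : Type*} [NormedAddCommGroup V] [InnerProductSpace ℝ V] [FiniteDimensional ℝ V]
  [MeasurableSpace V] [BorelSpace V]

variable (V) in
/-- A smooth bump function of integral one, supported in the unit ball. -/
def unitBump : V → ℝ :=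
  (⟨1 / 2, 1, by norm_num, by norm_num⟩ : ContDiffBump (0 : V)).normed volume

theorem contDiff_unitBump : ContDiff ℝ ∞ (unitBump V) := ContDiffBump.contDiff_normed _

theorem tsupport_unitBump : tsupport (unitBump V) = closedBall 0 1 :=
  ContDiffBump.tsupport_normed_eq _

theorem hasCompactSupport_unitBump : HasCompactSupport (unitBump V) :=
  ContDiffBump.hasCompactSupport_normed _

theorem unitBump_eq_zero {y : V} (hy : y ∉ closedBall (0 : V) 1) : unitBump V y = 0 :=
  image_eq_zero_of_notMem_tsupport (by rwa [tsupport_unitBump])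

theorem fderiv_unitBump_eq_zero {y : V} (hy : y ∉ closedBall (0 : V) 1) :
    fderiv ℝ (unitBump V) y = 0 :=
  image_eq_zero_of_notMem_tsupport fun h =>
    hy (tsupport_unitBump (V := V) ▸ tsupport_fderiv_subset ℝ h)

theorem integral_unitBump : ∫ y, unitBump V y = 1 := ContDiffBump.integral_normed _

theorem setIntegral_unitBump : ∫ y in closedBall (0 : V) 1, unitBump V y = 1 := by
  rw [setIntegral_eq_integral_of_forall_compl_eq_zero fun y hy => unitBump_eq_zero hy,
    integral_unitBump]

/-- `t` times the mean of `u` at the scale `t` around `q`. -/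
def mollify (u : V → ℝ) (x : V × ℝ) : ℝ :=
  x.2 * ∫ y in closedBall (0 : V) 1, u (x.1 + x.2 • y) * unitBump V y

variable (V) in
/-- The kernel of the derivative of `mollify u`. -/
def mollifyKernel (y : V) : (V × ℝ) →L[ℝ] ℝ :=
  ((1 - Module.finrank ℝ V) * unitBump V y) • ContinuousLinearMap.snd ℝ _ ℝ -
    (fderiv ℝ (unitBump V) y).comp
      (ContinuousLinearMap.fst ℝ _ ℝ + (ContinuousLinearMap.snd ℝ _ ℝ).smulRight y)

theorem mollifyKernel_apply (y h : V) (τ : ℝ) : mollifyKernel V y (h, τ) =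
    (1 - Module.finrank ℝ V) * unitBump V y * τ - fderiv ℝ (unitBump V) y (h + τ • y) := by
  simp [mollifyKernel]

theorem continuous_mollifyKernel : Continuous (mollifyKernel V) := by
  have h1 : Continuous (unitBump V) := contDiff_unitBump.continuous
  have h2 : Continuous (fderiv ℝ (unitBump V)) :=
    contDiff_unitBump.continuous_fderiv (by simp)
  unfold mollifyKernel
  refine ((continuous_const.mul h1).smul continuous_const).sub (h2.clm_comp ?_)
  refine continuous_const.add ?_
  exact ((ContinuousLinearMap.smulRightL ℝ (V × ℝ) V) (ContinuousLinearMap.snd ℝ V ℝ)).continuous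

theorem hasFDerivAt_comp_scale {u : V → ℝ} (hu : ContDiff ℝ 1 u) (y : V) (x : V × ℝ) :
    HasFDerivAt (fun x : V × ℝ => u (x.1 + x.2 • y))
      ((fderiv ℝ u (x.1 + x.2 • y)).comp
        (ContinuousLinearMap.fst ℝ _ ℝ + (ContinuousLinearMap.snd ℝ _ ℝ).smulRight y)) x := by
  have h1 : HasFDerivAt (fun x : V × ℝ => x.1 + x.2 • y)
      (ContinuousLinearMap.fst ℝ _ ℝ + (ContinuousLinearMap.snd ℝ _ ℝ).smulRight y) x :=
    (ContinuousLinearMap.fst ℝ V ℝ + (ContinuousLinearMap.snd ℝ V ℝ).smulRight y).hasFDerivAt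
  exact ((hu.differentiable one_ne_zero) (x.1 + x.2 • y)).hasFDerivAt.comp x h1

/-- Integration by parts: the derivative of `y ↦ u (q + t • y)` is `t` times that of `u`, so the
factor `t` is exactly what allows the derivative to be moved off `u`. -/
theorem integral_comp_scale_mul_fderiv {u : V → ℝ} (hu : ContDiff ℝ 1 u) {g : V → ℝ}
    (hg : ContDiff ℝ 1 g) (hgc : HasCompactSupport g) (q h : V) (t : ℝ) :
    ∫ y, u (q + t • y) * fderiv ℝ g y h = - ∫ y, t * fderiv ℝ u (q + t • y) h * g y := by
  have hf : ∀ y, HasFDerivAt (fun y => u (q + t • y)) (t • fderiv ℝ u (q + t • y)) y := by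
    intro y
    have h1 : HasFDerivAt (fun y : V => q + t • y) (t • ContinuousLinearMap.id ℝ V) y :=
      ((hasFDerivAt_id y).const_smul t).const_add q
    have h2 := ((hu.differentiable one_ne_zero) (q + t • y)).hasFDerivAt.comp y h1
    refine h2.congr_fderiv ?_
    ext v; simp
  have hcu : Continuous fun y => u (q + t • y) := by have := hu.continuous; fun_prop
  have hcu' : Continuous fun y => fderiv ℝ u (q + t • y) := by
    have := hu.continuous_fderiv one_ne_zero; fun_prop
  have hcg' : Continuous (fderiv ℝ g) := hg.continuous_fderiv one_ne_zero
  have hcg := hg.continuous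
  have := integral_bilinear_hasFDerivAt_right_eq_neg_left_of_integrable (μ := volume)
    (B := ContinuousLinearMap.mul ℝ ℝ) (f := fun y => u (q + t • y))
    (f' := fun y => t • fderiv ℝ u (q + t • y)) (g := g) (g' := fderiv ℝ g) (v := h)
    ?_ ?_ ?_ (fun y _ => hf y) (fun y _ => ((hg.differentiable one_ne_zero) y).hasFDerivAt)
  · simpa using this
  · refine Continuous.integrable_of_hasCompactSupport ?_ hgc.mul_left
    simp only [ContinuousLinearMap.mul_apply']
    fun_prop
  · refine Continuous.integrable_of_hasCompactSupport ?_
      (hgc.fderiv_apply (𝕜 := ℝ) h).mul_left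
    simp only [ContinuousLinearMap.mul_apply']
    fun_prop
  · refine Continuous.integrable_of_hasCompactSupport ?_ hgc.mul_left
    simp only [ContinuousLinearMap.mul_apply']
    fun_prop

/-- This is integration by parts along the vector field `y ↦ h + τ • y`; its divergence `τ * dim V`
produces the last term. In coordinates the linear part is handled with the test functions `⟨b j, y⟩
* unitBump V y`. -/
theorem integral_comp_scale_mul_unitBump {u : V → ℝ} (hu : ContDiff ℝ 1 u) (q h : V) (t τ : ℝ) :
    ∫ y, t * fderiv ℝ u (q + t • y) (h + τ • y) * unitBump V y =
      - ∫ y, u (q + t • y) *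
        (fderiv ℝ (unitBump V) y (h + τ • y) + Module.finrank ℝ V * τ * unitBump V y) := by
  have hη : ContDiff ℝ 1 (unitBump V) := contDiff_unitBump.of_le (by simp)
  have hηc : HasCompactSupport (unitBump V) := hasCompactSupport_unitBump
  have hcη := hη.continuous
  have hcη' := hη.continuous_fderiv one_ne_zero
  have hcu : Continuous fun y => u (q + t • y) := by have := hu.continuous; fun_prop
  have hcu' : Continuous fun y => fderiv ℝ u (q + t • y) := by
    have := hu.continuous_fderiv one_ne_zero; fun_prop
  let b := stdOrthonormalBasis ℝ V
  let g : Fin (Module.finrank ℝ V) → V → ℝ := fun j y => inner ℝ (b j) y * unitBump V y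
  have hg : ∀ j, ContDiff ℝ 1 (g j) := fun j => (contDiff_const.inner ℝ contDiff_id).mul hη
  have hgc : ∀ j, HasCompactSupport (g j) := fun j => hηc.mul_left
  have hg' : ∀ j y, fderiv ℝ (g j) y (b j) =
      unitBump V y + inner ℝ (b j) y * fderiv ℝ (unitBump V) y (b j) := by
    intro j y
    have h1 : HasFDerivAt (fun y : V => inner ℝ (b j) y) (innerSL ℝ (b j)) y :=
      (innerSL ℝ (b j)).hasFDerivAt
    have h2 := h1.mul ((hη.differentiable one_ne_zero) y).hasFDerivAt
    rw [show fderiv ℝ (g j) y = _ from h2.fderiv]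
    simp [add_comm]
  have hsum : ∀ (L : V →L[ℝ] ℝ) (y : V), L y = ∑ j, inner ℝ (b j) y * L (b j) := by
    intro L y
    conv_lhs => rw [← b.sum_repr' y]
    simp
  have e1 : ∀ y, t * fderiv ℝ u (q + t • y) (h + τ • y) * unitBump V y =
      t * fderiv ℝ u (q + t • y) h * unitBump V y +
        ∑ j, τ * (t * fderiv ℝ u (q + t • y) (b j) * g j y) := by
    intro y
    rw [map_add, map_smul, smul_eq_mul, hsum _ y]
    simp only [g, Finset.mul_sum, mul_add, add_mul, Finset.sum_mul]
    congr 1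
    exact Finset.sum_congr rfl fun j _ => by ring
  have e2 : ∀ y, u (q + t • y) *
        (fderiv ℝ (unitBump V) y (h + τ • y) + Module.finrank ℝ V * τ * unitBump V y) =
      u (q + t • y) * fderiv ℝ (unitBump V) y h +
        ∑ j, τ * (u (q + t • y) * fderiv ℝ (g j) y (b j)) := by
    intro y
    rw [map_add, map_smul, smul_eq_mul, hsum _ y]
    simp only [hg', mul_add, Finset.sum_add_distrib, Finset.mul_sum]
    simp only [Finset.sum_const, Finset.card_univ, Fintype.card_fin, nsmul_eq_mul]
    rw [add_assoc]
    congr 1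
    rw [add_comm]
    congr 1
    · ring
    · exact Finset.sum_congr rfl fun j _ => by ring
  have i1 : ∀ {k : V → ℝ} (_ : Continuous k) (_ : HasCompactSupport k) (w : V),
      Integrable fun y => t * fderiv ℝ u (q + t • y) w * k y := fun hk hkc w =>
    Continuous.integrable_of_hasCompactSupport (by fun_prop) hkc.mul_left
  have i2 : ∀ {k : V → ℝ} (_ : ContDiff ℝ 1 k) (_ : HasCompactSupport k) (w : V),
      Integrable fun y => u (q + t • y) * fderiv ℝ k y w := fun hk hkc w => by
    have := hk.continuous_fderiv one_ne_zero
    exact Continuous.integrable_of_hasCompactSupport (by fun_prop)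
      (hkc.fderiv_apply (𝕜 := ℝ) w).mul_left
  simp only [e1, e2]
  rw [integral_add (i1 hcη hηc h) (integrable_finsetSum _ fun j _ =>
      (i1 (hg j).continuous (hgc j) _).const_mul _),
    integral_add (i2 hη hηc h) (integrable_finsetSum _ fun j _ =>
      (i2 (hg j) (hgc j) _).const_mul _),
    integral_finsetSum _ (fun j _ => (i1 (hg j).continuous (hgc j) _).const_mul _),
    integral_finsetSum _ (fun j _ => (i2 (hg j) (hgc j) _).const_mul _),
    integral_comp_scale_mul_fderiv hu hη hηc]
  simp only [integral_const_mul]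
  rw [Finset.sum_congr rfl fun j _ =>
    congrArg (τ * ·) (integral_comp_scale_mul_fderiv hu (hg j) (hgc j) q (b j) t)]
  simp [add_comm]

theorem integrableOn_unitBall {X : Type*} [NormedAddCommGroup X] {k : V → X}
    (hk : Continuous k) : IntegrableOn k (closedBall 0 1) :=
  hk.continuousOn.integrableOn_compact' (isCompact_closedBall _ _) measurableSet_closedBall

/-- The gain of one derivative: after integration by parts the formula contains `u` but not `fderiv
ℝ u`, so it can be differentiated once more although `u` is only `C¹`. -/
theorem hasFDerivAt_mollify {u : V → ℝ} (hu : ContDiff ℝ 1 u) (x : V × ℝ) :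
    HasFDerivAt (mollify u)
      (∫ y in closedBall (0 : V) 1, u (x.1 + x.2 • y) • mollifyKernel V y) x := by
  have hη : ContDiff ℝ 1 (unitBump V) := contDiff_unitBump.of_le (by simp)
  have hcη := hη.continuous
  have hcu := hu.continuous
  have hcu' := hu.continuous_fderiv one_ne_zero
  have hcη' := hη.continuous_fderiv one_ne_zero
  have hck := continuous_mollifyKernel (V := V)
  let P : V → (V × ℝ) →L[ℝ] V := fun y =>
    ContinuousLinearMap.fst ℝ V ℝ + (ContinuousLinearMap.snd ℝ V ℝ).smulRight y
  have hP : Continuous P := continuous_const.add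
    ((ContinuousLinearMap.smulRightL ℝ (V × ℝ) V) (ContinuousLinearMap.snd ℝ V ℝ)).continuous
  have h1 := hasFDerivAt_setIntegral_of_continuous (μ := volume) (k := closedBall (0 : V) 1)
    (f := fun (x : V × ℝ) y => u (x.1 + x.2 • y) * unitBump V y)
    (f' := fun x y => unitBump V y • (fderiv ℝ u (x.1 + x.2 • y)).comp (P y))
    (by simp only [Function.uncurry_def]; fun_prop)
    (by
      simp only [Function.uncurry_def]
      refine Continuous.fun_smul (by fun_prop) (Continuous.clm_comp (by fun_prop) (by fun_prop)))
    (fun x y => (hasFDerivAt_comp_scale hu y x).mul_const _) (isCompact_closedBall _ _)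
    measurableSet_closedBall x
  have h2 := (ContinuousLinearMap.snd ℝ V ℝ).hasFDerivAt (x := x) |>.mul h1
  refine h2.congr_fderiv ?_
  refine ContinuousLinearMap.ext fun ⟨h, τ⟩ => ?_
  have hcP : Continuous fun y => unitBump V y • (fderiv ℝ u (x.1 + x.2 • y)).comp (P y) :=
    Continuous.fun_smul (by fun_prop) (Continuous.clm_comp (by fun_prop) (by fun_prop))
  have key := integral_comp_scale_mul_unitBump hu x.1 h x.2 τ
  have k1 := setIntegral_eq_integral_of_forall_compl_eq_zero (μ := volume)
    (s := closedBall (0 : V) 1)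
    (f := fun y => x.2 * fderiv ℝ u (x.1 + x.2 • y) (h + τ • y) * unitBump V y)
    (fun y hy => by simp [unitBump_eq_zero hy])
  have k2 := setIntegral_eq_integral_of_forall_compl_eq_zero (μ := volume)
    (s := closedBall (0 : V) 1)
    (f := fun y => u (x.1 + x.2 • y) *
      (fderiv ℝ (unitBump V) y (h + τ • y) + Module.finrank ℝ V * τ * unitBump V y))
    (fun y hy => by simp [unitBump_eq_zero hy, fderiv_unitBump_eq_zero hy])
  rw [← k1, ← k2] at key
  have hcK : Continuous fun y => u (x.1 + x.2 • y) • mollifyKernel V y :=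
    Continuous.fun_smul (by fun_prop) (by fun_prop)
  rw [ContinuousLinearMap.integral_apply (integrableOn_unitBall hcK).integrable]
  simp only [add_apply, smul_apply, smul_eq_mul]
  rw [ContinuousLinearMap.integral_apply (integrableOn_unitBall hcP).integrable]
  simp only [smul_apply, ContinuousLinearMap.comp_apply, P, smul_eq_mul, mollifyKernel_apply,
    add_apply, ContinuousLinearMap.coe_fst', ContinuousLinearMap.coe_snd',
    ContinuousLinearMap.smulRight_apply]
  have key2 : x.2 * ∫ y in closedBall (0 : V) 1,
      unitBump V y * fderiv ℝ u (x.1 + x.2 • y) (h + τ • y) =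
      - ∫ y in closedBall (0 : V) 1, u (x.1 + x.2 • y) *
        (fderiv ℝ (unitBump V) y (h + τ • y) + Module.finrank ℝ V * τ * unitBump V y) := by
    rw [← key, ← integral_const_mul]
    exact integral_congr_ae (Eventually.of_forall fun y => by ring)
  rw [key2, ← integral_neg, ← integral_mul_const, ← integral_add
    (integrableOn_unitBall (by fun_prop)) (integrableOn_unitBall (by fun_prop))]
  exact integral_congr_ae (Eventually.of_forall fun y => by ring)

theorem exists_mollifyKernel_bound :
    ∃ C : ℝ, 0 ≤ C ∧ (∀ y ∈ closedBall (0 : V) 1, ‖mollifyKernel V y‖ ≤ C) ∧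
      ∀ y ∈ closedBall (0 : V) 1, ‖unitBump V y‖ ≤ C := by
  obtain ⟨C₁, h₁⟩ := (isCompact_closedBall (0 : V) 1).exists_bound_of_continuousOn
    (continuous_mollifyKernel (V := V)).continuousOn
  obtain ⟨C₂, h₂⟩ := (isCompact_closedBall (0 : V) 1).exists_bound_of_continuousOn
    (contDiff_unitBump (V := V)).continuous.continuousOn
  exact ⟨max 0 (max C₁ C₂), le_max_left _ _,
    fun y hy => (h₁ y hy).trans ((le_max_left _ _).trans (le_max_right _ _)),
    fun y hy => (h₂ y hy).trans ((le_max_right _ _).trans (le_max_right _ _))⟩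

/-- The derivative of the derivative of `mollify u`. -/
theorem hasFDerivAt_fderiv_mollify {u : V → ℝ} (hu : ContDiff ℝ 1 u) (x : V × ℝ) :
    HasFDerivAt (fderiv ℝ (mollify u))
      (∫ y in closedBall (0 : V) 1, ((fderiv ℝ u (x.1 + x.2 • y)).comp
        (ContinuousLinearMap.fst ℝ V ℝ + (ContinuousLinearMap.snd ℝ V ℝ).smulRight y)).smulRight
          (mollifyKernel V y)) x ∧ ContDiff ℝ 1 (fderiv ℝ (mollify u)) := by
  have hcu := hu.continuous
  have hcu' := hu.continuous_fderiv one_ne_zero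
  have hck := continuous_mollifyKernel (V := V)
  have hP : Continuous fun y : V =>
      ContinuousLinearMap.fst ℝ V ℝ + (ContinuousLinearMap.snd ℝ V ℝ).smulRight y :=
    continuous_const.add
      ((ContinuousLinearMap.smulRightL ℝ (V × ℝ) V) (ContinuousLinearMap.snd ℝ V ℝ)).continuous
  have e : fderiv ℝ (mollify u) = fun x : V × ℝ =>
      ∫ y in closedBall (0 : V) 1, u (x.1 + x.2 • y) • mollifyKernel V y :=
    funext fun x => (hasFDerivAt_mollify hu x).fderiv
  have c1 : Continuous (Function.uncurry fun (x : V × ℝ) (y : V) =>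
      u (x.1 + x.2 • y) • mollifyKernel V y) :=
    Continuous.fun_smul (by fun_prop) (by fun_prop)
  have c2 : Continuous (Function.uncurry fun (x : V × ℝ) (y : V) =>
      ((fderiv ℝ u (x.1 + x.2 • y)).comp (ContinuousLinearMap.fst ℝ V ℝ +
        (ContinuousLinearMap.snd ℝ V ℝ).smulRight y)).smulRight (mollifyKernel V y)) := by
    have h1 : Continuous fun z : (V × ℝ) × V => (fderiv ℝ u (z.1.1 + z.1.2 • z.2)).comp
        (ContinuousLinearMap.fst ℝ V ℝ + (ContinuousLinearMap.snd ℝ V ℝ).smulRight z.2) :=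
      Continuous.clm_comp (by fun_prop) (hP.comp continuous_snd)
    have h2 : Continuous fun z : (V × ℝ) × V => mollifyKernel V z.2 := hck.comp continuous_snd
    exact ((ContinuousLinearMap.smulRightL ℝ (V × ℝ) ((V × ℝ) →L[ℝ] ℝ)).continuous.comp
      h1).clm_apply h2
  have hd := fun (x : V × ℝ) (y : V) => (hasFDerivAt_comp_scale hu y x).smul_const
    (mollifyKernel V y)
  rw [e]
  exact ⟨hasFDerivAt_setIntegral_of_continuous c1 c2 hd (isCompact_closedBall _ _)
      measurableSet_closedBall x,
    contDiff_one_setIntegral_of_continuous c1 c2 hd (isCompact_closedBall _ _)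
      measurableSet_closedBall⟩

theorem contDiff_mollify {u : V → ℝ} (hu : ContDiff ℝ 1 u) : ContDiff ℝ 2 (mollify u) := by
  rw [show (2 : WithTop ℕ∞) = 1 + 1 by norm_num, contDiff_succ_iff_fderiv]
  exact ⟨fun x => (hasFDerivAt_mollify hu x).differentiableAt, by simp,
    (hasFDerivAt_fderiv_mollify hu 0).2⟩

-- The first derivative is a kernel integral of `u` and the second a kernel integral of `Du`, so the
-- `C¹` size of `u` controls the `C²` size of `mollify u`. The bound on the scale matters only at
-- order zero.
variable (V) in
theorem exists_iteratedFDeriv_mollify_le : ∃ C : ℝ, 0 ≤ C ∧ ∀ (u : V → ℝ) (δ : ℝ), 0 ≤ δ →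
    ContDiff ℝ 1 u → (∀ q, |u q| ≤ δ) → (∀ q, ‖fderiv ℝ u q‖ ≤ δ) →
    ∀ x : V × ℝ, |x.2| ≤ 1 → ∀ k ≤ 2, ‖iteratedFDeriv ℝ k (mollify u) x‖ ≤ C * δ := by
  obtain ⟨C, hC0, hC, hC'⟩ := exists_mollifyKernel_bound (V := V)
  set m := (volume (closedBall (0 : V) 1)).toReal with hm
  have hfin : volume (closedBall (0 : V) 1) < ⊤ := (isCompact_closedBall _ _).measure_lt_top
  have hm0 : 0 ≤ m := ENNReal.toReal_nonneg
  refine ⟨2 * C * m, by positivity, fun u δ hδ hu hu0 hu1 x hx k hk => ?_⟩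
  have hb : 0 ≤ C * δ * m := by positivity
  interval_cases k
  · rw [norm_iteratedFDeriv_zero, mollify, norm_mul]
    have : ‖∫ y in closedBall (0 : V) 1, u (x.1 + x.2 • y) * unitBump V y‖ ≤ δ * C * m :=
      norm_setIntegral_le_of_norm_le_const hfin fun y hy => by
        rw [norm_mul]
        exact mul_le_mul (hu0 _) (hC' y hy) (norm_nonneg _) hδ
    calc _ ≤ 1 * (δ * C * m) := mul_le_mul hx this (norm_nonneg _) zero_le_one
      _ ≤ _ := by linarith
  · rw [← norm_iteratedFDeriv_fderiv, norm_iteratedFDeriv_zero, (hasFDerivAt_mollify hu x).fderiv]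
    have : ‖∫ y in closedBall (0 : V) 1, u (x.1 + x.2 • y) • mollifyKernel V y‖ ≤ δ * C * m :=
      norm_setIntegral_le_of_norm_le_const hfin fun y hy => by
        rw [norm_smul]
        exact mul_le_mul (hu0 _) (hC y hy) (norm_nonneg _) hδ
    linarith
  · rw [← norm_iteratedFDeriv_fderiv, ← norm_iteratedFDeriv_fderiv, norm_iteratedFDeriv_zero,
      (hasFDerivAt_fderiv_mollify hu x).1.fderiv]
    refine (norm_setIntegral_le_of_norm_le_const (C := δ * 2 * C) hfin fun y hy => ?_).trans
      (le_of_eq (by rw [← Measure.real] at hm; rw [← hm]; ring))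
    rw [ContinuousLinearMap.norm_smulRight_apply]
    refine mul_le_mul ?_ (hC y hy) (norm_nonneg _) (by positivity)
    refine (ContinuousLinearMap.opNorm_comp_le _ _).trans ?_
    refine mul_le_mul (hu1 _) ?_ (norm_nonneg _) hδ
    refine (norm_add_le _ _).trans ?_
    rw [ContinuousLinearMap.norm_smulRight_apply]
    have h1 := ContinuousLinearMap.norm_fst_le (𝕜 := ℝ) (E := V) (F := ℝ)
    have h2 := ContinuousLinearMap.norm_snd_le (𝕜 := ℝ) (E := V) (F := ℝ)
    have h3 : ‖y‖ ≤ 1 := by simpa using hy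
    have h4 := mul_le_mul h2 h3 (norm_nonneg _) zero_le_one
    linarith

theorem mollify_zero (u : V → ℝ) (q : V) : mollify u (q, 0) = 0 := by simp [mollify]

/-- At scale `0` the derivative formula sees only the value `u q`, so `u` may be replaced by this
constant, and the mollification of a constant is linear in the scale. -/
theorem fderiv_mollify_zero {u : V → ℝ} (hu : ContDiff ℝ 1 u) (q h : V) (τ : ℝ) :
    fderiv ℝ (mollify u) (q, 0) (h, τ) = τ * u q := by
  have h1 := (hasFDerivAt_mollify hu (q, 0)).fderiv
  have h2 := (hasFDerivAt_mollify (V := V) (contDiff_const (c := u q)) (q, 0)).fderiv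
  have h3 : mollify (fun _ : V => u q) = fun x => u q * ContinuousLinearMap.snd ℝ V ℝ x := by
    funext x
    simp [mollify, integral_const_mul, setIntegral_unitBump, mul_comm]
  have h4 := (ContinuousLinearMap.snd ℝ V ℝ).hasFDerivAt (x := (q, (0 : ℝ))) |>.const_mul (u q)
  rw [h3, h4.fderiv] at h2
  rw [h1]
  simp only [zero_smul, add_zero]
  rw [← h2]
  simp [mul_comm]

theorem mollify_eq_zero {u : V → ℝ} {x : V × ℝ}
    (h : ∀ y ∈ closedBall (0 : V) 1, u (x.1 + x.2 • y) = 0) : mollify u x = 0 := by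
  rw [mollify, setIntegral_congr_fun measurableSet_closedBall
    (g := fun _ => (0 : ℝ)) fun y hy => by simp [h y hy]]
  simp

end Mollify

/-! ### Symplectic diffeomorphisms of `V × V` from generating functions -/

section Generating

variable {V : Type*} [NormedAddCommGroup V] [InnerProductSpace ℝ V]

/-- The standard symplectic form of `V × V`. -/
def stdSymp (x y : V × V) : ℝ := inner ℝ x.1 y.2 - inner ℝ x.2 y.1

/-- A perturbation of the identity by a contraction is a homeomorphism, and the Neumann series
inverts its derivative, which makes the inverse `C¹`. -/
theorem exists_homeomorph_id_add {E : Type*} [NormedAddCommGroup E] [NormedSpace ℝ E]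
    [CompleteSpace E] {f : E → E} (hf : ContDiff ℝ 1 f) {c : ℝ} (hc0 : 0 ≤ c) (hc : c < 1)
    (hfc : ∀ x, ‖fderiv ℝ f x‖ ≤ c) :
    ∃ e : E ≃ₜ E, (∀ x, e x = x + f x) ∧ ContDiff ℝ 1 e.symm := by
  lift c to NNReal using hc0
  have hlip : LipschitzWith c f :=
    lipschitzWith_of_nnnorm_fderiv_le (hf.differentiable one_ne_zero) fun x => hfc x
  have happ : ApproximatesLinearOn (fun x => x + f x)
      ((ContinuousLinearEquiv.refl ℝ E : E ≃L[ℝ] E) : E →L[ℝ] E) univ c := by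
    intro x _ y _
    simpa [add_sub_add_left_eq_sub, add_sub_add_comm] using hlip.norm_sub_le x y
  -- The identity has norm `1` only on a nontrivial space.
  have hcc : Subsingleton E ∨
      c < ‖((ContinuousLinearEquiv.refl ℝ E).symm : E →L[ℝ] E)‖₊⁻¹ := by
    rcases subsingleton_or_nontrivial E with h | h
    · exact Or.inl h
    · right
      have : ‖((ContinuousLinearEquiv.refl ℝ E).symm : E →L[ℝ] E)‖₊ = 1 := by
        ext; simp
      rw [this, inv_one]
      exact_mod_cast hc
  let e := happ.toHomeomorph _ hcc
  have he : ∀ x, e x = x + f x := fun x => rfl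
  have hunit : ∀ x, IsUnit (1 + fderiv ℝ f x) := by
    intro x
    have := isUnit_one_sub_of_norm_lt_one (x := -fderiv ℝ f x)
      (by rw [norm_neg]; exact (hfc x).trans_lt hc)
    simpa using this
  refine ⟨e, he, e.contDiff_symm
    (f₀' := fun x => ContinuousLinearEquiv.ofUnit (hunit x).unit) (fun x => ?_) ?_⟩
  · have h1 := (hasFDerivAt_id x).add ((hf.differentiable one_ne_zero) x).hasFDerivAt
    exact h1
  · exact contDiff_id.add hf

variable [FiniteDimensional ℝ V]

variable (V) in
/-- The vector representing a linear form. -/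
def riesz : (V →L[ℝ] ℝ) →L[ℝ] V :=
  LinearMap.mkContinuous
    { toFun := fun L => (InnerProductSpace.toDual ℝ V).symm L
      map_add' := fun L L' => map_add _ L L'
      map_smul' := fun c L => by simp } 1 fun L => by simp

theorem inner_riesz (L : V →L[ℝ] ℝ) (w : V) : inner ℝ (riesz V L) w = L w :=
  InnerProductSpace.toDual_symm_apply

theorem norm_riesz (L : V →L[ℝ] ℝ) : ‖riesz V L‖ = ‖L‖ := LinearIsometryEquiv.norm_map _ _

variable (V) in
/-- The first component of the gradient with derivative `L`. -/
def gradFst : ((V × V) →L[ℝ] ℝ) →L[ℝ] V :=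
  (riesz V).comp ((ContinuousLinearMap.compL ℝ V (V × V) ℝ).flip (ContinuousLinearMap.inl ℝ V V))

variable (V) in
/-- The second component of the gradient with derivative `L`. -/
def gradSnd : ((V × V) →L[ℝ] ℝ) →L[ℝ] V :=
  (riesz V).comp ((ContinuousLinearMap.compL ℝ V (V × V) ℝ).flip (ContinuousLinearMap.inr ℝ V V))

theorem inner_gradFst (L : (V × V) →L[ℝ] ℝ) (w : V) : inner ℝ (gradFst V L) w = L (w, 0) := by
  simp [gradFst, inner_riesz]

theorem inner_gradSnd (L : (V × V) →L[ℝ] ℝ) (w : V) : inner ℝ (gradSnd V L) w = L (0, w) := by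
  simp [gradSnd, inner_riesz]

theorem norm_gradFst_le (L : (V × V) →L[ℝ] ℝ) : ‖gradFst V L‖ ≤ ‖L‖ := by
  have : ‖gradFst V L‖ = ‖L.comp (ContinuousLinearMap.inl ℝ V V)‖ := norm_riesz _
  rw [this]
  refine (ContinuousLinearMap.opNorm_comp_le _ _).trans ?_
  exact mul_le_of_le_one_right (norm_nonneg _) (ContinuousLinearMap.norm_inl_le_one ℝ V V)

theorem norm_gradSnd_le (L : (V × V) →L[ℝ] ℝ) : ‖gradSnd V L‖ ≤ ‖L‖ := by
  have : ‖gradSnd V L‖ = ‖L.comp (ContinuousLinearMap.inr ℝ V V)‖ := norm_riesz _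
  rw [this]
  refine (ContinuousLinearMap.opNorm_comp_le _ _).trans ?_
  exact mul_le_of_le_one_right (norm_nonneg _) (ContinuousLinearMap.norm_inr_le_one ℝ V V)

/-- `φ = eB ∘ eA⁻¹`, where `eA` shifts `p` by `∂_q F` and `eB` shifts `q` by `∂_p F`. The pull-backs
of the standard form by `eA` and `eB` differ by the antisymmetrization of `D²F`, which vanishes. No
derivative of `F` beyond the second is needed for `φ` to be `C¹`. -/
theorem exists_symplectic_of_generating {F : V × V → ℝ} (hF : ContDiff ℝ 2 F) {c : ℝ}
    (hc0 : 0 ≤ c) (hc : c ≤ 1 / 2) (h1 : ∀ x, ‖fderiv ℝ F x‖ ≤ c)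
    (h2 : ∀ x, ‖fderiv ℝ (fderiv ℝ F) x‖ ≤ c) :
    ∃ φ : (V × V) ≃ₜ (V × V), ContDiff ℝ 1 φ ∧ ContDiff ℝ 1 φ.symm ∧
      (∀ x u w, stdSymp (fderiv ℝ φ x u) (fderiv ℝ φ x w) = stdSymp u w) ∧
      (∀ x, ‖φ x - x‖ ≤ c) ∧ (∀ x w, ‖fderiv ℝ φ x w - w‖ ≤ 2 * c * ‖w‖) ∧
      ∀ x, φ (x.1, x.2 + gradFst V (fderiv ℝ F x)) = (x.1 + gradSnd V (fderiv ℝ F x), x.2) := by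
  have hF' : ContDiff ℝ 1 (fderiv ℝ F) := hF.fderiv_right (by norm_num)
  let Λ₁ : ((V × V) →L[ℝ] ℝ) →L[ℝ] V × V := (ContinuousLinearMap.inr ℝ V V).comp (gradFst V)
  let Λ₂ : ((V × V) →L[ℝ] ℝ) →L[ℝ] V × V := (ContinuousLinearMap.inl ℝ V V).comp (gradSnd V)
  have e1 : ∀ L, Λ₁ L = (0, gradFst V L) := fun L => rfl
  have e2 : ∀ L, Λ₂ L = (gradSnd V L, 0) := fun L => rfl
  have n1 : ∀ L, ‖Λ₁ L‖ ≤ ‖L‖ := fun L => by simpa [e1, Prod.norm_def] using norm_gradFst_le L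
  have n2 : ∀ L, ‖Λ₂ L‖ ≤ ‖L‖ := fun L => by simpa [e2, Prod.norm_def] using norm_gradSnd_le L
  have n12 : ∀ L, ‖Λ₂ L - Λ₁ L‖ ≤ ‖L‖ := fun L => by
    simpa [e1, e2, Prod.norm_def] using And.intro (norm_gradSnd_le L) (norm_gradFst_le L)
  let D := fun x => fderiv ℝ (fderiv ℝ F) x
  have hD : ∀ x, HasFDerivAt (fderiv ℝ F) (D x) x := fun x =>
    ((hF'.differentiable one_ne_zero) x).hasFDerivAt
  have hd1 : ∀ x, HasFDerivAt (fun x => Λ₁ (fderiv ℝ F x)) (Λ₁.comp (D x)) x := fun x =>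
    Λ₁.hasFDerivAt.comp x (hD x)
  have hd2 : ∀ x, HasFDerivAt (fun x => Λ₂ (fderiv ℝ F x)) (Λ₂.comp (D x)) x := fun x =>
    Λ₂.hasFDerivAt.comp x (hD x)
  have hDle : ∀ x w, ‖D x w‖ ≤ c * ‖w‖ := fun x w => (D x).le_of_opNorm_le (h2 x) w
  obtain ⟨eA, hA, hA'⟩ := exists_homeomorph_id_add (f := fun x => Λ₁ (fderiv ℝ F x))
    (Λ₁.contDiff.comp hF') hc0 (by linarith) fun x => by
      rw [(hd1 x).fderiv]
      exact ContinuousLinearMap.opNorm_le_bound _ hc0 fun w => (n1 _).trans (hDle x w)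
  obtain ⟨eB, hB, hB'⟩ := exists_homeomorph_id_add (f := fun x => Λ₂ (fderiv ℝ F x))
    (Λ₂.contDiff.comp hF') hc0 (by linarith) fun x => by
      rw [(hd2 x).fderiv]
      exact ContinuousLinearMap.opNorm_le_bound _ hc0 fun w => (n2 _).trans (hDle x w)
  have hAd : ∀ x, HasFDerivAt eA (ContinuousLinearMap.id ℝ _ + Λ₁.comp (D x)) x := fun x => by
    rw [show (eA : V × V → V × V) = fun x => x + Λ₁ (fderiv ℝ F x) from funext hA]
    exact (hasFDerivAt_id x).add (hd1 x)
  have hBd : ∀ x, HasFDerivAt eB (ContinuousLinearMap.id ℝ _ + Λ₂.comp (D x)) x := fun x => by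
    rw [show (eB : V × V → V × V) = fun x => x + Λ₂ (fderiv ℝ F x) from funext hB]
    exact (hasFDerivAt_id x).add (hd2 x)
  have hAc : ContDiff ℝ 1 eA := by
    rw [show (eA : V × V → V × V) = fun x => x + Λ₁ (fderiv ℝ F x) from funext hA]
    exact contDiff_id.add (Λ₁.contDiff.comp hF')
  have hBc : ContDiff ℝ 1 eB := by
    rw [show (eB : V × V → V × V) = fun x => x + Λ₂ (fderiv ℝ F x) from funext hB]
    exact contDiff_id.add (Λ₂.contDiff.comp hF')
  let φ := eA.symm.trans eB
  have hφA : ∀ y, φ (eA y) = eB y := fun y => by simp [φ]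
  have hφc : ContDiff ℝ 1 φ := hBc.comp hA'
  have hφd : ∀ y w, fderiv ℝ φ (eA y) (w + Λ₁ (D y w)) = w + Λ₂ (D y w) := by
    intro y w
    have h3 := ((hφc.differentiable one_ne_zero) (eA y)).hasFDerivAt.comp y (hAd y)
    rw [show φ ∘ eA = eB from funext hφA] at h3
    have := congrArg (fun L => L w) (h3.unique (hBd y))
    simpa using this
  -- From `‖u‖ ≤ ‖w‖ + c * ‖u‖` and `c ≤ 1 / 2`; this is the source of the factor `2` in the
  -- estimate of the derivative.
  have hsurj : ∀ y w, ∃ u, u + Λ₁ (D y u) = w ∧ ‖u‖ ≤ 2 * ‖w‖ := by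
    intro y w
    have h3 := ((hA'.differentiable one_ne_zero) (eA y)).hasFDerivAt
    have h4 := (hAd (eA.symm (eA y))).comp (eA y) h3
    rw [show eA ∘ eA.symm = id from funext eA.apply_symm_apply, eA.symm_apply_apply] at h4
    have h5 := congrArg (fun L => L w) (h4.unique (hasFDerivAt_id _))
    refine ⟨fderiv ℝ eA.symm (eA y) w, by simpa using h5, ?_⟩
    set u := fderiv ℝ eA.symm (eA y) w
    have h6 : u + Λ₁ (D y u) = w := by simpa using h5
    have h7 : ‖u‖ ≤ ‖w‖ + ‖Λ₁ (D y u)‖ := by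
      rw [← h6]
      simpa using norm_sub_le (u + Λ₁ (D y u)) (Λ₁ (D y u))
    have h8 := (n1 (D y u)).trans (hDle y u)
    nlinarith [norm_nonneg u]
  refine ⟨φ, hφc, hAc.comp hB', ?_, ?_, ?_, ?_⟩
  · intro x u w
    obtain ⟨y, rfl⟩ := eA.surjective x
    obtain ⟨u, rfl, -⟩ := hsurj y u
    obtain ⟨w, rfl, -⟩ := hsurj y w
    rw [hφd, hφd]
    have hsymm : D y u w = D y w u :=
      (hF.contDiffAt (x := y)).isSymmSndFDerivAt (by simp) u w
    obtain ⟨u₁, u₂⟩ := u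
    obtain ⟨w₁, w₂⟩ := w
    have s1 : D y (u₁, u₂) (w₁, w₂) = D y (u₁, u₂) (w₁, 0) + D y (u₁, u₂) (0, w₂) := by
      rw [← map_add]; simp
    have s2 : D y (w₁, w₂) (u₁, u₂) = D y (w₁, w₂) (u₁, 0) + D y (w₁, w₂) (0, u₂) := by
      rw [← map_add]; simp
    simp only [stdSymp, e1, e2, Prod.mk_add_mk, add_zero, inner_add_left, inner_add_right,
      inner_gradFst, inner_gradSnd]
    rw [real_inner_comm (gradFst V _) u₁, real_inner_comm (gradSnd V _) u₂, inner_gradFst,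
      inner_gradSnd]
    linarith
  · intro x
    obtain ⟨y, rfl⟩ := eA.surjective x
    rw [hφA, hA, hB, add_sub_add_left_eq_sub]
    exact (n12 _).trans (h1 y)
  · intro x w
    obtain ⟨y, rfl⟩ := eA.surjective x
    obtain ⟨u, rfl, hu⟩ := hsurj y w
    rw [hφd, add_sub_add_left_eq_sub]
    refine (n12 _).trans ((hDle y u).trans ?_)
    nlinarith
  · intro x
    have h3 := hφA x
    rw [hA, hB, e1, e2] at h3
    simpa [Prod.add_def] using h3

end Generating

/-! ### Symplectic extension of a diffeomorphism of the zero section of `V × V` -/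

section LocalExtension

variable {V : Type*} [NormedAddCommGroup V] [InnerProductSpace ℝ V] [FiniteDimensional ℝ V]
  [MeasurableSpace V] [BorelSpace V]

/-- The linear map `(q, p) ↦ (q, ⟨b, p⟩)`. -/
def coordMap (b : V) : (V × V) →L[ℝ] V × ℝ :=
  (ContinuousLinearMap.id ℝ V).prodMap (innerSL ℝ b)

@[simp] theorem coordMap_apply (b : V) (x : V × V) : coordMap b x = (x.1, inner ℝ b x.2) := rfl

theorem norm_coordMap_le {b : V} (hb : ‖b‖ = 1) : ‖coordMap b‖ ≤ 1 := by
  refine ContinuousLinearMap.opNorm_le_bound _ zero_le_one fun x => ?_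
  rw [coordMap_apply, one_mul, Prod.norm_def, Prod.norm_def]
  exact max_le_max le_rfl ((norm_inner_le_norm b x.2).trans (by rw [hb, one_mul]))

/-- The generating function with `p`-derivative `v` along `p = 0`, cut off by `χ`. -/
def genFun (χ : V → ℝ) (v : V → V) (x : V × V) : ℝ :=
  ∑ i, χ x.2 * mollify (fun q => inner ℝ (stdOrthonormalBasis ℝ V i) (v q))
    (coordMap (stdOrthonormalBasis ℝ V i) x)

theorem contDiff_genFun {χ : V → ℝ} (hχ : ContDiff ℝ ∞ χ) {v : V → V} (hv : ContDiff ℝ 1 v) :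
    ContDiff ℝ 2 (genFun χ v) := by
  refine ContDiff.sum fun i _ => ContDiff.mul ?_ ?_
  · exact (hχ.of_le ENat.LEInfty.out).comp contDiff_snd
  · exact (contDiff_mollify (contDiff_const.inner ℝ hv)).comp
      (coordMap (stdOrthonormalBasis ℝ V i)).contDiff

/-- Every mollified term vanishes at `p = 0`, so neither the derivative of `χ` nor any
`q`-derivative contributes; the `p`-derivatives add up to the expansion of `v q` in the orthonormal
basis. -/
theorem fderiv_genFun_zero {χ : V → ℝ} (hχ : ContDiff ℝ ∞ χ) (hχ0 : χ 0 = 1) {v : V → V}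
    (hv : ContDiff ℝ 1 v) (q h k : V) :
    fderiv ℝ (genFun χ v) (q, 0) (h, k) = inner ℝ (v q) k := by
  have hi : ∀ i, HasFDerivAt (fun x : V × V =>
      χ x.2 * mollify (fun q => inner ℝ (stdOrthonormalBasis ℝ V i) (v q))
        (coordMap (stdOrthonormalBasis ℝ V i) x)) _ (q, 0) := fun i =>
    (((hχ.differentiable (by simp)) (0 : V)).hasFDerivAt.comp (q, (0 : V))
      (ContinuousLinearMap.snd ℝ V V).hasFDerivAt).mul
      (((contDiff_mollify (contDiff_const.inner ℝ hv)).differentiable (by simp)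
        _).hasFDerivAt.comp (q, (0 : V)) (coordMap (stdOrthonormalBasis ℝ V i)).hasFDerivAt)
  have := HasFDerivAt.fun_sum (u := Finset.univ) fun i _ => hi i
  rw [show fderiv ℝ (genFun χ v) (q, 0) = _ from this.fderiv, sum_apply]
  have hu : ∀ i, ContDiff ℝ 1 fun q => inner ℝ (stdOrthonormalBasis ℝ V i) (v q) :=
    fun i => contDiff_const.inner ℝ hv
  simp [hχ0, mollify_zero, fderiv_mollify_zero (hu _)]
  rw [← (stdOrthonormalBasis ℝ V).sum_inner_mul_inner (v q) k]
  exact Finset.sum_congr rfl fun i _ => by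
    rw [real_inner_comm (v q), mul_comm]

/-- The scale `|⟨b i, p⟩|` is at most `‖p‖ ≤ η`, so the averages only see values of `v` at distance
at most `η` from `q`. -/
theorem genFun_eq_zero {χ : V → ℝ} {v : V → V} {K : Set V} {η : ℝ} (hv : ∀ q ∉ K, v q = 0)
    (hχ : ∀ p ∉ closedBall (0 : V) η, χ p = 0) {x : V × V}
    (hx : x ∉ cthickening η K ×ˢ closedBall (0 : V) η) : genFun χ v x = 0 := by
  refine Finset.sum_eq_zero fun i _ => ?_
  by_cases hp : x.2 ∈ closedBall (0 : V) η
  · rw [mollify_eq_zero, mul_zero]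
    intro y hy
    rw [hv, inner_zero_right]
    intro hK
    refine hx ⟨mem_cthickening_of_dist_le _ _ _ _ hK ?_, hp⟩
    simp only [coordMap_apply, dist_self_add_right, norm_smul]
    have h1 : ‖(inner ℝ (stdOrthonormalBasis ℝ V i) x.2 : ℝ)‖ ≤ η :=
      (norm_inner_le_norm _ _).trans (by simpa using hp)
    have h2 : ‖y‖ ≤ 1 := by simpa using hy
    exact (mul_le_of_le_one_right (norm_nonneg _) h2).trans h1
  · rw [hχ _ hp, zero_mul]

/-- The constant does not depend on `v`, which lets the smallness of `v` be chosen afterwards. The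
support of `χ` in the unit ball keeps all scales at most `1`. -/
theorem exists_iteratedFDeriv_genFun_le {χ : V → ℝ} (hχ : ContDiff ℝ ∞ χ)
    (hχ1 : ∀ p ∉ closedBall (0 : V) 1, χ p = 0) :
    ∃ C : ℝ, 0 ≤ C ∧ ∀ (v : V → V) (δ : ℝ), 0 ≤ δ → ContDiff ℝ 1 v → (∀ q, ‖v q‖ ≤ δ) →
      (∀ q, ‖fderiv ℝ v q‖ ≤ δ) → ∀ x, ∀ k ≤ 2, ‖iteratedFDeriv ℝ k (genFun χ v) x‖ ≤ C * δ := by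
  obtain ⟨C₁, hC₁0, hC₁⟩ := exists_iteratedFDeriv_mollify_le V
  let X : V × V → ℝ := fun x => χ x.2
  have hX : ContDiff ℝ ∞ X := hχ.comp contDiff_snd
  have hXb : ∃ C₂ : ℝ, 0 ≤ C₂ ∧ ∀ x : V × V, ‖x.2‖ ≤ 1 → ∀ k ≤ 2,
      ‖iteratedFDeriv ℝ k X x‖ ≤ C₂ := by
    have h0 : ∀ k : ℕ, ∃ C : ℝ, ∀ p ∈ closedBall (0 : V) 1, ‖iteratedFDeriv ℝ k χ p‖ ≤ C :=
      fun k => (isCompact_closedBall (0 : V) 1).exists_bound_of_continuousOn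
        (hχ.continuous_iteratedFDeriv (by exact_mod_cast le_top)).continuousOn
    choose C hC using h0
    refine ⟨max 0 (max (C 0) (max (C 1) (C 2))), le_max_left _ _, fun x hx k hk => ?_⟩
    have h1 : ‖iteratedFDeriv ℝ k X x‖ ≤ C k := by
      have e := (ContinuousLinearMap.snd ℝ V V).iteratedFDeriv_comp_right (i := k) hχ x
        (by exact_mod_cast le_top)
      rw [show X = χ ∘ ContinuousLinearMap.snd ℝ V V from rfl, e]
      refine (ContinuousMultilinearMap.norm_compContinuousLinearMap_le _ _).trans ?_
      refine (mul_le_of_le_one_right (norm_nonneg _) ?_).trans (hC k x.2 (by simpa using hx))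
      exact Finset.prod_le_one (fun _ _ => norm_nonneg _)
        fun _ _ => ContinuousLinearMap.norm_snd_le ..
    refine h1.trans ?_
    interval_cases k <;> simp
  obtain ⟨C₂, hC₂0, hC₂⟩ := hXb
  -- One summand per basis vector; `4` bounds the sum of the binomial coefficients in Leibniz' rule
  -- up to order two.
  refine ⟨Module.finrank ℝ V * (4 * C₂ * C₁), by positivity,
    fun v δ hδ hv hv0 hv1 x k hk => ?_⟩
  by_cases hx : ‖x.2‖ ≤ 1
  swap
  · have h0 : genFun χ v =ᶠ[𝓝 x] 0 := by
      have : ∀ᶠ y in 𝓝 x, 1 < ‖y.2‖ :=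
        (continuous_snd.norm.tendsto x).eventually (lt_mem_nhds (not_le.1 hx))
      filter_upwards [this] with y hy
      have : χ y.2 = 0 := hχ1 _ (by simpa using hy)
      simp [genFun, this]
    rw [(h0.iteratedFDeriv (𝕜 := ℝ) k).eq_of_nhds]
    simp only [Pi.zero_def, iteratedFDeriv_fun_zero]
    simp only [norm_zero]
    positivity
  let b := stdOrthonormalBasis ℝ V
  have hb : ∀ i, ‖b i‖ = 1 := fun i => b.norm_eq_one i
  let u : Fin (Module.finrank ℝ V) → V → ℝ := fun i q => inner ℝ (b i) (v q)
  have hu : ∀ i, ContDiff ℝ 1 (u i) := fun i => contDiff_const.inner ℝ hv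
  have hu0 : ∀ i q, |u i q| ≤ δ := fun i q =>
    (abs_real_inner_le_norm (b i) (v q)).trans (by rw [hb, one_mul]; exact hv0 q)
  have hu1 : ∀ i q, ‖fderiv ℝ (u i) q‖ ≤ δ := by
    intro i q
    have h1 : HasFDerivAt (u i) ((innerSL ℝ (b i)).comp (fderiv ℝ v q)) q :=
      (innerSL ℝ (b i)).hasFDerivAt.comp q ((hv.differentiable one_ne_zero) q).hasFDerivAt
    rw [h1.fderiv]
    refine (ContinuousLinearMap.opNorm_comp_le _ _).trans ?_
    rw [innerSL_apply_norm, hb, one_mul]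
    exact hv1 q
  have hm : ∀ i, ContDiff ℝ 2 fun x => mollify (u i) (coordMap (b i) x) := fun i =>
    (contDiff_mollify (hu i)).comp (coordMap (b i)).contDiff
  have hmb : ∀ i, ∀ j ≤ 2, ‖iteratedFDeriv ℝ j (fun x => mollify (u i) (coordMap (b i) x)) x‖
      ≤ C₁ * δ := by
    intro i j hj
    have e := (coordMap (b i)).iteratedFDeriv_comp_right (i := j) (contDiff_mollify (hu i)) x
      (by exact_mod_cast hj)
    rw [show (fun x => mollify (u i) (coordMap (b i) x)) = mollify (u i) ∘ coordMap (b i) from rfl,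
      e]
    refine (ContinuousMultilinearMap.norm_compContinuousLinearMap_le _ _).trans ?_
    refine (mul_le_of_le_one_right (norm_nonneg _) ?_).trans
      (hC₁ (u i) δ hδ (hu i) (hu0 i) (hu1 i) _ ?_ j hj)
    · exact Finset.prod_le_one (fun _ _ => norm_nonneg _) fun _ _ => norm_coordMap_le (hb i)
    · simp only [coordMap_apply]
      exact (abs_real_inner_le_norm (b i) x.2).trans (by rw [hb, one_mul]; exact hx)
  have hX2 : ContDiff ℝ 2 X := hX.of_le ENat.LEInfty.out
  have hterm : ∀ i, ‖iteratedFDeriv ℝ k (fun x => X x * mollify (u i) (coordMap (b i) x)) x‖ ≤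
      4 * C₂ * (C₁ * δ) := by
    intro i
    refine (norm_iteratedFDeriv_mul_le hX2 (hm i) x (n := k) (by exact_mod_cast hk)).trans ?_
    have h1 : ∀ j ∈ Finset.range (k + 1), (k.choose j : ℝ) * ‖iteratedFDeriv ℝ j X x‖ *
        ‖iteratedFDeriv ℝ (k - j) (fun x => mollify (u i) (coordMap (b i) x)) x‖ ≤
        (k.choose j : ℝ) * (C₂ * (C₁ * δ)) := by
      intro j hj
      rw [mul_assoc]
      have := Finset.mem_range.1 hj
      exact mul_le_mul_of_nonneg_left (mul_le_mul (hC₂ x hx j (by omega))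
        (hmb i (k - j) (by omega)) (norm_nonneg _) hC₂0) (by positivity)
    refine (Finset.sum_le_sum h1).trans ?_
    rw [← Finset.sum_mul, ← Nat.cast_sum, Nat.sum_range_choose]
    have h2 : ((2 ^ k : ℕ) : ℝ) ≤ 4 := by interval_cases k <;> norm_num
    calc _ ≤ 4 * (C₂ * (C₁ * δ)) := mul_le_mul_of_nonneg_right h2 (by positivity)
      _ = _ := by ring
  have hsum : iteratedFDeriv ℝ k (genFun χ v) x =
      ∑ i, iteratedFDeriv ℝ k (fun x => X x * mollify (u i) (coordMap (b i) x)) x := by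
    exact iteratedFDeriv_fun_sum_apply fun i _ =>
      ((hX2.mul (hm i)).of_le (by exact_mod_cast hk)).contDiffAt
  rw [hsum]
  refine (norm_sum_le _ _).trans ((Finset.sum_le_sum fun i _ => hterm i).trans (le_of_eq ?_))
  simp only [Finset.sum_const, Finset.card_univ, Fintype.card_fin, nsmul_eq_mul]
  ring

/-- The generating function `genFun` has gradient `(0, v q)` at `(q, 0)`, so the map it generates
moves `(q, 0)` to `(q + v q, 0)`; where it vanishes locally, the map fixes the point. The compact
set `C` is chosen before `v`. -/
theorem exists_symplectic_extension {K : Set V} (hK : IsCompact K) {U : Set (V × V)}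
    (hU : IsOpen U) (hKU : ∀ q ∈ K, (q, (0 : V)) ∈ U) {ε : ℝ} (hε : 0 < ε) :
    ∃ C ⊆ U, IsCompact C ∧ ∃ δ > 0, ∀ v : V → V, ContDiff ℝ 1 v → (∀ q ∉ K, v q = 0) →
      (∀ q, ‖v q‖ ≤ δ) → (∀ q, ‖fderiv ℝ v q‖ ≤ δ) →
      ∃ φ : (V × V) ≃ₜ (V × V), ContDiff ℝ 1 φ ∧ ContDiff ℝ 1 φ.symm ∧
        (∀ x u w, stdSymp (fderiv ℝ φ x u) (fderiv ℝ φ x w) = stdSymp u w) ∧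
        (∀ x ∉ C, φ x = x) ∧ (∀ q, φ (q, 0) = (q + v q, 0)) ∧
        (∀ x, ‖φ x - x‖ ≤ ε) ∧ ∀ x w, ‖fderiv ℝ φ x w - w‖ ≤ ε * ‖w‖ := by
  have hK0 : IsCompact ((fun q : V => (q, (0 : V))) '' K) := hK.image (by fun_prop)
  obtain ⟨r, hr0, hr⟩ := hK0.exists_cthickening_subset_open hU (by
    rintro _ ⟨q, hq, rfl⟩
    exact hKU q hq)
  -- `r` keeps the support inside `U`; `1` is what the derivative bounds for `genFun` require of the
  -- cutoff.
  set η := min r 1 with hη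
  have hη0 : 0 < η := lt_min hr0 one_pos
  let C := cthickening η K ×ˢ closedBall (0 : V) η
  have hCc : IsCompact C := hK.cthickening.prod (isCompact_closedBall _ _)
  have hCU : C ⊆ U := by
    rintro ⟨q, p⟩ ⟨hq, hp⟩
    apply hr
    rw [hK.cthickening_eq_biUnion_closedBall hη0.le, mem_iUnion₂] at hq
    obtain ⟨q₀, hq₀, hq⟩ := hq
    refine mem_cthickening_of_dist_le _ _ _ _ (mem_image_of_mem _ hq₀) ?_
    rw [Prod.dist_eq]
    exact max_le (hq.trans (min_le_left _ _)) (hp.trans (min_le_left _ _))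
  let B : ContDiffBump (0 : V) := ⟨η / 2, η, by positivity, by linarith⟩
  have hBs : ∀ p ∉ closedBall (0 : V) η, B p = 0 := fun p hp =>
    B.zero_of_le_dist (le_of_lt (by simpa using hp))
  obtain ⟨M, hM0, hM⟩ := exists_iteratedFDeriv_genFun_le (χ := B) B.contDiff fun p hp =>
    hBs p fun h => hp (closedBall_subset_closedBall (min_le_right _ _) h)
  -- `1 / 2` is the threshold for generating functions; `ε / 2` turns the derivative bound `2 * c`
  -- into `ε`.
  set c := min (1 / 2) (ε / 2) with hc
  have hc0 : 0 < c := by positivity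
  -- Dividing by `M + 1` covers the case `M = 0`.
  refine ⟨C, hCU, hCc, c / (M + 1), by positivity, fun v hv hvK hv0 hv1 => ?_⟩
  have hMc : M * (c / (M + 1)) ≤ c := by
    rw [mul_div_assoc', div_le_iff₀ (by positivity)]
    nlinarith
  have hb := hM v (c / (M + 1)) (by positivity) hv hv0 hv1
  have hχ : ContDiff ℝ ∞ B := B.contDiff
  have hχ0 : B 0 = 1 := B.one_of_mem_closedBall (mem_closedBall_self (by positivity))
  obtain ⟨φ, h1, h2, h3, h4, h5, h6⟩ := exists_symplectic_of_generating
    (contDiff_genFun hχ hv) hc0.le (min_le_left _ _)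
    (fun x => by
      rw [← norm_iteratedFDeriv_zero (𝕜 := ℝ), norm_iteratedFDeriv_fderiv]
      exact (hb x 1 (by norm_num)).trans hMc)
    (fun x => by
      rw [← norm_iteratedFDeriv_zero (𝕜 := ℝ), norm_iteratedFDeriv_fderiv,
        norm_iteratedFDeriv_fderiv]
      exact (hb x 2 (by norm_num)).trans hMc)
  refine ⟨φ, h1, h2, h3, fun x hx => ?_, fun q => ?_, fun x => ?_, fun x w => ?_⟩
  · have h0 : genFun B v =ᶠ[𝓝 x] fun _ => 0 := by
      filter_upwards [hCc.isClosed.isOpen_compl.mem_nhds hx] with y hy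
      exact genFun_eq_zero hvK hBs hy
    have := h6 x
    rw [h0.fderiv_eq] at this
    simpa using this
  · have := h6 (q, 0)
    have e1 : gradFst V (fderiv ℝ (genFun B v) (q, 0)) = 0 := ext_inner_right ℝ fun w => by
      rw [inner_gradFst, fderiv_genFun_zero hχ hχ0 hv]; simp
    have e2 : gradSnd V (fderiv ℝ (genFun B v) (q, 0)) = v q := ext_inner_right ℝ fun w => by
      rw [inner_gradSnd, fderiv_genFun_zero hχ hχ0 hv]
    rw [e1, e2] at this
    simpa using this
  · exact (h4 x).trans ((min_le_right _ _).trans (by linarith))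
  · refine (h5 x w).trans (mul_le_mul_of_nonneg_right ?_ (norm_nonneg _))
    linarith [min_le_right (1 / 2) (ε / 2)]

end LocalExtension

/-! ### The flow of a time-dependent vector field near a degenerate zero -/

section Flow

variable {E : Type*} [NormedAddCommGroup E] [NormedSpace ℝ E]

local notation "I" => Set.Icc (0 : ℝ) 1

/-- The composition operator `γ ↦ (s ↦ X (s, γ s))`. -/
def graphComp {F : Type*} [TopologicalSpace F] (X : C(I × E, F)) (γ : C(I, E)) : C(I, F) :=
  X.comp ((ContinuousMap.id I).prodMk γ)

theorem continuous_graphComp {F : Type*} [TopologicalSpace F] (X : C(I × E, F)) :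
    Continuous (graphComp X) := by
  refine ContinuousMap.continuous_of_continuous_uncurry _ ?_
  have h : Continuous fun p : C(I, E) × I => X (p.2, p.1 p.2) := by fun_prop
  exact h

/-- Pointwise evaluation of a path of linear maps on a path of vectors. -/
def pathApply : C(I, E →L[ℝ] E) →L[ℝ] C(I, E) →L[ℝ] C(I, E) :=
  LinearMap.mkContinuous₂
    (LinearMap.mk₂ ℝ (fun A η => ⟨fun s => A s (η s), by fun_prop⟩)
      (fun A B η => by ext; simp) (fun c A η => by ext; simp)
      (fun A η ζ => by ext; simp) (fun c A η => by ext; simp)) 1 fun A η => by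
    rw [one_mul, ContinuousMap.norm_le _ (by positivity)]
    exact fun s => ((A s).le_opNorm _).trans
      (mul_le_mul (A.norm_coe_le_norm s) (η.norm_coe_le_norm s) (norm_nonneg _) (norm_nonneg _))

@[simp] theorem pathApply_apply (A : C(I, E →L[ℝ] E)) (η : C(I, E)) (s : I) :
    pathApply A η s = A s (η s) := rfl

/-- The mean value inequality is applied at each time `s`; the estimate is uniform in `s` because
`graphComp DX` is continuous for the sup norm on paths. -/
theorem hasFDerivAt_graphComp {X : C(I × E, E)} {DX : C(I × E, E →L[ℝ] E)}
    (h : ∀ t x, HasFDerivAt (fun x => X (t, x)) (DX (t, x)) x) (γ : C(I, E)) :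
    HasFDerivAt (graphComp X) (pathApply (graphComp DX γ)) γ := by
  rw [hasFDerivAt_iff_isLittleO_nhds_zero, Asymptotics.isLittleO_iff]
  intro c hc
  obtain ⟨δ, hδ, hball⟩ := Metric.continuousAt_iff.1
    ((continuous_graphComp DX).continuousAt (x := γ)) c hc
  filter_upwards [ball_mem_nhds (0 : C(I, E)) hδ] with η hη
  rw [ContinuousMap.norm_le _ (by positivity)]
  intro s
  have hs : ‖η s‖ ≤ ‖η‖ := η.norm_coe_le_norm s
  have hη' : ‖η‖ < δ := by simpa using hη
  have key := (convex_ball (γ s) δ).norm_image_sub_le_of_norm_hasFDerivWithin_le'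
    (f := fun x => X (s, x)) (f' := fun x => DX (s, x)) (φ := DX (s, γ s)) (C := c)
    (fun x _ => (h s x).hasFDerivWithinAt) (fun x hx => ?_)
    (mem_ball_self hδ) (show γ s + η s ∈ ball (γ s) δ by simpa using hs.trans_lt hη')
  · rw [add_sub_cancel_left] at key
    exact key.trans (mul_le_mul_of_nonneg_left hs hc.le)
  -- Translating the whole path by `x - γ s` makes it pass through `x` at time `s`, so continuity of
  -- `graphComp DX` at `γ` compares `DX (s, x)` with `DX (s, γ s)`.
  · have h1 : dist (γ + ContinuousMap.const I (x - γ s)) γ < δ := by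
      rw [dist_eq_norm, add_sub_cancel_left]
      refine lt_of_le_of_lt ((ContinuousMap.norm_le _ (norm_nonneg (x - γ s))).2
        fun _ => le_rfl) ?_
      rwa [← dist_eq_norm]
    have h2 := hball h1
    rw [dist_eq_norm] at h2
    have h3 := (ContinuousMap.norm_coe_le_norm (graphComp DX (γ + ContinuousMap.const I (x - γ s))
      - graphComp DX γ) s).trans h2.le
    simpa [graphComp] using h3

/-- The primitive of a path, defined for all times. -/
def primitive (η : C(I, E)) (t : ℝ) : E := ∫ s in (0 : ℝ)..t, η (projIcc 0 1 zero_le_one s)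

variable [CompleteSpace E]

theorem hasDerivAt_primitive (η : C(I, E)) (t : ℝ) :
    HasDerivAt (primitive η) (η (projIcc 0 1 zero_le_one t)) t := by
  have hc : Continuous fun s => η (projIcc 0 1 zero_le_one s) :=
    η.continuous.comp continuous_projIcc
  exact intervalIntegral.integral_hasDerivAt_right (hc.intervalIntegrable _ _)
    (hc.stronglyMeasurableAtFilter _ _) hc.continuousAt

theorem primitive_zero (η : C(I, E)) : primitive η 0 = 0 := intervalIntegral.integral_same

/-- Integration of paths. -/
def volterra : C(I, E) →L[ℝ] C(I, E) :=
  LinearMap.mkContinuous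
    { toFun := fun η => ⟨fun t => primitive η t,
        (continuous_iff_continuousAt.2 fun t =>
          (hasDerivAt_primitive η t).continuousAt).comp continuous_subtype_val⟩
      map_add' := fun η ζ => by
        ext t
        have hc : ∀ η : C(I, E), Continuous fun s => η (projIcc 0 1 zero_le_one s) :=
          fun η => η.continuous.comp continuous_projIcc
        exact intervalIntegral.integral_add ((hc η).intervalIntegrable _ _)
          ((hc ζ).intervalIntegrable _ _)
      map_smul' := fun c η => by
        ext t
        exact intervalIntegral.integral_smul _ _ } 1 fun η => by
    rw [one_mul, ContinuousMap.norm_le _ (norm_nonneg _)]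
    intro t
    refine (intervalIntegral.norm_integral_le_of_norm_le_const (C := ‖η‖)
      fun s _ => η.norm_coe_le_norm _).trans ?_
    have h1 : |(t : ℝ) - 0| ≤ 1 := by
      rw [sub_zero, abs_of_nonneg t.2.1]; exact t.2.2
    exact mul_le_of_le_one_right (norm_nonneg _) h1

@[simp] theorem volterra_apply (η : C(I, E)) (t : I) : volterra η t = primitive η t := rfl

/-- Integral curves starting at `x` solve `Θ γ = x`, with `Θ γ` the path `γ` minus the primitive of
`X` along `γ`. Since `X` and `DX` vanish along `x = 0`, the map `Θ` fixes the zero path and has the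
identity as derivative there. The inverse function theorem on paths gives curves up to time one,
depending in a `C¹` way on `x`; differentiating `Θ (φ x) = x` gives the linearized equation. -/
theorem exists_flow {X : C(I × E, E)} {DX : C(I × E, E →L[ℝ] E)}
    (h : ∀ t x, HasFDerivAt (fun x => X (t, x)) (DX (t, x)) x)
    (hX : ∀ t, X (t, 0) = 0) (hDX : ∀ t, DX (t, 0) = 0) :
    ∃ φ : E → C(I, E), ContDiffAt ℝ 1 φ 0 ∧ φ 0 = 0 ∧
      (∀ u, fderiv ℝ φ 0 u = ContinuousMap.const I u) ∧
      ∀ᶠ x in 𝓝 0, φ x = ContinuousMap.const I x + volterra (graphComp X (φ x)) ∧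
        ∀ u, fderiv ℝ φ x u = ContinuousMap.const I u +
          volterra (pathApply (graphComp DX (φ x)) (fderiv ℝ φ x u)) := by
  let Θ : C(I, E) → C(I, E) := fun γ => γ - volterra (graphComp X γ)
  let Θ' : C(I, E) → C(I, E) →L[ℝ] C(I, E) := fun γ =>
    ContinuousLinearMap.id ℝ _ - volterra.comp (pathApply (graphComp DX γ))
  have hΘ : ∀ γ, HasFDerivAt Θ (Θ' γ) γ := fun γ =>
    (hasFDerivAt_id γ).sub ((volterra (E := E)).hasFDerivAt.comp γ (hasFDerivAt_graphComp h γ))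
  have hΘc : ContDiff ℝ 1 Θ := by
    refine contDiff_one_iff_hasFDerivAt.2 ⟨Θ', ?_, hΘ⟩
    exact continuous_const.sub (continuous_const.clm_comp
      (pathApply.continuous.comp (continuous_graphComp DX)))
  have hg0 : graphComp X 0 = 0 := by ext s; exact hX s
  have hg0' : graphComp DX 0 = 0 := by ext1 s; exact hDX s
  have hΘ0 : Θ 0 = 0 := by simp [Θ, hg0]
  have hΘ'0 : Θ' 0 = ((ContinuousLinearEquiv.refl ℝ C(I, E) : C(I, E) ≃L[ℝ] C(I, E)) :
      C(I, E) →L[ℝ] C(I, E)) := by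
    simp only [Θ', hg0', map_zero, ContinuousLinearMap.comp_zero, sub_zero]
    rfl
  have hd0 : HasFDerivAt Θ ((ContinuousLinearEquiv.refl ℝ C(I, E) : C(I, E) ≃L[ℝ] C(I, E)) :
      C(I, E) →L[ℝ] C(I, E)) 0 := hΘ'0 ▸ hΘ 0
  let cst : E →L[ℝ] C(I, E) := LinearMap.mkContinuous
    { toFun := fun x => ContinuousMap.const I x
      map_add' := fun x y => rfl
      map_smul' := fun c x => rfl } 1 fun x => by
    rw [one_mul, ContinuousMap.norm_le _ (norm_nonneg _)]
    exact fun _ => le_rfl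
  let S := hΘc.contDiffAt.localInverse hd0 one_ne_zero
  have hS : ContDiffAt ℝ 1 S (Θ 0) := hΘc.contDiffAt.to_localInverse hd0 one_ne_zero
  have hS0 : S (Θ 0) = 0 := by
    exact hΘc.contDiffAt.localInverse_apply_image hd0 one_ne_zero
  rw [hΘ0] at hS hS0
  have hSr : ∀ᶠ y in 𝓝 (0 : C(I, E)), Θ (S y) = y := by
    have := (hΘc.contDiffAt.toOpenPartialHomeomorph Θ hd0 one_ne_zero).eventually_right_inverse
      (hΘc.contDiffAt.image_mem_toOpenPartialHomeomorph_target hd0 one_ne_zero)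
    rwa [hΘ0] at this
  let φ : E → C(I, E) := fun x => S (cst x)
  have hc0 : cst 0 = 0 := map_zero cst
  have hφ : ContDiffAt ℝ 1 φ 0 := by
    refine ContDiffAt.comp 0 ?_ cst.contDiff.contDiffAt
    rwa [hc0]
  have hφ0 : φ 0 = 0 := by simp only [φ, hc0, hS0]
  have hev : ∀ᶠ x in 𝓝 (0 : E), Θ (φ x) = cst x := by
    have ht : Tendsto cst (𝓝 0) (𝓝 0) := by simpa using cst.continuous.tendsto 0
    exact ht.eventually hSr
  have hev2 : ∀ᶠ x in 𝓝 (0 : E), φ x = ContinuousMap.const I x + volterra (graphComp X (φ x)) ∧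
        ∀ u, fderiv ℝ φ x u = ContinuousMap.const I u +
          volterra (pathApply (graphComp DX (φ x)) (fderiv ℝ φ x u)) := by
    filter_upwards [hev.eventually_nhds, hφ.eventually (by simp)] with x hx hxd
    refine ⟨?_, fun u => ?_⟩
    · have := hx.self_of_nhds
      simp only [Θ, sub_eq_iff_eq_add] at this
      exact this
    · have h1 := (hΘ (φ x)).comp x (hxd.differentiableAt one_ne_zero).hasFDerivAt
      have h2 := (cst.hasFDerivAt (x := x)).congr_of_eventuallyEq hx
      have h3 := congrArg (fun L => L u) (h1.unique h2)
      simp only [Θ', ContinuousLinearMap.comp_apply, sub_apply, sub_eq_iff_eq_add,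
        ContinuousLinearMap.id_apply] at h3
      exact h3
  refine ⟨φ, hφ, hφ0, fun u => ?_, hev2⟩
  have := (hev2.self_of_nhds).2 u
  rwa [hφ0, hg0', map_zero, zero_apply, map_zero, add_zero] at this

end Flow

/-! ### The Darboux theorem, by the Moser trick -/

section Moser

variable {E : Type*} [NormedAddCommGroup E] [NormedSpace ℝ E] [FiniteDimensional ℝ E]

/-- The radial primitive of a field of bilinear forms. -/
def radialPrimitive (σ : E → E →L[ℝ] E →L[ℝ] ℝ) (x : E) : E →L[ℝ] ℝ :=
  ∫ s in Icc (0 : ℝ) 1, s • σ (s • x) x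

theorem hasFDerivAt_radialPrimitive {σ : E → E →L[ℝ] E →L[ℝ] ℝ} (hσ : ContDiff ℝ 1 σ) (x : E) :
    HasFDerivAt (radialPrimitive σ) (∫ s in Icc (0 : ℝ) 1,
      s • (s • (fderiv ℝ σ (s • x)).flip x + σ (s • x))) x := by
  have hc := hσ.continuous
  have hc' := hσ.continuous_fderiv one_ne_zero
  have c1 : Continuous fun p : E × ℝ => σ (p.2 • p.1) p.1 :=
    Continuous.clm_apply (by fun_prop) (by fun_prop)
  have c3 : Continuous fun p : E × ℝ => σ (p.2 • p.1) := by fun_prop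
  have c2 : Continuous fun p : E × ℝ => (fderiv ℝ σ (p.2 • p.1)).flip p.1 :=
    Continuous.clm_apply ((ContinuousLinearMap.flipₗᵢ ℝ E E (E →L[ℝ] ℝ)).continuous.comp
      (by fun_prop)) (by fun_prop)
  refine hasFDerivAt_setIntegral_of_continuous (f := fun x s => s • σ (s • x) x)
    (f' := fun x s => s • (s • (fderiv ℝ σ (s • x)).flip x + σ (s • x)))
    (Continuous.fun_smul continuous_snd c1)
    (Continuous.fun_smul continuous_snd ((Continuous.fun_smul continuous_snd c2).add
      c3)) (fun x s => ?_) isCompact_Icc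
      measurableSet_Icc x
  have h1 : HasFDerivAt (fun x : E => s • x) (s • ContinuousLinearMap.id ℝ E) x :=
    (hasFDerivAt_id x).const_smul s
  have h2 := ((hσ.differentiable one_ne_zero (s • x)).hasFDerivAt.comp x h1).clm_apply
    (hasFDerivAt_id x)
  refine (h2.const_smul s).congr_fderiv ?_
  ext u w
  simp [add_comm]

theorem contDiff_radialPrimitive {σ : E → E →L[ℝ] E →L[ℝ] ℝ} (hσ : ContDiff ℝ 1 σ) :
    ContDiff ℝ 1 (radialPrimitive σ) := by
  have hc := hσ.continuous
  have hc' := hσ.continuous_fderiv one_ne_zero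
  have c3 : Continuous fun p : E × ℝ => σ (p.2 • p.1) := by fun_prop
  have c2 : Continuous fun p : E × ℝ => (fderiv ℝ σ (p.2 • p.1)).flip p.1 :=
    Continuous.clm_apply ((ContinuousLinearMap.flipₗᵢ ℝ E E (E →L[ℝ] ℝ)).continuous.comp
      (by fun_prop)) (by fun_prop)
  exact contDiff_one_iff_hasFDerivAt.2 ⟨_, continuous_parametric_integral_of_continuous
    (f := fun x s => s • (s • (fderiv ℝ σ (s • x)).flip x + σ (s • x)))
    (Continuous.fun_smul continuous_snd ((Continuous.fun_smul continuous_snd c2).add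
      c3)) isCompact_Icc,
    hasFDerivAt_radialPrimitive hσ⟩

theorem radialPrimitive_zero (σ : E → E →L[ℝ] E →L[ℝ] ℝ) : radialPrimitive σ 0 = 0 := by
  simp [radialPrimitive]

theorem fderiv_radialPrimitive_zero {σ : E → E →L[ℝ] E →L[ℝ] ℝ} (hσ : ContDiff ℝ 1 σ)
    (h0 : σ 0 = 0) : fderiv ℝ (radialPrimitive σ) 0 = 0 := by
  rw [(hasFDerivAt_radialPrimitive hσ 0).fderiv]
  simp [h0]

theorem fderiv_skew {σ : E → E →L[ℝ] E →L[ℝ] ℝ} (hσ : ContDiff ℝ 1 σ) {r : ℝ}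
    (hskew : ∀ x ∈ ball (0 : E) r, ∀ u w, σ x u w = -σ x w u) {x : E} (hx : x ∈ ball (0 : E) r)
    (h u w : E) : fderiv ℝ σ x h u w = -fderiv ℝ σ x h w u := by
  have hd : ∀ u w, HasFDerivAt (fun x => σ x u w)
      ((((fderiv ℝ σ x).flip u).flip w)) x := by
    intro u w
    have h1 := ((hσ.differentiable one_ne_zero x).hasFDerivAt.clm_apply
      (hasFDerivAt_const u x)).clm_apply (hasFDerivAt_const w x)
    refine h1.congr_fderiv ?_
    ext; simp
  have h2 : (fun x => σ x u w) =ᶠ[𝓝 x] fun x => -σ x w u := by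
    filter_upwards [isOpen_ball.mem_nhds hx] with y hy using hskew y hy u w
  have h3 := ((hd w u).neg.congr_of_eventuallyEq h2).unique (hd u w)
  simpa using (congrArg (fun L => L h) h3).symm

/-- The Poincaré lemma on a ball: closedness turns the antisymmetrized integrand into the derivative
of `s ^ 2 * σ (s • x) u w`, so the integral is the value at `s = 1`. -/
theorem fderiv_radialPrimitive_skew {σ : E → E →L[ℝ] E →L[ℝ] ℝ} (hσ : ContDiff ℝ 1 σ) {r : ℝ}
    (hskew : ∀ x ∈ ball (0 : E) r, ∀ u w, σ x u w = -σ x w u)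
    (hclosed : ∀ x ∈ ball (0 : E) r, ∀ u v w,
      fderiv ℝ σ x u v w + fderiv ℝ σ x v w u + fderiv ℝ σ x w u v = 0)
    {x : E} (hx : x ∈ ball (0 : E) r) (u w : E) :
    fderiv ℝ (radialPrimitive σ) x u w - fderiv ℝ (radialPrimitive σ) x w u = σ x u w := by
  have hc := hσ.continuous
  have hc' := hσ.continuous_fderiv one_ne_zero
  have c2 : Continuous fun s : ℝ => (fderiv ℝ σ (s • x)).flip x :=
    Continuous.clm_apply ((ContinuousLinearMap.flipₗᵢ ℝ E E (E →L[ℝ] ℝ)).continuous.comp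
      (by fun_prop)) (by fun_prop)
  let G : ℝ → E →L[ℝ] E →L[ℝ] ℝ := fun s => s • (s • (fderiv ℝ σ (s • x)).flip x + σ (s • x))
  have cG : Continuous G :=
    Continuous.fun_smul continuous_id ((Continuous.fun_smul continuous_id c2).add (by fun_prop))
  have hint : IntegrableOn G (Icc (0 : ℝ) 1) := cG.continuousOn.integrableOn_compact isCompact_Icc
  have hap : ∀ u w, fderiv ℝ (radialPrimitive σ) x u w = ∫ s in Icc (0 : ℝ) 1, G s u w := by
    intro u w
    rw [(hasFDerivAt_radialPrimitive hσ x).fderiv,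
      ContinuousLinearMap.integral_apply hint.integrable,
      ContinuousLinearMap.integral_apply
        ((cG.clm_apply continuous_const).continuousOn.integrableOn_compact
          isCompact_Icc).integrable]
  have hcont : ∀ u w, Continuous fun s => G s u w := fun u w =>
    (cG.clm_apply continuous_const).clm_apply continuous_const
  rw [hap, hap, ← integral_sub ((hcont u w).continuousOn.integrableOn_compact
    isCompact_Icc).integrable ((hcont w u).continuousOn.integrableOn_compact
    isCompact_Icc).integrable]
  have hder : ∀ s : ℝ, HasDerivAt (fun s : ℝ => s ^ 2 * σ (s • x) u w)
      (2 * s * σ (s • x) u w + s ^ 2 * fderiv ℝ σ (s • x) x u w) s := by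
    intro s
    have h1 : HasDerivAt (fun s : ℝ => s • x) x s := by
      simpa using (hasDerivAt_id s).smul_const x
    have h2 := (hσ.differentiable one_ne_zero (s • x)).hasFDerivAt.comp_hasDerivAt s h1
    have h3 := (h2.clm_apply (hasDerivAt_const s u)).clm_apply (hasDerivAt_const s w)
    have h4 := (hasDerivAt_pow 2 s).mul h3
    refine h4.congr_deriv ?_
    simp
  have hmem : ∀ s ∈ Icc (0 : ℝ) 1, s • x ∈ ball (0 : E) r := by
    intro s hs
    rw [mem_ball_zero_iff] at hx ⊢
    rw [norm_smul, Real.norm_of_nonneg hs.1]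
    exact (mul_le_of_le_one_left (norm_nonneg _) hs.2).trans_lt hx
  have heq : ∀ s ∈ Icc (0 : ℝ) 1, G s u w - G s w u =
      2 * s * σ (s • x) u w + s ^ 2 * fderiv ℝ σ (s • x) x u w := by
    intro s hs
    have h1 := hclosed _ (hmem s hs) x u w
    have h2 := fderiv_skew hσ hskew (hmem s hs) u w x
    have h3 := hskew _ (hmem s hs) w u
    simp only [G, smul_apply, add_apply, smul_eq_mul, ContinuousLinearMap.flip_apply]
    rw [h3]
    linear_combination (-s ^ 2) * h1 + s ^ 2 * h2
  rw [setIntegral_congr_fun measurableSet_Icc heq, integral_Icc_eq_integral_Ioc,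
    ← intervalIntegral.integral_of_le zero_le_one,
    intervalIntegral.integral_eq_sub_of_hasDerivAt (fun s _ => hder s)]
  · simp
  · refine Continuous.intervalIntegrable ?_ _ _
    have k1 : Continuous fun s : ℝ => σ (s • x) u w := by fun_prop
    have k2 : Continuous fun s : ℝ => fderiv ℝ σ (s • x) x u w := by fun_prop
    fun_prop

end Moser

/-! ### Moser's vector field and the Darboux theorem. -/

section Darboux

variable {E : Type*} [NormedAddCommGroup E] [NormedSpace ℝ E] [FiniteDimensional ℝ E]

/-- The time-dependent vector field of the Moser trick. -/
def moserField (e : E ≃L[ℝ] (E →L[ℝ] ℝ)) (σ : E → E →L[ℝ] E →L[ℝ] ℝ) (z : ℝ × E) : E :=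
  -(Ring.inverse (1 + z.1 • (e.symm : (E →L[ℝ] ℝ) →L[ℝ] E).comp (σ z.2))
    (e.symm (radialPrimitive σ z.2)))

section Field

variable {e : E ≃L[ℝ] (E →L[ℝ] ℝ)} {σ : E → E →L[ℝ] E →L[ℝ] ℝ}

/-- Neumann series. The open range `|t| < 2` contains `[0, 1]`, so the field is also `C¹` at the end
times. -/
theorem isUnit_moser (hS : ∀ x, ‖(e.symm : (E →L[ℝ] ℝ) →L[ℝ] E).comp (σ x)‖ ≤ 1 / 2) {z : ℝ × E}
    (hz : |z.1| < 2) : IsUnit (1 + z.1 • (e.symm : (E →L[ℝ] ℝ) →L[ℝ] E).comp (σ z.2)) := by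
  have h := isUnit_one_sub_of_norm_lt_one
    (x := -(z.1 • (e.symm : (E →L[ℝ] ℝ) →L[ℝ] E).comp (σ z.2))) (by
      rw [norm_neg, norm_smul, Real.norm_eq_abs]
      have := hS z.2
      have h0 := abs_nonneg z.1
      nlinarith [norm_nonneg ((e.symm : (E →L[ℝ] ℝ) →L[ℝ] E).comp (σ z.2))])
  simpa using h

theorem contDiffAt_moserField (hσ : ContDiff ℝ 1 σ)
    (hS : ∀ x, ‖(e.symm : (E →L[ℝ] ℝ) →L[ℝ] E).comp (σ x)‖ ≤ 1 / 2) {z : ℝ × E}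
    (hz : |z.1| < 2) : ContDiffAt ℝ 1 (moserField e σ) z := by
  have h1 : ContDiff ℝ 1 fun z : ℝ × E =>
      1 + z.1 • (e.symm : (E →L[ℝ] ℝ) →L[ℝ] E).comp (σ z.2) :=
    contDiff_const.add (contDiff_fst.smul (contDiff_const.clm_comp (hσ.comp contDiff_snd)))
  have h2 : ContDiffAt ℝ 1 (fun z : ℝ × E => Ring.inverse
      (1 + z.1 • (e.symm : (E →L[ℝ] ℝ) →L[ℝ] E).comp (σ z.2))) z := by
    have := contDiffAt_ringInverse ℝ (n := 1) (isUnit_moser hS hz).unit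
    exact ContDiffAt.comp z (g := Ring.inverse) this h1.contDiffAt
  have h3 : ContDiff ℝ 1 fun z : ℝ × E => e.symm (radialPrimitive σ z.2) :=
    e.symm.contDiff.comp ((contDiff_radialPrimitive hσ).comp contDiff_snd)
  exact (h2.clm_apply h3.contDiffAt).neg

/-- Moser's equation: contracting `e + t σ` with the field gives minus the radial primitive of `σ`.
-/
theorem moserField_spec (hS : ∀ x, ‖(e.symm : (E →L[ℝ] ℝ) →L[ℝ] E).comp (σ x)‖ ≤ 1 / 2)
    {z : ℝ × E} (hz : |z.1| < 2) :
    e (moserField e σ z) + z.1 • σ z.2 (moserField e σ z) = -radialPrimitive σ z.2 := by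
  have h1 := Ring.mul_inverse_cancel _ (isUnit_moser hS hz)
  have h2 := congrArg (fun L : E →L[ℝ] E => e (L (e.symm (radialPrimitive σ z.2)))) h1
  simp only [ContinuousLinearMap.mul_def, add_apply, smul_apply,
    one_apply_eq_self, ContinuousLinearMap.comp_apply, map_add, map_smul,
    ContinuousLinearEquiv.coe_coe, ContinuousLinearEquiv.apply_symm_apply] at h2
  simp only [moserField, map_neg, smul_neg]
  rw [← neg_add, h2]

theorem moserField_zero (t : ℝ) : moserField e σ (t, 0) = 0 := by
  simp [moserField, radialPrimitive_zero]

/-- The spatial derivative of the Moser field. -/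
def moserDeriv (e : E ≃L[ℝ] (E →L[ℝ] ℝ)) (σ : E → E →L[ℝ] E →L[ℝ] ℝ) (z : ℝ × E) : E →L[ℝ] E :=
  (fderiv ℝ (moserField e σ) z).comp (ContinuousLinearMap.inr ℝ ℝ E)

theorem hasFDerivAt_moserField (hσ : ContDiff ℝ 1 σ)
    (hS : ∀ x, ‖(e.symm : (E →L[ℝ] ℝ) →L[ℝ] E).comp (σ x)‖ ≤ 1 / 2) {t : ℝ} (ht : |t| < 2)
    (x : E) : HasFDerivAt (fun x => moserField e σ (t, x)) (moserDeriv e σ (t, x)) x := by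
  have h1 := ((contDiffAt_moserField hσ hS (z := (t, x)) ht).differentiableAt
    one_ne_zero).hasFDerivAt
  exact h1.comp x (hasFDerivAt_prodMk_right t x)

/-- Moser's equation differentiated in the direction `u`. Used for two directions, it takes the
place of Cartan's formula for the Lie derivative. -/
theorem moserDeriv_spec (hσ : ContDiff ℝ 1 σ)
    (hS : ∀ x, ‖(e.symm : (E →L[ℝ] ℝ) →L[ℝ] E).comp (σ x)‖ ≤ 1 / 2) {t : ℝ} (ht : |t| < 2)
    (x u w : E) : e (moserDeriv e σ (t, x) u) w + t * (fderiv ℝ σ x u (moserField e σ (t, x)) w +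
      σ x (moserDeriv e σ (t, x) u) w) = -fderiv ℝ (radialPrimitive σ) x u w := by
  have h1 := hasFDerivAt_moserField hσ hS ht x
  have h2 := ((hσ.differentiable one_ne_zero x).hasFDerivAt.clm_apply h1).const_smul t
  have h3 := ((e : E →L[ℝ] (E →L[ℝ] ℝ)).hasFDerivAt.comp x h1).add h2
  have h4 := ((contDiff_radialPrimitive hσ).differentiable one_ne_zero x).hasFDerivAt.neg
  have h5 : ((e : E →L[ℝ] (E →L[ℝ] ℝ)) ∘ fun x => moserField e σ (t, x)) +
      (t • fun x => σ x (moserField e σ (t, x))) = -radialPrimitive σ := by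
    funext x
    exact moserField_spec hS (z := (t, x)) ht
  have h6 := congrArg (fun L => L u w) (h3.unique (h5 ▸ h4))
  simp at h6
  rw [← h6]
  ring

/-- At the origin `σ`, the field and the derivative of the radial primitive all vanish, so the
differentiated Moser equation reduces to `e (DX u) = 0`. -/
theorem moserDeriv_zero (hσ : ContDiff ℝ 1 σ) (h0 : σ 0 = 0)
    (hS : ∀ x, ‖(e.symm : (E →L[ℝ] ℝ) →L[ℝ] E).comp (σ x)‖ ≤ 1 / 2) {t : ℝ} (ht : |t| < 2) :
    moserDeriv e σ (t, 0) = 0 := by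
  ext1 u
  apply e.injective
  ext w
  have := moserDeriv_spec hσ hS ht 0 u w
  simpa [h0, moserField_zero, fderiv_radialPrimitive_zero hσ h0] using this

theorem continuousOn_moserDeriv (hσ : ContDiff ℝ 1 σ)
    (hS : ∀ x, ‖(e.symm : (E →L[ℝ] ℝ) →L[ℝ] E).comp (σ x)‖ ≤ 1 / 2) :
    ContinuousOn (moserDeriv e σ) {z | |z.1| < 2} := by
  have ho : IsOpen {z : ℝ × E | |z.1| < 2} := isOpen_lt (by fun_prop) continuous_const
  have h1 : ContDiffOn ℝ 1 (moserField e σ) {z | |z.1| < 2} := fun z hz =>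
    (contDiffAt_moserField hσ hS hz).contDiffWithinAt
  exact (h1.continuousOn_fderiv_of_isOpen ho le_rfl).clm_comp continuousOn_const

end Field

/-- `g` is the time-one map of the Moser flow: the pull-back of `e + t σ` by the time-`t` map is
independent of `t`, and is `e` at `t = 0`. -/
theorem exists_moser_diffeo (e : E ≃L[ℝ] (E →L[ℝ] ℝ)) (he : ∀ u w, e u w = -e w u)
    {σ : E → E →L[ℝ] E →L[ℝ] ℝ} (hσ : ContDiff ℝ 1 σ) (h0 : σ 0 = 0)
    (hS : ∀ x, ‖(e.symm : (E →L[ℝ] ℝ) →L[ℝ] E).comp (σ x)‖ ≤ 1 / 2) {r : ℝ} (hr : 0 < r)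
    (hskew : ∀ x ∈ ball (0 : E) r, ∀ u w, σ x u w = -σ x w u)
    (hclosed : ∀ x ∈ ball (0 : E) r, ∀ u v w,
      fderiv ℝ σ x u v w + fderiv ℝ σ x v w u + fderiv ℝ σ x w u v = 0) :
    ∃ g : E → E, ContDiffAt ℝ 1 g 0 ∧ g 0 = 0 ∧
      fderiv ℝ g 0 = ContinuousLinearMap.id ℝ E ∧
      ∀ᶠ x in 𝓝 0, ∀ u w, e (fderiv ℝ g x u) (fderiv ℝ g x w) +
        σ (g x) (fderiv ℝ g x u) (fderiv ℝ g x w) = e u w := by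
  have ht2 : ∀ t : Icc (0 : ℝ) 1, |(t : ℝ)| < 2 := fun t => by
    rw [abs_of_nonneg t.2.1]; linarith [t.2.2]
  let X : C(Icc (0 : ℝ) 1 × E, E) := ⟨fun z => moserField e σ (z.1, z.2),
    continuous_iff_continuousAt.2 fun z =>
      ContinuousAt.comp (f := fun z : Icc (0 : ℝ) 1 × E => ((z.1 : ℝ), z.2))
        (contDiffAt_moserField hσ hS (ht2 z.1)).continuousAt
        (Continuous.continuousAt (by fun_prop))⟩
  let DX : C(Icc (0 : ℝ) 1 × E, E →L[ℝ] E) := ⟨fun z => moserDeriv e σ (z.1, z.2),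
    (continuousOn_moserDeriv hσ hS).comp_continuous
      (f := fun z : Icc (0 : ℝ) 1 × E => ((z.1 : ℝ), z.2)) (by fun_prop) fun z => ht2 z.1⟩
  obtain ⟨φ, hφ, hφ0, hφ0', hev⟩ := exists_flow (X := X) (DX := DX)
    (fun t x => hasFDerivAt_moserField hσ hS (ht2 t) x) (fun t => moserField_zero _)
    (fun t => moserDeriv_zero hσ h0 hS (ht2 t))
  let one : Icc (0 : ℝ) 1 := ⟨1, by simp⟩
  let ev : C(Icc (0 : ℝ) 1, E) →L[ℝ] E := ContinuousMap.evalCLM ℝ one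
  have hg : ContDiffAt ℝ 1 (fun x => φ x one) 0 := ev.contDiff.contDiffAt.comp 0 hφ
  have hgd : ∀ᶠ x in 𝓝 0, ∀ u, fderiv ℝ (fun x => φ x one) x u = fderiv ℝ φ x u one := by
    filter_upwards [hφ.eventually (by simp)] with x hx u
    have := ev.hasFDerivAt.comp x (hx.differentiableAt one_ne_zero).hasFDerivAt
    rw [show fderiv ℝ (fun x => φ x one) x = _ from this.fderiv]
    rfl
  refine ⟨fun x => φ x one, hg, by simp [hφ0], ?_, ?_⟩
  · ext1 u
    rw [hgd.self_of_nhds, hφ0']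
    rfl
  have hsmall : ∀ᶠ x in 𝓝 (0 : E), ‖φ x‖ < r := by
    have := hφ.continuousAt.norm.tendsto
    rw [hφ0, norm_zero] at this
    exact this.eventually (gt_mem_nhds hr)
  filter_upwards [hev, hgd, hsmall] with x ⟨hx, hx'⟩ hgx hxr u w
  rw [hgx, hgx]
  set P := projIcc (0 : ℝ) 1 zero_le_one with hP
  -- `a` is the trajectory of `x` and `y u` its variation in the direction `u`. Written through
  -- `primitive` they exist for all real times and are differentiable at both ends of `[0, 1]`.
  let a : ℝ → E := fun t => x + primitive (graphComp X (φ x)) t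
  let y : E → ℝ → E := fun u t => u + primitive (pathApply (graphComp DX (φ x)) (fderiv ℝ φ x u)) t
  have ha : ∀ t : Icc (0 : ℝ) 1, a t = φ x t := fun t => by
    conv_rhs => rw [hx]
    rfl
  have hy : ∀ u, ∀ t : Icc (0 : ℝ) 1, y u t = fderiv ℝ φ x u t := fun u t => by
    conv_rhs => rw [hx']
    rfl
  have hda : ∀ t, HasDerivAt a (moserField e σ (P t, φ x (P t))) t := fun t =>
    (hasDerivAt_primitive (graphComp X (φ x)) t).const_add x
  have hdy : ∀ u t, HasDerivAt (y u) (moserDeriv e σ (P t, φ x (P t)) (fderiv ℝ φ x u (P t))) t :=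
    fun u t => (hasDerivAt_primitive
      (pathApply (graphComp DX (φ x)) (fderiv ℝ φ x u)) t).const_add u
  let f : ℝ → ℝ := fun t => e (y u t) (y w t) + t * σ (a t) (y u t) (y w t)
  have hdf : ∀ t ∈ Icc (0 : ℝ) 1, HasDerivAt f 0 t := by
    intro t ht
    have hPt : P t = ⟨t, ht⟩ := projIcc_of_mem _ ht
    have h1 := hda t
    have h2 := hdy u t
    have h3 := hdy w t
    rw [hPt] at h1 h2 h3
    rw [← ha ⟨t, ht⟩] at h1 h2 h3
    rw [← hy] at h2 h3
    simp only at h1 h2 h3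
    have h4 := ((e : E →L[ℝ] (E →L[ℝ] ℝ)).hasFDerivAt.comp_hasDerivAt t h2).clm_apply h3
    have h5 := (((hσ.differentiable one_ne_zero (a t)).hasFDerivAt.comp_hasDerivAt t
      h1).clm_apply h2).clm_apply h3
    have h6 := h4.add ((hasDerivAt_id t).mul h5)
    refine h6.congr_deriv ?_
    have hat : a t ∈ ball (0 : E) r := by
      rw [mem_ball_zero_iff, show a t = φ x ⟨t, ht⟩ from ha ⟨t, ht⟩]
      exact ((φ x).norm_coe_le_norm _).trans_lt hxr
    have ht2' : |t| < 2 := ht2 ⟨t, ht⟩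
    have s1 := moserDeriv_spec hσ hS ht2' (a t) (y u t) (y w t)
    have s2 := moserDeriv_spec hσ hS ht2' (a t) (y w t) (y u t)
    have s3 := hclosed _ hat (moserField e σ (t, a t)) (y u t) (y w t)
    have s4 := fderiv_radialPrimitive_skew hσ hskew hclosed hat (y u t) (y w t)
    have s5 := he (y u t) (moserDeriv e σ (t, a t) (y w t))
    have s6 := hskew _ hat (y u t) (moserDeriv e σ (t, a t) (y w t))
    have s7 := fderiv_skew hσ hskew hat (y u t) (moserField e σ (t, a t)) (y w t)
    simp only [ContinuousLinearEquiv.coe_coe, Function.comp_apply, add_apply, id, one_mul]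
    -- After both uses of the differentiated Moser equation there remain `σ` minus the
    -- antisymmetrized derivative of its primitive, which is zero by `s4`, and `t` times the cyclic
    -- sum of `Dσ`, zero by `s3`. The other relations only swap arguments.
    linear_combination s1 + s5 - s2 + t * s6 - s4 + t * s3 - t * s7
  have hconst := constant_of_has_deriv_right_zero (f := f) (a := 0) (b := 1)
    (fun t ht => (hdf t ht).continuousAt.continuousWithinAt)
    (fun t ht => (hdf t (Ico_subset_Icc_self ht)).hasDerivWithinAt) 1 (by simp)
  have e0 : ∀ u, y u 0 = u := fun u => by simp [y, primitive_zero]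
  have e1 : ∀ u, y u 1 = fderiv ℝ φ x u one := fun u => hy u one
  have e2 : a 1 = φ x one := ha one
  simp only [f, e0, e1, e2, one_mul, zero_mul, add_zero] at hconst
  exact hconst

theorem exists_equiv_dual {B : E →L[ℝ] E →L[ℝ] ℝ} (hB : ∀ u, (∀ w, B u w = 0) → u = 0) :
    ∃ e : E ≃L[ℝ] (E →L[ℝ] ℝ), ∀ u, e u = B u := by
  have hinj : Function.Injective (B : E →ₗ[ℝ] (E →L[ℝ] ℝ)) := by
    rw [← LinearMap.ker_eq_bot, LinearMap.ker_eq_bot']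
    intro u hu
    exact hB u fun w => congrArg (fun L : E →L[ℝ] ℝ => L w) hu
  have hdim : Module.finrank ℝ E = Module.finrank ℝ (E →L[ℝ] ℝ) := by
    rw [← (LinearMap.toContinuousLinearMap (𝕜 := ℝ) (E := E) (F' := ℝ)).finrank_eq]
    exact (Subspace.dual_finrank_eq (K := ℝ) (V := E)).symm
  exact ⟨(LinearEquiv.ofInjectiveOfFinrankEq _ hinj hdim).toContinuousLinearEquiv, fun u => rfl⟩

/-- **Darboux theorem**: a closed nondegenerate field of alternating forms is the pull-back of a
constant form by a `C¹` local diffeomorphism. -/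
theorem exists_darboux {β : E → E →L[ℝ] E →L[ℝ] ℝ} {r : ℝ} (hr : 0 < r)
    (hβ : ContDiffOn ℝ 1 β (ball 0 r))
    (hskew : ∀ x ∈ ball (0 : E) r, ∀ u w, β x u w = -β x w u)
    (hclosed : ∀ x ∈ ball (0 : E) r, ∀ u v w,
      fderiv ℝ β x u v w + fderiv ℝ β x v w u + fderiv ℝ β x w u v = 0)
    (hnd : ∀ u, (∀ w, β 0 u w = 0) → u = 0) :
    ∃ g : E → E, ContDiffAt ℝ 1 g 0 ∧ g 0 = 0 ∧
      fderiv ℝ g 0 = ContinuousLinearMap.id ℝ E ∧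
      ∀ᶠ x in 𝓝 0, ∀ u w, β (g x) (fderiv ℝ g x u) (fderiv ℝ g x w) = β 0 u w := by
  obtain ⟨e, he⟩ := exists_equiv_dual hnd
  have hβ0 : ContinuousAt β 0 := hβ.continuousOn.continuousAt (ball_mem_nhds _ hr)
  have hsm : ∀ᶠ x in 𝓝 (0 : E), ‖(e.symm : (E →L[ℝ] ℝ) →L[ℝ] E).comp (β x - β 0)‖ < 1 / 2 := by
    have h1 : ContinuousAt
        (fun x => ‖(e.symm : (E →L[ℝ] ℝ) →L[ℝ] E).comp (β x - β 0)‖) 0 :=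
      (continuousAt_const.clm_comp (hβ0.sub continuousAt_const)).norm
    have h2 := h1.tendsto
    simp only [sub_self, ContinuousLinearMap.comp_zero, norm_zero] at h2
    exact h2.eventually (gt_mem_nhds (by norm_num))
  obtain ⟨ρ, hρ, hball⟩ := Metric.eventually_nhds_iff_ball.1
    (hsm.and (ball_mem_nhds (0 : E) hr))
  -- The cutoff makes `σ` globally `C¹` and keeps the bound `1 / 2` everywhere, while `σ = β - β 0`
  -- near the origin.
  let χ : ContDiffBump (0 : E) := ⟨ρ / 4, ρ / 2, by positivity, by linarith⟩
  let σ : E → E →L[ℝ] E →L[ℝ] ℝ := fun x => χ x • (β x - β 0)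
  have hχ0 : ∀ x ∉ closedBall (0 : E) (ρ / 2), χ x = 0 := fun x hx =>
    χ.zero_of_le_dist (le_of_lt (by simpa using hx))
  have hσ : ContDiff ℝ 1 σ := by
    rw [contDiff_iff_contDiffAt]
    intro x
    by_cases hx : x ∈ closedBall (0 : E) (ρ / 2)
    · have hx' : x ∈ ball (0 : E) r :=
        (hball x (closedBall_subset_ball (by linarith) hx)).2
      exact χ.contDiff.contDiffAt.smul
        ((hβ.contDiffAt (isOpen_ball.mem_nhds hx')).sub contDiffAt_const)
    · have h1 : σ =ᶠ[𝓝 x] fun _ => 0 := by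
        filter_upwards [isClosed_closedBall.isOpen_compl.mem_nhds hx] with y hy
        simp only [σ, hχ0 y hy, zero_smul]
      exact contDiffAt_const.congr_of_eventuallyEq h1
  have hS : ∀ x, ‖(e.symm : (E →L[ℝ] ℝ) →L[ℝ] E).comp (σ x)‖ ≤ 1 / 2 := by
    intro x
    by_cases hx : x ∈ closedBall (0 : E) (ρ / 2)
    · have h1 := (hball x (closedBall_subset_ball (by linarith) hx)).1
      simp only [σ, ContinuousLinearMap.comp_smul, norm_smul, Real.norm_of_nonneg χ.nonneg]
      exact (mul_le_of_le_one_left (norm_nonneg _) χ.le_one).trans h1.le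
    · simp only [σ, hχ0 x hx, zero_smul, ContinuousLinearMap.comp_zero, norm_zero]
      norm_num
  have hσeq : ∀ x ∈ ball (0 : E) (ρ / 4), σ x = β x - β 0 := fun x hx => by
    simp only [σ, χ.one_of_mem_closedBall (ball_subset_closedBall hx), one_smul]
  have hsub : ∀ x ∈ ball (0 : E) (ρ / 4), x ∈ ball (0 : E) r := fun x hx =>
    (hball x (ball_subset_ball (by linarith) hx)).2
  have h0r : (0 : E) ∈ ball (0 : E) r := mem_ball_self hr
  have hσd : ∀ x ∈ ball (0 : E) (ρ / 4), fderiv ℝ σ x = fderiv ℝ β x := by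
    intro x hx
    have h1 : σ =ᶠ[𝓝 x] fun x => β x - β 0 := by
      filter_upwards [isOpen_ball.mem_nhds hx] with y hy using hσeq y hy
    rw [h1.fderiv_eq, fderiv_sub_const]
  obtain ⟨g, hg, hg0, hg0', hev⟩ := exists_moser_diffeo e
    (fun u w => by rw [he, he]; exact hskew 0 h0r u w) hσ (by simp [σ]) hS
    (r := ρ / 4) (by positivity)
    (fun x hx u w => by
      have h1 := hskew x (hsub x hx) u w
      have h2 := hskew 0 h0r u w
      simp only [hσeq x hx, sub_apply]
      linarith)
    (fun x hx u v w => by rw [hσd x hx]; exact hclosed x (hsub x hx) u v w)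
  refine ⟨g, hg, hg0, hg0', ?_⟩
  have hgb : ∀ᶠ x in 𝓝 (0 : E), g x ∈ ball (0 : E) (ρ / 4) := by
    refine hg.continuousAt.eventually_mem ?_
    rw [hg0]
    exact ball_mem_nhds _ (by positivity)
  filter_upwards [hev, hgb] with x hx hxb u w
  have := hx u w
  rw [hσeq _ hxb, he, he] at this
  simpa using this

end Darboux

/-! ### Normal form of a Lagrangian submanifold in a symplectic vector space -/

section NormalForm

variable {E : Type*} [NormedAddCommGroup E] [NormedSpace ℝ E] [FiniteDimensional ℝ E]
  {V : Type*} [NormedAddCommGroup V] [InnerProductSpace ℝ V] [FiniteDimensional ℝ V]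

theorem eq_zero_of_stdSymp {x : V × V} (h : ∀ y, stdSymp x y = 0) : x = 0 := by
  have h1 := h (-x.2, x.1)
  simp only [stdSymp, inner_neg_right, sub_neg_eq_add] at h1
  have h2 := real_inner_self_nonneg (x := x.1)
  have h3 := real_inner_self_nonneg (x := x.2)
  exact Prod.ext (inner_self_eq_zero (𝕜 := ℝ) |>.1 (by linarith))
    (inner_self_eq_zero (𝕜 := ℝ) |>.1 (by linarith))

/-- A Lagrangian subspace of a symplectic vector space can be completed to a symplectic
splitting. -/
theorem exists_linear_normal_form {B : E →L[ℝ] E →L[ℝ] ℝ} (hskew : ∀ u w, B u w = -B w u)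
    (hnd : ∀ u, (∀ w, B u w = 0) → u = 0) {L : V →L[ℝ] E} (hL : Function.Injective L)
    (hiso : ∀ u w, B (L u) (L w) = 0) (hdim : Module.finrank ℝ E = 2 * Module.finrank ℝ V) :
    ∃ T : E ≃L[ℝ] V × V, (∀ u w, stdSymp (T u) (T w) = B u w) ∧ ∀ u, T (L u) = (u, 0) := by
  -- `P x` represents the form `u ↦ B (L u) x`. Nondegeneracy makes `P` surjective, and a right
  -- inverse gives a complement dual to the range of `L`.
  let P : E →L[ℝ] V := (riesz V).comp
    (((ContinuousLinearMap.compL ℝ V E ℝ).flip L).comp B.flip)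
  have hP : ∀ u x, inner ℝ u (P x) = B (L u) x := fun u x => by
    rw [real_inner_comm]
    simp [P, inner_riesz]
  have hPsurj : Function.Surjective P := by
    have h1 : (P : E →ₗ[ℝ] V).range = ⊤ := by
      rw [← Submodule.orthogonal_eq_bot_iff, Submodule.eq_bot_iff]
      intro w hw
      apply hL
      rw [map_zero]
      refine hnd _ fun x => ?_
      rw [← hP, real_inner_comm]
      exact hw _ ⟨x, rfl⟩
    exact LinearMap.range_eq_top.1 h1
  obtain ⟨M₀', hM₀'⟩ := LinearMap.exists_rightInverse_of_surjective (P : E →ₗ[ℝ] V)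
    (LinearMap.range_eq_top.2 hPsurj)
  let M₀ : V →L[ℝ] E := LinearMap.toContinuousLinearMap M₀'
  have hM₀ : ∀ w, P (M₀ w) = w := fun w => congrArg (fun f : V →ₗ[ℝ] V => f w) hM₀'
  -- Adding `L ∘ A` to `M₀` does not change the pairing with `L`, whose range is isotropic. Each of
  -- the two cross terms removes half of `B (M₀ u) (M₀ w)`, hence the coefficient `-1 / 2`.
  let A : V →L[ℝ] V := (riesz V).comp
    ((ContinuousLinearMap.compL ℝ V E ℝ).flip M₀ |>.comp ((-(1 / 2 : ℝ)) • B.comp M₀))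
  have hA : ∀ u w, inner ℝ (A u) w = -(1 / 2) * B (M₀ u) (M₀ w) := fun u w => by
    simp [A, inner_riesz, inner_smul_left]
  let M : V →L[ℝ] E := M₀ + L.comp A
  have hLM : ∀ u w, B (L u) (M w) = inner ℝ u w := fun u w => by
    have : M w = M₀ w + L (A w) := rfl
    rw [this, map_add, hiso, add_zero, ← hP, hM₀]
  have hML : ∀ u w, B (M u) (L w) = -inner ℝ u w := fun u w => by
    rw [hskew, hLM, real_inner_comm]
  have hMM : ∀ u w, B (M u) (M w) = 0 := fun u w => by
    have e1 : M u = M₀ u + L (A u) := rfl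
    have e2 : M w = M₀ w + L (A w) := rfl
    have h1 : B (L (A u)) (M w) = -(1 / 2) * B (M₀ u) (M₀ w) := by rw [hLM, hA]
    have h2 : B (M₀ u) (L (A w)) = 1 / 2 * B (M₀ w) (M₀ u) := by
      rw [hskew, ← hP, hM₀, hA]; ring
    rw [e1, map_add, add_apply, h1, e2, map_add, h2, hskew (M₀ w)]
    ring
  let S : V × V →L[ℝ] E := L.coprod M
  have hS : ∀ x y, B (S x) (S y) = stdSymp x y := fun x y => by
    simp only [S, ContinuousLinearMap.coprod_apply, map_add, add_apply, hiso, hLM, hML, hMM,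
      stdSymp]
    ring
  have hSinj : Function.Injective (S : V × V →ₗ[ℝ] E) := by
    rw [← LinearMap.ker_eq_bot, LinearMap.ker_eq_bot']
    intro x hx
    refine eq_zero_of_stdSymp fun y => ?_
    rw [← hS, show S x = 0 from hx, map_zero, zero_apply]
  have hd : Module.finrank ℝ (V × V) = Module.finrank ℝ E := by
    rw [Module.finrank_prod, hdim, two_mul]
  let T := (LinearEquiv.ofInjectiveOfFinrankEq (S : V × V →ₗ[ℝ] E) hSinj hd).toContinuousLinearEquiv
  have hT : ∀ x, T x = S x := fun x => rfl
  refine ⟨T.symm, fun u w => ?_, fun u => ?_⟩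
  · rw [← hS, ← hT, ← hT, T.apply_symm_apply, T.apply_symm_apply]
  · rw [ContinuousLinearEquiv.symm_apply_eq, hT]
    simp [S]

/-- A local diffeomorphism restricted to a neighborhood where it is `C¹` both ways and has a given
local property. -/
theorem exists_openPartialHomeomorph {E F : Type*} [NormedAddCommGroup E] [NormedSpace ℝ E]
    [CompleteSpace E] [NormedAddCommGroup F] [NormedSpace ℝ F] {f : E → F} {a : E}
    (hf : ContDiffAt ℝ 1 f a) {e : E ≃L[ℝ] F} (he : HasFDerivAt f (e : E →L[ℝ] F) a)
    {p : E → Prop} (hp : ∀ᶠ x in 𝓝 a, p x) :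
    ∃ c : OpenPartialHomeomorph E F, a ∈ c.source ∧ (∀ x, c x = f x) ∧
      ContDiffOn ℝ 1 c c.source ∧ ContDiffOn ℝ 1 c.symm c.target ∧ ∀ x ∈ c.source, p x := by
  let c₀ := hf.toOpenPartialHomeomorph f he one_ne_zero
  have ha : a ∈ c₀.source := hf.mem_toOpenPartialHomeomorph_source he one_ne_zero
  have hsymm : ContDiffAt ℝ 1 c₀.symm (c₀ a) := hf.to_localInverse he one_ne_zero
  have hev : ∀ᶠ x in 𝓝 a, ContDiffAt ℝ 1 f x ∧ ContDiffAt ℝ 1 c₀.symm (c₀ x) ∧ p x := by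
    filter_upwards [hf.eventually (by simp), hp, (c₀.continuousAt ha).eventually
      (hsymm.eventually (by simp))] with x h1 h2 h3 using ⟨h1, h3, h2⟩
  obtain ⟨s, hs, hso, has⟩ := _root_.eventually_nhds_iff.1 hev
  let c := c₀.restrOpen s hso
  have hcs : c.source = c₀.source ∩ s := rfl
  refine ⟨c, ⟨ha, has⟩, fun x => rfl, fun x hx => (hs x hx.2).1.contDiffWithinAt, ?_,
    fun x hx => (hs x hx.2).2.2⟩
  intro y hy
  have h1 := c.map_target hy
  have h2 := (hs _ h1.2).2.1
  have h3 : c₀ (c.symm y) = y := c.right_inv hy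
  rw [h3] at h2
  exact h2.contDiffWithinAt

/-- The first component of `f` is a local diffeomorphism, so the image is locally a graph over `V ×
0`; a graph is isotropic exactly when the derivative of its defining map is symmetric. -/
theorem exists_straightening {f : V → V × V} (hf : ContDiffAt ℝ 1 f 0) (hf0 : f 0 = 0)
    (hf0' : ∀ u, fderiv ℝ f 0 u = (u, 0))
    (hiso : ∀ᶠ x in 𝓝 0, ∀ u w, stdSymp (fderiv ℝ f x u) (fderiv ℝ f x w) = 0) :
    ∃ α : V → V, ContDiffAt ℝ 1 α 0 ∧ α 0 = 0 ∧ fderiv ℝ α 0 = 0 ∧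
      (∀ᶠ x in 𝓝 0, (f x).2 = α (f x).1) ∧
      ∀ᶠ q in 𝓝 0, ∀ u w, inner ℝ (fderiv ℝ α q u) w = inner ℝ u (fderiv ℝ α q w) := by
  let f₁ : V → V := fun x => (f x).1
  have hf₁ : ContDiffAt ℝ 1 f₁ 0 := hf.fst
  have hd₁ : HasFDerivAt f₁ ((ContinuousLinearEquiv.refl ℝ V : V ≃L[ℝ] V) : V →L[ℝ] V) 0 := by
    refine (hf.differentiableAt one_ne_zero).hasFDerivAt.fst.congr_fderiv ?_
    ext u
    simp [hf0']
  have hf₁0 : f₁ 0 = 0 := by simp [f₁, hf0]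
  obtain ⟨c, h0, hcf, -, hsymm, hp⟩ := exists_openPartialHomeomorph hf₁ hd₁
    (hiso.and (hf.eventually (by simp)))
  have hc0 : c 0 = 0 := (hcf 0).trans hf₁0
  have h0t : (0 : V) ∈ c.target := hc0 ▸ c.map_source h0
  have hs0 : c.symm 0 = 0 := by simpa [hc0] using c.left_inv h0
  let α : V → V := fun q => (f (c.symm q)).2
  have hsAt : ∀ q ∈ c.target, ContDiffAt ℝ 1 c.symm q := fun q hq =>
    hsymm.contDiffAt (c.open_target.mem_nhds hq)
  have hfs : ∀ q ∈ c.target, HasFDerivAt (fun q => f (c.symm q))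
      ((fderiv ℝ f (c.symm q)).comp (fderiv ℝ c.symm q)) q := fun q hq =>
    ((hp _ (c.map_target hq)).2.differentiableAt one_ne_zero).hasFDerivAt.comp q
      ((hsAt q hq).differentiableAt one_ne_zero).hasFDerivAt
  have hfst : ∀ q ∈ c.target, ∀ u, (fderiv ℝ f (c.symm q) (fderiv ℝ c.symm q u)).1 = u := by
    intro q hq u
    have h1 : (fun q => (f (c.symm q)).1) =ᶠ[𝓝 q] id := by
      filter_upwards [c.open_target.mem_nhds hq] with y hy
      rw [← show c (c.symm y) = (f (c.symm y)).1 from hcf _, c.right_inv hy, id]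
    have h2 := ((hasFDerivAt_id q).congr_of_eventuallyEq h1).unique (hfs q hq).fst
    exact (congrArg (fun L => L u) h2).symm
  have hα : ∀ q ∈ c.target, HasFDerivAt α
      ((ContinuousLinearMap.snd ℝ V V).comp
        ((fderiv ℝ f (c.symm q)).comp (fderiv ℝ c.symm q))) q := fun q hq => (hfs q hq).snd
  refine ⟨α, ?_, ?_, ?_, ?_, ?_⟩
  · refine ContDiffAt.snd (ContDiffAt.comp (g := f) 0 ?_ (hsAt 0 h0t))
    rwa [hs0]
  · simp [α, hs0, hf0]
  · rw [(hα 0 h0t).fderiv, hs0]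
    ext u
    simp [hf0']
  · filter_upwards [c.open_source.mem_nhds h0] with x hx
    simp only [α]
    rw [← show c x = (f x).1 from hcf x, c.left_inv hx]
  · filter_upwards [c.open_target.mem_nhds h0t] with q hq u w
    have h1 := (hp _ (c.map_target hq)).1 (fderiv ℝ c.symm q u) (fderiv ℝ c.symm q w)
    simp only [stdSymp, hfst q hq] at h1
    rw [(hα q hq).fderiv]
    simp only [ContinuousLinearMap.comp_apply, ContinuousLinearMap.coe_snd']
    linarith

/-- Local normal form of a Lagrangian submanifold for a closed nondegenerate form. -/
theorem exists_lagrangian_normal_form {β : E → E →L[ℝ] E →L[ℝ] ℝ} {r : ℝ} (hr : 0 < r)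
    (hβ : ContDiffOn ℝ 1 β (ball 0 r))
    (hskew : ∀ x ∈ ball (0 : E) r, ∀ u w, β x u w = -β x w u)
    (hclosed : ∀ x ∈ ball (0 : E) r, ∀ u v w,
      fderiv ℝ β x u v w + fderiv ℝ β x v w u + fderiv ℝ β x w u v = 0)
    (hnd : ∀ u, (∀ w, β 0 u w = 0) → u = 0) {j : V → E} (hj : ContDiffAt ℝ 1 j 0)
    (hj0 : j 0 = 0) (hj0' : Function.Injective (fderiv ℝ j 0))
    (hiso : ∀ᶠ x in 𝓝 0, ∀ u w, β (j x) (fderiv ℝ j x u) (fderiv ℝ j x w) = 0)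
    (hdim : Module.finrank ℝ E = 2 * Module.finrank ℝ V)
    {p : E → Prop} (hp : ∀ᶠ x in 𝓝 0, p x) :
    ∃ c : OpenPartialHomeomorph E (V × V), 0 ∈ c.source ∧ c 0 = 0 ∧
      ContDiffOn ℝ 1 c c.source ∧ ContDiffOn ℝ 1 c.symm c.target ∧ (∀ x ∈ c.source, p x) ∧
      (∀ x ∈ c.source, ∀ u w, stdSymp (fderiv ℝ c x u) (fderiv ℝ c x w) = β x u w) ∧
      (∀ᶠ x in 𝓝 0, (c (j x)).2 = 0) ∧
      ∀ u, fderiv ℝ (fun x => c (j x)) 0 u = (u, 0) := by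
  obtain ⟨g, hg, hg0, hg0', hgβ⟩ := exists_darboux hr hβ hskew hclosed hnd
  have hgd : HasFDerivAt g ((ContinuousLinearEquiv.refl ℝ E : E ≃L[ℝ] E) : E →L[ℝ] E) 0 := by
    have := (hg.differentiableAt one_ne_zero).hasFDerivAt
    rwa [hg0'] at this
  obtain ⟨d, hd0, hdg, -, hdsymm, hdp⟩ := exists_openPartialHomeomorph hg hgd
    (hgβ.and (hg.eventually (by simp)))
  have hd00 : d 0 = 0 := (hdg 0).trans hg0
  have h0t : (0 : E) ∈ d.target := hd00 ▸ d.map_source hd0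
  have hs0 : d.symm 0 = 0 := by simpa [hd00] using d.left_inv hd0
  have hsAt : ∀ y ∈ d.target, ContDiffAt ℝ 1 d.symm y := fun y hy =>
    hdsymm.contDiffAt (d.open_target.mem_nhds hy)
  have hgs : ∀ y ∈ d.target, ∀ u, fderiv ℝ g (d.symm y) (fderiv ℝ d.symm y u) = u := by
    intro y hy u
    have h1 : (fun y => g (d.symm y)) =ᶠ[𝓝 y] id := by
      filter_upwards [d.open_target.mem_nhds hy] with z hz
      rw [← hdg, d.right_inv hz, id]
    have h2 := ((hdp _ (d.map_target hy)).2.differentiableAt one_ne_zero).hasFDerivAt.comp y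
      ((hsAt y hy).differentiableAt one_ne_zero).hasFDerivAt
    exact (congrArg (fun L => L u) (((hasFDerivAt_id y).congr_of_eventuallyEq h1).unique h2)).symm
  -- `g` pulls `β` back to the constant form `β 0`, so the inverse pulls `β 0` back to `β`.
  have hsβ : ∀ y ∈ d.target, ∀ u w,
      β 0 (fderiv ℝ d.symm y u) (fderiv ℝ d.symm y w) = β y u w := by
    intro y hy u w
    have h1 := (hdp _ (d.map_target hy)).1 (fderiv ℝ d.symm y u) (fderiv ℝ d.symm y w)
    rw [hgs y hy, hgs y hy, ← hdg, d.right_inv hy] at h1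
    exact h1.symm
  have hs0' : ∀ u, fderiv ℝ d.symm 0 u = u := fun u => by
    have := hgs 0 h0t u
    rwa [hs0, hg0'] at this
  have hβj0 : ∀ u w, β 0 (fderiv ℝ j 0 u) (fderiv ℝ j 0 w) = 0 := fun u w => by
    have := hiso.self_of_nhds u w
    rwa [hj0] at this
  obtain ⟨T, hT, hTL⟩ := exists_linear_normal_form (hskew 0 (mem_ball_self hr)) hnd hj0' hβj0 hdim
  have hjt : ∀ᶠ x in 𝓝 (0 : V), j x ∈ d.target := by
    refine hj.continuousAt.eventually_mem ?_
    rw [hj0]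
    exact d.open_target.mem_nhds h0t
  let f : V → V × V := fun x => T (d.symm (j x))
  have hfd : ∀ᶠ x in 𝓝 (0 : V), ∀ u, fderiv ℝ f x u =
      T (fderiv ℝ d.symm (j x) (fderiv ℝ j x u)) := by
    filter_upwards [hjt, hj.eventually (by simp)] with x hx hxj u
    have h1 := T.hasFDerivAt.comp x (((hsAt _ hx).differentiableAt one_ne_zero).hasFDerivAt.comp x
      (hxj.differentiableAt one_ne_zero).hasFDerivAt)
    rw [show fderiv ℝ f x = _ from h1.fderiv]
    rfl
  have hf : ContDiffAt ℝ 1 f 0 := by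
    refine T.contDiff.contDiffAt.comp 0 (ContDiffAt.comp 0 ?_ hj)
    rw [hj0]
    exact hsAt 0 h0t
  have hf0 : f 0 = 0 := by simp [f, hj0, hs0]
  have hf0' : ∀ u, fderiv ℝ f 0 u = (u, 0) := fun u => by
    rw [hfd.self_of_nhds, hj0, hs0', hTL]
  obtain ⟨α, hα, hα0, hα0', hαf, hαs⟩ := exists_straightening hf hf0 hf0' (by
    filter_upwards [hfd, hjt, hiso] with x h1 h2 h3 u w
    rw [h1, h1, hT, hsβ _ h2, h3])
  -- Undo the Darboux map, normalize linearly by `T`, then shear by `α`. The shear is symplectic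
  -- because `Dα` is symmetric; no potential of `α` is needed.
  let k : E → V × V := fun y => ((T (d.symm y)).1, (T (d.symm y)).2 - α (T (d.symm y)).1)
  have hTd : ContDiffAt ℝ 1 (fun y => T (d.symm y)) 0 :=
    T.contDiff.contDiffAt.comp 0 (hsAt 0 h0t)
  have hTd0 : T (d.symm 0) = 0 := by rw [hs0, map_zero]
  have hk : ContDiffAt ℝ 1 k 0 := by
    refine hTd.fst.prodMk (hTd.snd.sub (ContDiffAt.comp (g := α) 0 ?_ hTd.fst))
    rwa [hTd0]
  have hk0 : k 0 = 0 := by simp [k, hs0, hα0]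
  have hαev : ∀ᶠ y in 𝓝 (0 : E), ContDiffAt ℝ 1 α (T (d.symm y)).1 ∧ ∀ u w,
      inner ℝ (fderiv ℝ α (T (d.symm y)).1 u) w = inner ℝ u (fderiv ℝ α (T (d.symm y)).1 w) := by
    have h1 : Tendsto (fun y => (T (d.symm y)).1) (𝓝 0) (𝓝 0) := by
      have := hTd.fst.continuousAt.tendsto
      rwa [hTd0] at this
    exact h1.eventually ((hα.eventually (by simp)).and hαs)
  have hkd : ∀ᶠ y in 𝓝 (0 : E), ∀ u, fderiv ℝ k y u = ((T (fderiv ℝ d.symm y u)).1,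
      (T (fderiv ℝ d.symm y u)).2 - fderiv ℝ α (T (d.symm y)).1 (T (fderiv ℝ d.symm y u)).1) := by
    filter_upwards [d.open_target.mem_nhds h0t, hαev] with y hy hyα u
    have h1 := T.hasFDerivAt.comp y ((hsAt _ hy).differentiableAt one_ne_zero).hasFDerivAt
    have h2 := h1.fst.prodMk (h1.snd.sub
      (HasFDerivAt.comp (g := α) y (hyα.1.differentiableAt one_ne_zero).hasFDerivAt h1.fst))
    rw [show fderiv ℝ k y = _ from h2.fderiv]
    rfl
  have hkβ : ∀ᶠ y in 𝓝 (0 : E), ∀ u w, stdSymp (fderiv ℝ k y u) (fderiv ℝ k y w) = β y u w := by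
    filter_upwards [d.open_target.mem_nhds h0t, hαev, hkd] with y hy hyα hyk u w
    rw [← hsβ y hy, ← hT, hyk, hyk]
    simp only [stdSymp, inner_sub_left, inner_sub_right, hyα.2]
    ring
  have hkd0 : HasFDerivAt k ((T : E ≃L[ℝ] V × V) : E →L[ℝ] V × V) 0 := by
    refine (hk.differentiableAt one_ne_zero).hasFDerivAt.congr_fderiv ?_
    ext1 u
    rw [hkd.self_of_nhds, hTd0, hs0']
    simp only [Prod.fst_zero, hα0', zero_apply, sub_zero]
    rfl
  obtain ⟨c, hc0, hck, hcc, hcs, hcp⟩ := exists_openPartialHomeomorph hk hkd0 (hp.and hkβ)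
  have hck' : (c : E → V × V) = k := funext hck
  refine ⟨c, hc0, (hck 0).trans hk0, hcc, hcs, fun x hx => (hcp x hx).1, fun x hx => ?_, ?_, ?_⟩
  · rw [hck']
    exact (hcp x hx).2
  · filter_upwards [hαf] with x hx
    rw [hck']
    exact sub_eq_zero.2 hx
  · intro u
    rw [hck']
    have h1 : HasFDerivAt (fun x => k (j x)) _ 0 := HasFDerivAt.comp (g := k) 0
      (by rw [hj0]; exact hkd0) (hj.differentiableAt one_ne_zero).hasFDerivAt
    rw [h1.fderiv]
    exact hTL u

end NormalForm

/-! ### Two-forms on a manifold in charts -/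

section TwoFormChart

/-! ### Alternating forms of degree two as bilinear forms. -/

section Bilin

variable {E : Type*} [NormedAddCommGroup E] [NormedSpace ℝ E]

/-- The bilinear form underlying an alternating form of degree two. -/
def toBilin : (E [⋀^Fin 2]→L[ℝ] ℝ) →L[ℝ] E →L[ℝ] E →L[ℝ] ℝ :=
  (ContinuousLinearMap.compL ℝ E (ContinuousMultilinearMap ℝ (fun _ : Fin 1 => E) ℝ) (E →L[ℝ] ℝ)
    ((continuousMultilinearCurryFin1 ℝ E ℝ).toContinuousLinearEquiv :
      ContinuousMultilinearMap ℝ (fun _ : Fin 1 => E) ℝ →L[ℝ] (E →L[ℝ] ℝ))).comp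
    (((continuousMultilinearCurryLeftEquiv ℝ (fun _ : Fin 2 => E) ℝ).toContinuousLinearEquiv :
      ContinuousMultilinearMap ℝ (fun _ : Fin 2 => E) ℝ →L[ℝ] _).comp
      (ContinuousAlternatingMap.toContinuousMultilinearMapCLM ℝ))

theorem toBilin_apply (a : E [⋀^Fin 2]→L[ℝ] ℝ) (u w : E) : toBilin a u w = a ![u, w] := by
  change a _ = a _
  congr 1
  ext i
  fin_cases i <;> rfl

theorem toBilin_skew (a : E [⋀^Fin 2]→L[ℝ] ℝ) (u w : E) : toBilin a u w = -toBilin a w u := by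
  rw [toBilin_apply, toBilin_apply]
  refine Eq.trans ?_ (a.toAlternatingMap.map_swap ![w, u] (i := 0) (j := 1) (by decide))
  change a _ = a _
  congr 1
  ext i
  fin_cases i <;> rfl

/-- The exterior derivative on three vectors is an alternating sum of directional derivatives;
skewness of the form absorbs the minus sign of the middle term into a cyclic order. -/
theorem toBilin_cyclic_of_extDeriv {σ : E → E [⋀^Fin 2]→L[ℝ] ℝ} {x : E}
    (hσ : DifferentiableAt ℝ σ x) (h : extDeriv σ x = 0) (u v w : E) :
    fderiv ℝ (fun y => toBilin (σ y)) x u v w + fderiv ℝ (fun y => toBilin (σ y)) x v w u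
      + fderiv ℝ (fun y => toBilin (σ y)) x w u v = 0 := by
  have hd : DifferentiableAt ℝ (fun y => toBilin (σ y)) x :=
    (toBilin (E := E)).differentiableAt.comp x hσ
  have key : ∀ a b c : E, fderiv ℝ (fun y => toBilin (σ y)) x a b c
      = fderiv ℝ (fun y => σ y ![b, c]) x a := fun a b c => by
    have h1 : (fun y => σ y ![b, c]) = fun y => toBilin (σ y) b c := by
      funext y
      rw [toBilin_apply]
    rw [h1, fderiv_clm_apply (hd.clm_apply (differentiableAt_const _)) (differentiableAt_const _),
      fderiv_clm_apply hd (differentiableAt_const _)]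
    simp
  have hsk : ∀ a b c : E, fderiv ℝ (fun y => toBilin (σ y)) x a b c
      = -fderiv ℝ (fun y => toBilin (σ y)) x a c b := fun a b c => by
    rw [key, key]
    have h1 : (fun y => σ y ![b, c]) = fun y => -σ y ![c, b] := by
      funext y
      rw [← toBilin_apply, ← toBilin_apply, toBilin_skew]
    rw [h1, fderiv_fun_neg]
    rfl
  have h2 : extDeriv σ x ![u, v, w] = 0 := by
    rw [h]
    rfl
  rw [extDeriv_apply hσ, Fin.sum_univ_succ, Fin.sum_univ_two] at h2
  simp only [Fin.succ_zero_eq_one, Fin.succ_one_eq_two] at h2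
  have e0 : (0 : Fin 3).removeNth ![u, v, w] = ![v, w] := by
    ext i; fin_cases i <;> rfl
  have e1 : (1 : Fin 3).removeNth ![u, v, w] = ![u, w] := by
    ext i; fin_cases i <;> rfl
  have e2 : (2 : Fin 3).removeNth ![u, v, w] = ![u, v] := by
    ext i; fin_cases i <;> rfl
  rw [e0, e1, e2, ← key, ← key, ← key] at h2
  simp at h2
  rw [hsk v w u]
  linarith

end Bilin

/-! ### Symplectic forms and Lagrangian immersions in charts. -/

variable {d : ℕ} {M : Type*} [TopologicalSpace M]
  [ChartedSpace (EuclideanSpace ℝ (Fin d)) M] [IsManifold (𝓡 d) 1 M] {Ω : TwoForm d M}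
  {e : OpenPartialHomeomorph M (EuclideanSpace ℝ (Fin d))}

/-- All tangent spaces are the same model space, so the base point can be rewritten while the
vectors stay put. -/
theorem TwoForm.congr_base {x y : M} (h : y = x) (m : Fin 2 → EuclideanSpace ℝ (Fin d)) :
    Ω y m = Ω x m := by
  subst h
  rfl

theorem TwoForm.toBilin_inChart (y u w : EuclideanSpace ℝ (Fin d)) :
    toBilin (Ω.inChart e y) u w
      = Ω (e.symm y) ![mfderiv (𝓡 d) (𝓡 d) e.symm y u, mfderiv (𝓡 d) (𝓡 d) e.symm y w] := by
  rw [toBilin_apply]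
  change Ω (e.symm y) _ = _
  congr 1
  ext i
  fin_cases i <;> rfl

theorem TwoForm.toBilin_inChart_mfderiv (he : e ∈ atlas (EuclideanSpace ℝ (Fin d)) M) {x : M}
    (hx : x ∈ e.source) (u w : TangentSpace (𝓡 d) x) :
    toBilin (Ω.inChart e (e x)) (mfderiv (𝓡 d) (𝓡 d) e x u) (mfderiv (𝓡 d) (𝓡 d) e x w)
      = Ω x ![u, w] := by
  have h := (mdifferentiable_of_mem_atlas (I := 𝓡 d) he).symm_comp_deriv hx
  have h' : ∀ u : EuclideanSpace ℝ (Fin d),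
      mfderiv (𝓡 d) (𝓡 d) e.symm (e x) (mfderiv (𝓡 d) (𝓡 d) e x u) = u := fun u =>
    congrArg (fun L : EuclideanSpace ℝ (Fin d) →L[ℝ] EuclideanSpace ℝ (Fin d) => L u) h
  refine (TwoForm.toBilin_inChart _ _ _).trans ?_
  refine (TwoForm.congr_base (e.left_inv hx) _).trans ?_
  congr 1
  ext i : 1
  fin_cases i
  · exact h' u
  · exact h' w

theorem TwoForm.IsSymplectic.nondegenerate_inChart (hΩ : Ω.IsSymplectic)
    (he : e ∈ atlas (EuclideanSpace ℝ (Fin d)) M) {y : EuclideanSpace ℝ (Fin d)}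
    (hy : y ∈ e.target) {u : EuclideanSpace ℝ (Fin d)}
    (h : ∀ w, toBilin (Ω.inChart e y) u w = 0) : u = 0 := by
  have hm := mdifferentiable_of_mem_atlas (I := 𝓡 d) he
  have h1 := hm.comp_symm_deriv hy
  have h1' : ∀ u : EuclideanSpace ℝ (Fin d),
      mfderiv (𝓡 d) (𝓡 d) e (e.symm y) (mfderiv (𝓡 d) (𝓡 d) e.symm y u) = u := fun u =>
    congrArg (fun L : EuclideanSpace ℝ (Fin d) →L[ℝ] EuclideanSpace ℝ (Fin d) => L u) h1
  have h2 : mfderiv (𝓡 d) (𝓡 d) e.symm y u = 0 := by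
    refine hΩ.nondegenerate (e.symm y) _ fun w => ?_
    have h3 := TwoForm.toBilin_inChart_mfderiv (Ω := Ω) he (e.map_target hy)
      (mfderiv (𝓡 d) (𝓡 d) e.symm y u) w
    rw [← h3, h1', e.right_inv hy]
    exact h _
  rw [← h1' u, h2]
  exact map_zero _

/-- The coordinate expression of a map between manifolds. -/
theorem contDiffAt_coord {m n : ℕ} {M W : Type*} [TopologicalSpace M]
    [ChartedSpace (EuclideanSpace ℝ (Fin m)) M] [IsManifold (𝓡 m) 1 M] [TopologicalSpace W]
    [ChartedSpace (EuclideanSpace ℝ (Fin n)) W] [IsManifold (𝓡 n) 1 W]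
    {ι : W → M} (hι : ContMDiff (𝓡 n) (𝓡 m) 1 ι) 
    {e : OpenPartialHomeomorph M (EuclideanSpace ℝ (Fin m))}
    (he : e ∈ atlas (EuclideanSpace ℝ (Fin m)) M)
    {k : OpenPartialHomeomorph W (EuclideanSpace ℝ (Fin n))}
    (hk : k ∈ atlas (EuclideanSpace ℝ (Fin n)) W) (a : EuclideanSpace ℝ (Fin m))
    (b : EuclideanSpace ℝ (Fin n)) {x : EuclideanSpace ℝ (Fin n)}
    (hx : x + b ∈ k.target)
    (hx' : ι (k.symm (x + b))
      ∈ e.source) :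
    ContDiffAt ℝ 1 (fun x => e (ι (k.symm (x + b))) - a) x ∧
    ∀ u, fderiv ℝ (fun x => e (ι (k.symm (x + b))) - a) x u
      = mfderiv (𝓡 m) (𝓡 m) e
          (ι (k.symm (x + b)))
        (mfderiv (𝓡 n) (𝓡 m) ι (k.symm (x + b))
          (mfderiv (𝓡 n) (𝓡 n) k.symm (x + b) u)) := by
  have c1 : ContMDiffAt (𝓡 n) (𝓡 n) 1 k.symm (x + b) :=
    (contMDiffOn_symm_of_mem_maximalAtlas
      (IsManifold.subset_maximalAtlas (I := 𝓡 n) hk)).contMDiffAt (k.open_target.mem_nhds hx)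
  have c2 : ContMDiffAt (𝓡 n) (𝓡 m) 1 ι (k.symm (x + b)) := hι _
  have c3 : ContMDiffAt (𝓡 m) (𝓡 m) 1 e (ι (k.symm (x + b))) :=
    (contMDiffOn_of_mem_maximalAtlas
      (IsManifold.subset_maximalAtlas (I := 𝓡 m) he)).contMDiffAt (e.open_source.mem_nhds hx')
  have c23 : ContMDiffAt (𝓡 n) (𝓡 m) 1 (e ∘ ι) (k.symm (x + b)) := c3.comp _ c2
  have c : ContMDiffAt (𝓡 n) (𝓡 m) 1 ((e ∘ ι) ∘ k.symm) (x + b) := c23.comp _ c1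
  have d := mfderiv_comp (x + b) (c23.mdifferentiableAt one_ne_zero)
    (c1.mdifferentiableAt one_ne_zero)
  have d' := mfderiv_comp (k.symm (x + b)) (c3.mdifferentiableAt one_ne_zero)
    (c2.mdifferentiableAt one_ne_zero)
  rw [d', mfderiv_eq_fderiv] at d
  have cd : ContDiffAt ℝ 1 ((e ∘ ι) ∘ k.symm) (x + b) := contMDiffAt_iff_contDiffAt.1 c
  have cj : ContDiffAt ℝ 1 (fun x => ((e ∘ ι) ∘ k.symm) (x + b)) x :=
    ContDiffAt.comp (g := (e ∘ ι) ∘ k.symm) (f := fun x => x + b) x cd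
      (contDiffAt_id.add contDiffAt_const)
  refine ⟨cj.sub contDiffAt_const, fun u => ?_⟩
  have hj : fderiv ℝ (fun x => e (ι (k.symm (x + b))) - a) x
      = fderiv ℝ ((e ∘ ι) ∘ k.symm) (x + b) := by
    rw [fderiv_sub_const, ← fderiv_comp_add_right]
    rfl
  rw [hj]
  exact congrArg (fun L : EuclideanSpace ℝ (Fin n) →L[ℝ] EuclideanSpace ℝ (Fin m) => L u) d

theorem eq_zero_of_mfderiv_eq_zero {m : ℕ} {M : Type*} [TopologicalSpace M]
    [ChartedSpace (EuclideanSpace ℝ (Fin m)) M] [IsManifold (𝓡 m) 1 M] {F : Type*}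
    [NormedAddCommGroup F] [NormedSpace ℝ F] {e : OpenPartialHomeomorph M F}
    (he : e.MDifferentiable (𝓡 m) 𝓘(ℝ, F)) {x : M} (hx : x ∈ e.source)
    {u : TangentSpace (𝓡 m) x} (hu : mfderiv (𝓡 m) 𝓘(ℝ, F) e x u = 0) : u = 0 := by
  have h1 := he.symm_comp_deriv hx
  have h2 : mfderiv 𝓘(ℝ, F) (𝓡 m) e.symm (e x) (mfderiv (𝓡 m) 𝓘(ℝ, F) e x u) = u :=
    congrArg (fun L : EuclideanSpace ℝ (Fin m) →L[ℝ] EuclideanSpace ℝ (Fin m) => L u) h1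
  rw [← h2, hu]
  exact map_zero _

theorem eq_zero_of_mfderiv_symm_eq_zero {m : ℕ} {M : Type*} [TopologicalSpace M]
    [ChartedSpace (EuclideanSpace ℝ (Fin m)) M] [IsManifold (𝓡 m) 1 M] {F : Type*}
    [NormedAddCommGroup F] [NormedSpace ℝ F] {e : OpenPartialHomeomorph M F}
    (he : e.MDifferentiable (𝓡 m) 𝓘(ℝ, F)) {y : F} (hy : y ∈ e.target)
    {u : F} (hu : mfderiv 𝓘(ℝ, F) (𝓡 m) e.symm y u = 0) : u = 0 := by
  have h1 := he.comp_symm_deriv hy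
  have h2 : mfderiv (𝓡 m) 𝓘(ℝ, F) e (e.symm y) (mfderiv 𝓘(ℝ, F) (𝓡 m) e.symm y u) = u :=
    congrArg (fun L : F →L[ℝ] F => L u) h1
  rw [← h2, hu]
  exact map_zero _

/-- The charts are translated so that `ι z` and `z` sit at the origin; `β` and `j` are `Ω` and `ι`
in these coordinates. Their properties on manifolds become the hypotheses of
`exists_lagrangian_normal_form`. -/
theorem exists_darboux_in_charts {n : ℕ} {M W : Type*} [TopologicalSpace M]
    [ChartedSpace (EuclideanSpace ℝ (Fin (2 * n))) M] [IsManifold (𝓡 (2 * n)) 1 M]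
    {Ω : TwoForm (2 * n) M} (hΩ : Ω.IsSymplectic) [TopologicalSpace W]
    [ChartedSpace (EuclideanSpace ℝ (Fin n)) W] [IsManifold (𝓡 n) 1 W]
    {ι : W → M} (hι : IsLagrangianSubmanifold Ω ι) (z : W)
    {e : OpenPartialHomeomorph M (EuclideanSpace ℝ (Fin (2 * n)))}
    (he : e ∈ atlas (EuclideanSpace ℝ (Fin (2 * n))) M)
    {k : OpenPartialHomeomorph W (EuclideanSpace ℝ (Fin n))}
    (hk : k ∈ atlas (EuclideanSpace ℝ (Fin n)) W) (hez : ι z ∈ e.source) (hkz : z ∈ k.source)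
    {a₀ : EuclideanSpace ℝ (Fin (2 * n))} (ha : a₀ = e (ι z))
    {b₀ : EuclideanSpace ℝ (Fin n)} (hb : b₀ = k z)
    {β : EuclideanSpace ℝ (Fin (2 * n)) →
      EuclideanSpace ℝ (Fin (2 * n)) →L[ℝ] EuclideanSpace ℝ (Fin (2 * n)) →L[ℝ] ℝ}
    (hβ : β = fun y => toBilin (Ω.inChart e (y + a₀)))
    {j : EuclideanSpace ℝ (Fin n) → EuclideanSpace ℝ (Fin (2 * n))}
    (hj : j = fun x => e (ι (k.symm (x + b₀))) - a₀) :
    ∃ c : OpenPartialHomeomorph (EuclideanSpace ℝ (Fin (2 * n)))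
        (EuclideanSpace ℝ (Fin n) × EuclideanSpace ℝ (Fin n)),
      0 ∈ c.source ∧ ContDiffOn ℝ 1 c c.source ∧ ContDiffOn ℝ 1 c.symm c.target ∧
      (∀ x ∈ c.source, ∀ u w, stdSymp (fderiv ℝ c x u) (fderiv ℝ c x w) = β x u w) ∧
      j 0 = 0 ∧ ContDiffAt ℝ 1 j 0 ∧ (∀ u, fderiv ℝ (fun x => c (j x)) 0 u = (u, 0)) ∧
      ∀ᶠ x in 𝓝 0, (c (j x)).2 = 0 ∧ x + b₀ ∈ k.target ∧ ι (k.symm (x + b₀)) ∈ e.source := by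
  have ha₀ : a₀ ∈ e.target := ha ▸ e.map_source hez
  have hb₀ : b₀ ∈ k.target := hb ▸ k.map_source hkz
  have htgt : ∀ᶠ y in 𝓝 (0 : EuclideanSpace ℝ (Fin (2 * n))), y + a₀ ∈ e.target := by
    have : Tendsto (fun y => y + a₀) (𝓝 0) (𝓝 (0 + a₀)) :=
      (continuous_id.add continuous_const).tendsto 0
    rw [zero_add] at this
    exact this (e.open_target.mem_nhds ha₀)
  obtain ⟨r, hr, hball⟩ := Metric.eventually_nhds_iff_ball.1 htgt
  have hnear : ∀ᶠ x in 𝓝 (0 : EuclideanSpace ℝ (Fin n)),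
      x + b₀ ∈ k.target ∧ ι (k.symm (x + b₀)) ∈ e.source := by
    have h1 : Tendsto (fun x => x + b₀) (𝓝 0) (𝓝 (0 + b₀)) :=
      (continuous_id.add continuous_const).tendsto 0
    rw [zero_add] at h1
    refine h1.eventually (p := fun y => y ∈ k.target ∧ ι (k.symm y) ∈ e.source) ?_
    have h2 : Tendsto (fun x => ι (k.symm x)) (𝓝 b₀) (𝓝 (ι z)) := by
      have := (hι.contMDiff.continuous.continuousAt (x := k.symm b₀)).comp
        (k.continuousAt_symm hb₀)
      have h3 : k.symm b₀ = z := by rw [hb, k.left_inv hkz]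
      rw [ContinuousAt, Function.comp_apply, h3] at this
      exact this
    exact Filter.inter_mem (k.open_target.mem_nhds hb₀) (h2 (e.open_source.mem_nhds hez))
  have hsm : ∀ x, x + b₀ ∈ k.target → ι (k.symm (x + b₀)) ∈ e.source →
      ContDiffAt ℝ 1 j x ∧ ∀ u, fderiv ℝ j x u
        = mfderiv (𝓡 (2 * n)) (𝓡 (2 * n)) e (ι (k.symm (x + b₀)))
          (mfderiv (𝓡 n) (𝓡 (2 * n)) ι (k.symm (x + b₀))
            (mfderiv (𝓡 n) (𝓡 n) k.symm (x + b₀) u)) := fun x hx hx' => by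
    rw [hj]
    exact contDiffAt_coord hι.contMDiff he hk a₀ b₀ hx hx'
  have hz' : k.symm (0 + b₀) = z := by
    rw [zero_add, hb, k.left_inv hkz]
  have hj0 : j 0 = 0 := by
    simp only [hj, hz', ha, sub_self]
  have h0 := hnear.self_of_nhds
  have hsmooth : ContDiffOn ℝ 1 (Ω.inChart e) e.target :=
    (hΩ.smooth e he).of_le (by exact_mod_cast le_top)
  have hsmoothAt : ∀ y ∈ ball (0 : EuclideanSpace ℝ (Fin (2 * n))) r,
      ContDiffAt ℝ 1 (Ω.inChart e) (y + a₀) := fun y hy =>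
    hsmooth.contDiffAt (e.open_target.mem_nhds (hball y hy))
  have hβ1 : ContDiffOn ℝ 1 β (ball 0 r) := fun y hy => by
    have h1 : ContDiffAt ℝ 1 (fun y => Ω.inChart e (y + a₀)) y :=
      ContDiffAt.comp (g := Ω.inChart e) (f := fun y => y + a₀) y (hsmoothAt y hy)
        (contDiffAt_id.add contDiffAt_const)
    rw [hβ]
    exact ((toBilin (E := EuclideanSpace ℝ (Fin (2 * n)))).contDiff.contDiffAt.comp y
      h1).contDiffWithinAt
  have hβ2 : ∀ x ∈ ball (0 : EuclideanSpace ℝ (Fin (2 * n))) r, ∀ u w, β x u w = -β x w u :=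
    fun y _ u w => by
      rw [hβ]
      exact toBilin_skew _ u w
  have hβ3 : ∀ x ∈ ball (0 : EuclideanSpace ℝ (Fin (2 * n))) r, ∀ u v w,
      fderiv ℝ β x u v w + fderiv ℝ β x v w u + fderiv ℝ β x w u v = 0 := fun y hy u v w => by
    have hβ' : fderiv ℝ β y
        = fderiv ℝ (fun y => toBilin (Ω.inChart e y)) (y + a₀) := by
      rw [hβ]
      exact fderiv_comp_add_right (f := fun y => toBilin (Ω.inChart e y)) a₀
    rw [hβ']
    exact toBilin_cyclic_of_extDeriv ((hsmoothAt y hy).differentiableAt one_ne_zero)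
      (hΩ.closed e he _ (hball y hy)) u v w
  have hβ4 : ∀ u, (∀ w, β 0 u w = 0) → u = 0 := fun u hu => by
    rw [hβ] at hu
    exact hΩ.nondegenerate_inChart he (hball 0 (mem_ball_self hr)) hu
  have hinj : Function.Injective (fderiv ℝ j 0) := by
    refine (injective_iff_map_eq_zero _).2 fun u hu => ?_
    rw [(hsm 0 h0.1 h0.2).2] at hu
    have h1 := eq_zero_of_mfderiv_eq_zero
      (mdifferentiable_of_mem_atlas (I := 𝓡 (2 * n)) he) h0.2 hu
    have h2 := hι.injective_mfderiv _ (h1.trans (map_zero _).symm)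
    exact eq_zero_of_mfderiv_symm_eq_zero
      (mdifferentiable_of_mem_atlas (I := 𝓡 n) hk) h0.1 h2
  have hiso : ∀ᶠ x in 𝓝 0, ∀ u w, β (j x) (fderiv ℝ j x u) (fderiv ℝ j x w) = 0 := by
    filter_upwards [hnear] with x hx u w
    rw [(hsm x hx.1 hx.2).2, (hsm x hx.1 hx.2).2]
    have h1 : j x + a₀ = e (ι (k.symm (x + b₀))) := by
      rw [hj]
      exact sub_add_cancel _ _
    simp only [hβ]
    rw [h1]
    exact (TwoForm.toBilin_inChart_mfderiv he hx.2 _ _).trans (hι.isotropic _ _ _)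
  obtain ⟨c, hc0, hc00, hc1, hc2, -, hcs, hcj, hcj'⟩ :=
    exists_lagrangian_normal_form hr hβ1 hβ2 hβ3 hβ4 (hsm 0 h0.1 h0.2).1 hj0 hinj hiso
      (by simp) htgt
  exact ⟨c, hc0, hc1, hc2, hcs, hj0, (hsm 0 h0.1 h0.2).1, hcj', hcj.and hnear⟩

/-- Around a point of a Lagrangian submanifold there are Darboux coordinates of the ambient
manifold that extend coordinates of the submanifold. -/
theorem exists_adapted_charts {n : ℕ} {M W : Type*} [TopologicalSpace M]
    [ChartedSpace (EuclideanSpace ℝ (Fin (2 * n))) M] [IsManifold (𝓡 (2 * n)) 1 M]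
    {Ω : TwoForm (2 * n) M} (hΩ : Ω.IsSymplectic) [TopologicalSpace W]
    [ChartedSpace (EuclideanSpace ℝ (Fin n)) W] [IsManifold (𝓡 n) 1 W]
    {ι : W → M} (hι : IsLagrangianSubmanifold Ω ι) (z : W) :
    ∃ (C : OpenPartialHomeomorph M (EuclideanSpace ℝ (Fin n) × EuclideanSpace ℝ (Fin n)))
      (D : OpenPartialHomeomorph W (EuclideanSpace ℝ (Fin n))), z ∈ D.source ∧
      ContMDiffOn (𝓡 (2 * n)) 𝓘(ℝ, EuclideanSpace ℝ (Fin n) × EuclideanSpace ℝ (Fin n)) 1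
        C C.source ∧
      ContMDiffOn 𝓘(ℝ, EuclideanSpace ℝ (Fin n) × EuclideanSpace ℝ (Fin n)) (𝓡 (2 * n)) 1
        C.symm C.target ∧
      ContMDiffOn (𝓡 n) (𝓡 n) 1 D D.source ∧ ContMDiffOn (𝓡 n) (𝓡 n) 1 D.symm D.target ∧
      (∀ x ∈ C.source, ∀ u w : TangentSpace (𝓡 (2 * n)) x, stdSymp
        (mfderiv (𝓡 (2 * n)) 𝓘(ℝ, EuclideanSpace ℝ (Fin n) × EuclideanSpace ℝ (Fin n)) C x u)
        (mfderiv (𝓡 (2 * n)) 𝓘(ℝ, EuclideanSpace ℝ (Fin n) × EuclideanSpace ℝ (Fin n)) C x w)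
          = Ω x ![u, w]) ∧
      ∀ w ∈ D.source, ι w ∈ C.source ∧ C (ι w) = (D w, 0) := by
  set e := chartAt (EuclideanSpace ℝ (Fin (2 * n))) (ι z) with he_def
  have he : e ∈ atlas (EuclideanSpace ℝ (Fin (2 * n))) M := chart_mem_atlas _ _
  set k := chartAt (EuclideanSpace ℝ (Fin n)) z with hk_def
  have hk : k ∈ atlas (EuclideanSpace ℝ (Fin n)) W := chart_mem_atlas _ _
  have hez : ι z ∈ e.source := mem_chart_source _ _
  have hkz : z ∈ k.source := mem_chart_source _ _
  clear_value e k
  obtain ⟨a₀, ha⟩ : ∃ a, a = e (ι z) := ⟨_, rfl⟩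
  obtain ⟨b₀, hb⟩ : ∃ b, b = k z := ⟨_, rfl⟩
  obtain ⟨β, hβ⟩ : ∃ β : EuclideanSpace ℝ (Fin (2 * n)) →
      EuclideanSpace ℝ (Fin (2 * n)) →L[ℝ] EuclideanSpace ℝ (Fin (2 * n)) →L[ℝ] ℝ,
    β = fun y => toBilin (Ω.inChart e (y + a₀)) := ⟨_, rfl⟩
  obtain ⟨j, hj⟩ : ∃ j : EuclideanSpace ℝ (Fin n) → EuclideanSpace ℝ (Fin (2 * n)),
    j = fun x => e (ι (k.symm (x + b₀))) - a₀ := ⟨_, rfl⟩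
  obtain ⟨c, hc0, hc1, hc2, hcs, hj0, hjs, hjd, hev⟩ :=
    exists_darboux_in_charts hΩ hι z he hk hez hkz ha hb hβ hj
  have hcj : ContDiffAt ℝ 1 (fun x => c (j x)) 0 :=
    ContDiffAt.comp (g := c) (f := j) 0
      (by rw [hj0]; exact hc1.contDiffAt (c.open_source.mem_nhds hc0)) hjs
  have hf : HasFDerivAt (fun x => (c (j x)).1)
      ((ContinuousLinearEquiv.refl ℝ (EuclideanSpace ℝ (Fin n)) :
        EuclideanSpace ℝ (Fin n) →L[ℝ] EuclideanSpace ℝ (Fin n))) 0 := by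
    have h1 := (hcj.differentiableAt one_ne_zero).hasFDerivAt.fst
    refine h1.congr_fderiv ?_
    ext1 u
    change (fderiv ℝ (fun x => c (j x)) 0 u).1 = u
    rw [hjd]
  have hcs' : ∀ᶠ x in 𝓝 (0 : EuclideanSpace ℝ (Fin n)), j x ∈ c.source :=
    hjs.continuousAt.eventually_mem (by rw [hj0]; exact c.open_source.mem_nhds hc0)
  -- The first component of the immersion in Darboux coordinates is itself taken as coordinate on
  -- `W`, which makes `ι` read `q ↦ (q, 0)`.
  obtain ⟨g, hg0, hg, hg1, hg2, hgp⟩ := exists_openPartialHomeomorph hcj.fst hf (hev.and hcs')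
  let C := (e.transHomeomorph (Homeomorph.subRight a₀)).trans c
  let D := (k.transHomeomorph (Homeomorph.subRight b₀)).trans g
  have hCs : ∀ x ∈ C.source, x ∈ e.source ∧ e x - a₀ ∈ c.source := fun x hx => hx
  have hCt : ∀ y ∈ C.target, y ∈ c.target ∧ c.symm y + a₀ ∈ e.target := fun y hy => by
    refine ⟨hy.1, ?_⟩
    have h1 := hy.2
    simpa [OpenPartialHomeomorph.transHomeomorph] using h1
  have hDs : ∀ x ∈ D.source, x ∈ k.source ∧ k x - b₀ ∈ g.source := fun x hx => hx
  have hDt : ∀ y ∈ D.target, y ∈ g.target ∧ g.symm y + b₀ ∈ k.target := fun y hy => by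
    refine ⟨hy.1, ?_⟩
    have h1 := hy.2
    simpa [OpenPartialHomeomorph.transHomeomorph] using h1
  have me : ContMDiffOn (𝓡 (2 * n)) (𝓡 (2 * n)) 1 e e.source :=
    contMDiffOn_of_mem_maximalAtlas (IsManifold.subset_maximalAtlas he)
  have me' : ContMDiffOn (𝓡 (2 * n)) (𝓡 (2 * n)) 1 e.symm e.target :=
    contMDiffOn_symm_of_mem_maximalAtlas (IsManifold.subset_maximalAtlas he)
  have mk : ContMDiffOn (𝓡 n) (𝓡 n) 1 k k.source :=
    contMDiffOn_of_mem_maximalAtlas (IsManifold.subset_maximalAtlas hk)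
  have mk' : ContMDiffOn (𝓡 n) (𝓡 n) 1 k.symm k.target :=
    contMDiffOn_symm_of_mem_maximalAtlas (IsManifold.subset_maximalAtlas hk)
  have hcsub : ContDiffOn ℝ 1 (fun y => c (y - a₀)) ((fun y => y - a₀) ⁻¹' c.source) :=
    hc1.comp (contDiff_id.sub contDiff_const).contDiffOn fun _ h => h
  have hgsub : ContDiffOn ℝ 1 (fun y => g (y - b₀)) ((fun y => y - b₀) ⁻¹' g.source) :=
    hg1.comp (contDiff_id.sub contDiff_const).contDiffOn fun _ h => h
  have hcadd : ContDiffOn ℝ 1 (fun y => c.symm y + a₀) c.target := hc2.add contDiffOn_const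
  have hgadd : ContDiffOn ℝ 1 (fun y => g.symm y + b₀) g.target := hg2.add contDiffOn_const
  refine ⟨C, D, ⟨hkz, ?_⟩, ?_, ?_, ?_, ?_, ?_, ?_⟩
  · change k z - b₀ ∈ g.source
    rwa [hb, sub_self]
  · exact hcsub.contMDiffOn.comp (me.mono fun x hx => (hCs x hx).1) fun x hx => (hCs x hx).2
  · exact me'.comp (hcadd.contMDiffOn.mono fun x hx => (hCt x hx).1) fun x hx => (hCt x hx).2
  · exact hgsub.contMDiffOn.comp (mk.mono fun x hx => (hDs x hx).1) fun x hx => (hDs x hx).2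
  · exact mk'.comp (hgadd.contMDiffOn.mono fun x hx => (hDt x hx).1) fun x hx => (hDt x hx).2
  · intro x hx u w
    have h1 : MDifferentiableAt (𝓡 (2 * n)) (𝓡 (2 * n)) e x :=
      (me.contMDiffAt (e.open_source.mem_nhds (hCs x hx).1)).mdifferentiableAt one_ne_zero
    have h2 : ContDiffAt ℝ 1 c (e x - a₀) :=
      hc1.contDiffAt (c.open_source.mem_nhds (hCs x hx).2)
    have h2' : DifferentiableAt ℝ (fun y => c (y - a₀)) (e x) :=
      (h2.comp (e x) (contDiffAt_id.sub contDiffAt_const)).differentiableAt one_ne_zero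
    have h3 := mfderiv_comp x h2'.mdifferentiableAt h1
    rw [mfderiv_eq_fderiv, fderiv_comp_sub] at h3
    have h4 : ∀ u : EuclideanSpace ℝ (Fin (2 * n)),
        mfderiv (𝓡 (2 * n)) 𝓘(ℝ, EuclideanSpace ℝ (Fin n) × EuclideanSpace ℝ (Fin n)) C x u
          = fderiv ℝ c (e x - a₀) (mfderiv (𝓡 (2 * n)) (𝓡 (2 * n)) e x u) := fun u =>
      congrArg (fun L : EuclideanSpace ℝ (Fin (2 * n)) →L[ℝ]
        EuclideanSpace ℝ (Fin n) × EuclideanSpace ℝ (Fin n) => L u) h3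
    refine (congrArg₂ stdSymp (h4 u) (h4 w)).trans ?_
    refine (hcs _ (hCs x hx).2 _ _).trans ?_
    have h5 : β (e x - a₀) = toBilin (Ω.inChart e (e x)) := by
      rw [hβ]
      simp only [sub_add_cancel]
    rw [h5]
    exact TwoForm.toBilin_inChart_mfderiv he (hCs x hx).1 u w
  · intro x hx
    have h1 := hgp _ (hDs x hx).2
    have h2 : j (k x - b₀) = e (ι x) - a₀ := by
      rw [hj]
      simp only [sub_add_cancel, k.left_inv (hDs x hx).1]
    simp only [h2, sub_add_cancel, k.left_inv (hDs x hx).1] at h1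
    refine ⟨⟨h1.1.2.2, h1.2⟩, ?_⟩
    change c (e (ι x) - a₀) = (g (k x - b₀), 0)
    rw [hg, h2]
    exact Prod.ext rfl h1.1.1

end TwoFormChart

/-! ### Tangent vectors in a chart -/

theorem norm_smul_riemannianBundle {B : Type*} {E : B → Type*} [∀ x, TopologicalSpace (E x)]
    [∀ x, AddCommGroup (E x)] [∀ x, Module ℝ (E x)] [∀ x, IsTopologicalAddGroup (E x)]
    [∀ x, ContinuousConstSMul ℝ (E x)] [RiemannianBundle E] (x : B) (c : ℝ) (v : E x) :
    ‖c • v‖ = ‖c‖ * ‖v‖ :=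
  norm_smul c v

section TangentChart

variable {m : ℕ} {M : Type*} [TopologicalSpace M] [ChartedSpace (EuclideanSpace ℝ (Fin m)) M]
  [IsManifold (𝓡 m) 1 M] {H : Type*} [NormedAddCommGroup H] [NormedSpace ℝ H]
  {C : OpenPartialHomeomorph M H}

/-- The tangent map of a chart with values in a vector space. -/
def tangentChart (C : OpenPartialHomeomorph M H) (p : TangentBundle (𝓡 m) M) : H × H :=
  (C p.1, mfderiv (𝓡 m) 𝓘(ℝ, H) C p.1 p.2)

/-- The tangent map of the inverse of a chart with values in a vector space. -/
def tangentChartSymm (C : OpenPartialHomeomorph M H) (y : H × H) : TangentBundle (𝓡 m) M :=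
  ⟨C.symm y.1, mfderiv 𝓘(ℝ, H) (𝓡 m) C.symm y.1 y.2⟩

theorem mdifferentiable_chart_of_contMDiffOn (hC : ContMDiffOn (𝓡 m) 𝓘(ℝ, H) 1 C C.source)
    (hC' : ContMDiffOn 𝓘(ℝ, H) (𝓡 m) 1 C.symm C.target) :
    C.MDifferentiable (𝓡 m) 𝓘(ℝ, H) :=
  ⟨hC.mdifferentiableOn one_ne_zero, hC'.mdifferentiableOn one_ne_zero⟩

theorem tangentChartSymm_tangentChart (hC : ContMDiffOn (𝓡 m) 𝓘(ℝ, H) 1 C C.source)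
    (hC' : ContMDiffOn 𝓘(ℝ, H) (𝓡 m) 1 C.symm C.target) {p : TangentBundle (𝓡 m) M}
    (hp : p.1 ∈ C.source) : tangentChartSymm C (tangentChart C p) = p := by
  have h := (mdifferentiable_chart_of_contMDiffOn hC hC').symm_comp_deriv hp
  obtain ⟨x, v⟩ := p
  have h1 : mfderiv 𝓘(ℝ, H) (𝓡 m) C.symm (C x) (mfderiv (𝓡 m) 𝓘(ℝ, H) C x v) = v :=
    congrArg (fun L : EuclideanSpace ℝ (Fin m) →L[ℝ] EuclideanSpace ℝ (Fin m) => L v) h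
  have h2 : ∀ (a b : M) (u w : EuclideanSpace ℝ (Fin m)), a = b → u = w →
      (⟨a, u⟩ : TangentBundle (𝓡 m) M) = ⟨b, w⟩ := by
    rintro a b u w rfl rfl
    rfl
  exact h2 _ _ _ _ (C.left_inv hp) h1

theorem tangentChart_tangentChartSymm (hC : ContMDiffOn (𝓡 m) 𝓘(ℝ, H) 1 C C.source)
    (hC' : ContMDiffOn 𝓘(ℝ, H) (𝓡 m) 1 C.symm C.target) {y : H × H}
    (hy : y.1 ∈ C.target) : tangentChart C (tangentChartSymm (m := m) C y) = y := by
  have h := (mdifferentiable_chart_of_contMDiffOn hC hC').comp_symm_deriv hy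
  exact Prod.ext (C.right_inv hy) (congrArg (fun L : H →L[ℝ] H => L y.2) h)

theorem continuousOn_tangentChart (hC : ContMDiffOn (𝓡 m) 𝓘(ℝ, H) 1 C C.source) :
    ContinuousOn (tangentChart (m := m) C)
      ((TotalSpace.proj : TangentBundle (𝓡 m) M → M) ⁻¹' C.source) := by
  have h1 := hC.continuousOn_tangentMapWithin le_rfl C.open_source.uniqueMDiffOn
  have h2 := (tangentBundleModelSpaceHomeomorph 𝓘(ℝ, H)).continuous.comp_continuousOn h1
  refine ContinuousOn.congr (f := fun p => tangentBundleModelSpaceHomeomorph 𝓘(ℝ, H)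
    (tangentMapWithin (𝓡 m) 𝓘(ℝ, H) C C.source p)) h2 fun p hp => ?_
  rw [tangentBundleModelSpaceHomeomorph_coe]
  change _ = (C p.1, mfderivWithin (𝓡 m) 𝓘(ℝ, H) C C.source p.1 p.2)
  rw [mfderivWithin_of_isOpen C.open_source hp]
  rfl

theorem continuousOn_tangentChartSymm (hC' : ContMDiffOn 𝓘(ℝ, H) (𝓡 m) 1 C.symm C.target) :
    ContinuousOn (tangentChartSymm (m := m) C) (C.target ×ˢ univ) := by
  have h1 := hC'.continuousOn_tangentMapWithin le_rfl C.open_target.uniqueMDiffOn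
  have h2 : ContinuousOn (fun y : H × H => tangentMapWithin 𝓘(ℝ, H) (𝓡 m) C.symm C.target
      ((tangentBundleModelSpaceHomeomorph 𝓘(ℝ, H)).symm y)) (C.target ×ˢ univ) :=
    h1.comp (tangentBundleModelSpaceHomeomorph 𝓘(ℝ, H)).symm.continuous.continuousOn
      fun y hy => by
        rw [tangentBundleModelSpaceHomeomorph_coe_symm]
        exact hy.1
  refine h2.congr fun y hy => ?_
  rw [tangentBundleModelSpaceHomeomorph_coe_symm]
  change _ = (⟨C.symm y.1, mfderivWithin 𝓘(ℝ, H) (𝓡 m) C.symm C.target y.1 y.2⟩ :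
    TangentBundle (𝓡 m) M)
  rw [mfderivWithin_of_isOpen C.open_target hy.1]
  rfl

variable [FiniteDimensional ℝ H] [RiemannianBundle (fun x : M => TangentSpace (𝓡 m) x)]
  [IsContinuousRiemannianBundle (EuclideanSpace ℝ (Fin m))
    (fun x : M => TangentSpace (𝓡 m) x)]

theorem continuousOn_norm_tangentChartSymm
    (hC' : ContMDiffOn 𝓘(ℝ, H) (𝓡 m) 1 C.symm C.target) :
    ContinuousOn (fun y : H × H => ‖(tangentChartSymm (m := m) C y).2‖)
      (C.target ×ˢ univ) := by
  have h := continuousOn_tangentChartSymm hC'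
  have h1 := ContinuousOn.inner_bundle (F := EuclideanSpace ℝ (Fin m))
    (E := fun x : M => TangentSpace (𝓡 m) x) (b := fun y : H × H => C.symm y.1)
    (v := fun y => (tangentChartSymm (m := m) C y).2)
    (w := fun y => (tangentChartSymm (m := m) C y).2) h h
  refine (Real.continuous_sqrt.comp_continuousOn h1).congr fun y _ => ?_
  exact norm_eq_sqrt_real_inner _

/-- Over a compact set, a Riemannian metric is comparable with the norm of a chart. -/
theorem exists_norm_mfderiv_symm_bounds (hC : ContMDiffOn (𝓡 m) 𝓘(ℝ, H) 1 C C.source)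
    (hC' : ContMDiffOn 𝓘(ℝ, H) (𝓡 m) 1 C.symm C.target) {K : Set H} (hK : IsCompact K)
    (hKC : K ⊆ C.target) :
    ∃ κ : ℝ, 0 < κ ∧ ∀ y ∈ K, ∀ v : H,
      ‖(tangentChartSymm (m := m) C (y, v)).2‖ ≤ κ * ‖v‖ ∧
      ‖v‖ ≤ κ * ‖(tangentChartSymm (m := m) C (y, v)).2‖ := by
  -- By homogeneity it is enough to bound the Riemannian norm and its inverse on unit vectors over
  -- `K`, where both are continuous on a compact set.
  have hS : IsCompact (K ×ˢ sphere (0 : H) 1) := hK.prod (isCompact_sphere _ _)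
  have hcont := (continuousOn_norm_tangentChartSymm (m := m) hC').mono
    (prod_mono hKC (subset_univ (sphere (0 : H) 1)))
  have hpos : ∀ y ∈ K ×ˢ sphere (0 : H) 1, 0 < ‖(tangentChartSymm (m := m) C y).2‖ := by
    intro y hy
    refine norm_pos_iff.2 fun h0 => ?_
    have h1 := eq_zero_of_mfderiv_symm_eq_zero
      (mdifferentiable_chart_of_contMDiffOn hC hC') (hKC hy.1) h0
    have h2 := hy.2
    rw [h1] at h2
    simp at h2
  obtain ⟨b, hb⟩ := hS.bddAbove_image hcont
  obtain ⟨b', hb'⟩ := hS.bddAbove_image (hcont.inv₀ fun y hy => (hpos y hy).ne')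
  refine ⟨max 1 (max b b'), lt_max_of_lt_left one_pos, fun y hy v => ?_⟩
  rcases eq_or_ne v 0 with rfl | hv
  · have h0 : (tangentChartSymm (m := m) C (y, (0 : H))).2 = 0 := map_zero _
    rw [h0]
    simp
  have hv' : 0 < ‖v‖ := norm_pos_iff.2 hv
  have hmem : (y, ‖v‖⁻¹ • v) ∈ K ×ˢ sphere (0 : H) 1 :=
    ⟨hy, by simp [norm_smul, inv_mul_cancel₀ hv'.ne']⟩
  have hsm : (tangentChartSymm (m := m) C (y, ‖v‖⁻¹ • v)).2
      = ‖v‖⁻¹ • (tangentChartSymm (m := m) C (y, v)).2 := map_smul _ _ _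
  have h1 : ‖(tangentChartSymm (m := m) C (y, ‖v‖⁻¹ • v)).2‖
      = ‖v‖⁻¹ * ‖(tangentChartSymm (m := m) C (y, v)).2‖ := by
    refine (congrArg (fun w : TangentSpace (𝓡 m) (C.symm y) => ‖w‖) hsm).trans
      ((norm_smul_riemannianBundle (E := fun x : M => TangentSpace (𝓡 m) x) _ _ _).trans ?_)
    rw [norm_inv, norm_norm]
  have h2 := hb (mem_image_of_mem _ hmem)
  have h3 : ‖(tangentChartSymm (m := m) C (y, ‖v‖⁻¹ • v)).2‖⁻¹ ≤ b' :=
    hb' (mem_image_of_mem _ hmem)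
  have h4 := hpos _ hmem
  simp only [h1] at h2 h4
  rw [h1] at h3
  have h5 : 0 < ‖(tangentChartSymm (m := m) C (y, v)).2‖ := by
    by_contra h
    have : ‖v‖⁻¹ * ‖(tangentChartSymm (m := m) C (y, v)).2‖ ≤ 0 :=
      mul_nonpos_of_nonneg_of_nonpos (by positivity) (not_lt.1 h)
    linarith
  constructor
  · rw [inv_mul_le_iff₀ hv'] at h2
    calc _ ≤ ‖v‖ * b := h2
      _ = b * ‖v‖ := mul_comm _ _
      _ ≤ _ := by
        gcongr
        exact (le_max_left _ _).trans (le_max_right _ _)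
  · rw [mul_inv, inv_inv, mul_inv_le_iff₀ h5] at h3
    refine h3.trans ?_
    gcongr
    exact (le_max_right _ _).trans (le_max_right _ _)

/-- Over the compact coordinate ball `u` of radius `a`, lengths in the chart are at most `κ` times
Riemannian lengths. A path from `z` shorter than `a / κ` therefore never reaches the boundary of
`u`. As `u` is closed in `W`, the closure of the intrinsic ball stays in it too. -/
theorem exists_intrinsicDisk_subset {n : ℕ} {W : Type*} [TopologicalSpace W] [T2Space W]
    [ChartedSpace (EuclideanSpace ℝ (Fin n)) W] [IsManifold (𝓡 n) 1 W] {ι : W → M}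
    (hι : ContMDiff (𝓡 n) (𝓡 m) 1 ι)
    {C : OpenPartialHomeomorph M (EuclideanSpace ℝ (Fin n) × EuclideanSpace ℝ (Fin n))}
    {D : OpenPartialHomeomorph W (EuclideanSpace ℝ (Fin n))} {z : W} (hz : z ∈ D.source)
    (hC : ContMDiffOn (𝓡 m) 𝓘(ℝ, EuclideanSpace ℝ (Fin n) × EuclideanSpace ℝ (Fin n)) 1 C C.source)
    (hC' : ContMDiffOn 𝓘(ℝ, EuclideanSpace ℝ (Fin n) × EuclideanSpace ℝ (Fin n)) (𝓡 m) 1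
      C.symm C.target)
    (hCD : ∀ w ∈ D.source, ι w ∈ C.source ∧ C (ι w) = (D w, 0)) :
    ∃ R : ℝ, 0 < R ∧ ∃ u : Set W, IsCompact u ∧ u ⊆ D.source ∧ ∀ r ≤ R,
      intrinsicDisk (m := m) (n := n) ι z r ⊆ u := by
  obtain ⟨a, ha, haD⟩ := Metric.nhds_basis_closedBall.mem_iff.1
    (D.open_target.mem_nhds (D.map_source hz))
  let u : Set W := D.symm '' closedBall (D z) a
  have hu : IsCompact u := (isCompact_closedBall _ _).image_of_continuousOn
    (D.continuousOn_symm.mono haD)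
  have huD : u ⊆ D.source := by
    rintro _ ⟨y, hy, rfl⟩
    exact D.map_target (haD hy)
  have hmem : ∀ w ∈ u, D w ∈ closedBall (D z) a := by
    rintro _ ⟨y, hy, rfl⟩
    rwa [D.right_inv (haD hy)]
  have hmem' : ∀ w ∈ D.source, D w ∈ closedBall (D z) a → w ∈ u := fun w hw h =>
    ⟨D w, h, D.left_inv hw⟩
  obtain ⟨κ, hκ, hb⟩ := exists_norm_mfderiv_symm_bounds (m := m) hC hC'
    (hu.image_of_continuousOn (C.continuousOn.comp hι.continuous.continuousOn
      fun w hw => (hCD w (huD hw)).1) : IsCompact ((C ∘ ι) '' u)) (by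
        rintro _ ⟨w, hw, rfl⟩
        exact C.map_source (hCD w (huD hw)).1)
  have hnorm : ∀ x ∈ C.source, C x ∈ (C ∘ ι) '' u → ∀ v : TangentSpace (𝓡 m) x,
      ‖(tangentChart C (⟨x, v⟩ : TangentBundle (𝓡 m) M)).2‖ₑ ≤ ENNReal.ofReal κ * ‖v‖ₑ := by
    intro x hx hxu v
    have h1 := (hb _ hxu (tangentChart C ⟨x, v⟩).2).2
    have h2 := tangentChartSymm_tangentChart hC hC' (p := ⟨x, v⟩) hx
    have h3 : ‖(tangentChartSymm (m := m) C (C x, (tangentChart C ⟨x, v⟩).2)).2‖ = ‖v‖ :=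
      congrArg (fun p : TangentBundle (𝓡 m) M => ‖p.2‖) h2
    rw [h3] at h1
    rw [← ofReal_norm, ← ofReal_norm, ← ENNReal.ofReal_mul hκ.le]
    exact ENNReal.ofReal_le_ofReal h1
  refine ⟨a / κ, by positivity, u, hu, huD, fun r hr => ?_⟩
  refine closure_minimal (fun w hw => ?_) hu.isClosed
  have hw' : intrinsicEDist (m := m) (n := n) ι z w < ENNReal.ofReal (a / κ) :=
    lt_of_lt_of_le hw (ENNReal.ofReal_le_ofReal hr)
  simp only [intrinsicEDist, iInf_lt_iff] at hw'
  obtain ⟨γ, hγ, hγ0, hγ1, hlen⟩ := hw'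
  let A := γ ⁻¹' u
  have hzu : z ∈ u := hmem' z hz (mem_closedBall_self ha.le)
  have zero_mem : (0 : ℝ) ∈ A := by simpa [A, hγ0] using hzu
  have A_closed : IsClosed (A ∩ Icc 0 1) := by
    rw [inter_comm]
    exact hγ.continuousOn.preimage_isClosed_of_isClosed isClosed_Icc hu.isClosed
  suffices Icc 0 1 ⊆ A by
    have h1 : (1 : ℝ) ∈ A := this ⟨zero_le_one, le_rfl⟩
    simpa [A, hγ1] using h1
  -- Continuous induction: if the path has been in `u` up to time `t₁`, the length estimate puts it
  -- in the open coordinate ball at `t₁`, so it remains in `u` a little longer.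
  apply A_closed.Icc_subset_of_forall_mem_nhdsGT_of_Icc_subset zero_mem
  rintro t₁ ⟨ht₁0, ht₁1⟩ t₁_mem
  have hsrc : γ t₁ ∈ D.source := huD (t₁_mem ⟨ht₁0, le_rfl⟩)
  suffices h : D (γ t₁) ∈ ball (D z) a by
    have h1 : ContinuousWithinAt γ (Ioi t₁) t₁ :=
      (hγ.continuousOn t₁ ⟨ht₁0, ht₁1.le⟩).mono_of_mem_nhdsWithin
        (mem_of_superset (Ioo_mem_nhdsGT ht₁1) fun x hx => ⟨ht₁0.trans hx.1.le, hx.2.le⟩)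
    have h2 : u ∈ 𝓝 (γ t₁) := by
      filter_upwards [D.open_source.mem_nhds hsrc,
        (D.continuousAt hsrc).eventually_mem (isOpen_ball.mem_nhds h)] with w h3 h4
      exact hmem' w h3 (ball_subset_closedBall h4)
    exact h1 h2
  let σ : ℝ → EuclideanSpace ℝ (Fin n) × EuclideanSpace ℝ (Fin n) := C ∘ (ι ∘ γ)
  have hιγ : ContMDiffOn 𝓘(ℝ) (𝓡 m) 1 (ι ∘ γ) (Icc 0 t₁) :=
    hι.comp_contMDiffOn (hγ.mono (Icc_subset_Icc le_rfl ht₁1.le))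
  have hσ : ContMDiffOn 𝓘(ℝ) 𝓘(ℝ, EuclideanSpace ℝ (Fin n) × EuclideanSpace ℝ (Fin n)) 1 σ
      (Icc 0 t₁) :=
    hC.comp hιγ fun t ht => (hCD _ (huD (t₁_mem ht))).1
  have hfin : ‖σ t₁ - σ 0‖ₑ < ENNReal.ofReal a := by
    rcases ht₁0.eq_or_lt with h0 | h't'
    · simp [← h0, ha]
    calc
      ‖σ t₁ - σ 0‖ₑ
    _ ≤ ∫⁻ t' in Icc 0 t₁, ‖derivWithin σ (Icc 0 t₁) t'‖ₑ := by
      apply enorm_sub_le_lintegral_derivWithin_Icc_of_contDiffOn_Icc _ ht₁0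
      rwa [← contMDiffOn_iff_contDiffOn]
    _ ≤ ∫⁻ t' in Icc 0 t₁, ENNReal.ofReal κ *
        ‖mfderivWithin 𝓘(ℝ) (𝓡 m) (ι ∘ γ) (Icc 0 t₁) t' (1 : ℝ)‖ₑ := by
      apply setLIntegral_mono' measurableSet_Icc (fun t' ht' ↦ ?_)
      have hs := (hCD _ (huD (t₁_mem ht'))).1
      have hder : mfderivWithin 𝓘(ℝ) 𝓘(ℝ, EuclideanSpace ℝ (Fin n) × EuclideanSpace ℝ (Fin n)) σ
          (Icc 0 t₁) t' = (mfderiv (𝓡 m) 𝓘(ℝ, EuclideanSpace ℝ (Fin n) × EuclideanSpace ℝ (Fin n))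
            C (ι (γ t'))).comp (mfderivWithin 𝓘(ℝ) (𝓡 m) (ι ∘ γ) (Icc 0 t₁) t') := by
        apply mfderiv_comp_mfderivWithin
        · exact (hC.contMDiffAt (C.open_source.mem_nhds hs)).mdifferentiableAt one_ne_zero
        · exact hιγ.mdifferentiableOn one_ne_zero _ ht'
        · rw [uniqueMDiffWithinAt_iff_uniqueDiffWithinAt]
          exact uniqueDiffOn_Icc h't' _ ht'
      have hder' : derivWithin σ (Icc 0 t₁) t'
          = mfderiv (𝓡 m) 𝓘(ℝ, EuclideanSpace ℝ (Fin n) × EuclideanSpace ℝ (Fin n)) C (ι (γ t'))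
            (mfderivWithin 𝓘(ℝ) (𝓡 m) (ι ∘ γ) (Icc 0 t₁) t' (1 : ℝ)) := by
        rw [mfderivWithin_eq_fderivWithin] at hder
        rw [← fderivWithin_derivWithin]
        exact congrArg (fun L : ℝ →L[ℝ] EuclideanSpace ℝ (Fin n) × EuclideanSpace ℝ (Fin n) => L 1)
          hder
      rw [hder']
      exact hnorm (ι (γ t')) hs ⟨γ t', t₁_mem ht', rfl⟩ _
    _ = ENNReal.ofReal κ * pathELength (𝓡 m) (ι ∘ γ) 0 t₁ := by
      rw [lintegral_const_mul' _ _ ENNReal.ofReal_ne_top,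
          pathELength_eq_lintegral_mfderivWithin_Icc]
      rfl
    _ ≤ ENNReal.ofReal κ * pathELength (𝓡 m) (ι ∘ γ) 0 1 := by
      gcongr
    _ < ENNReal.ofReal κ * ENNReal.ofReal (a / κ) :=
      (ENNReal.mul_lt_mul_iff_right (by simpa using hκ) ENNReal.ofReal_ne_top).2 hlen
    _ = ENNReal.ofReal a := by
      rw [← ENNReal.ofReal_mul hκ.le, mul_div_cancel₀ _ hκ.ne']
  have h1 : σ t₁ - σ 0 = (D (γ t₁) - D z, 0) := by
    have h2 : σ t₁ = (D (γ t₁), 0) := (hCD _ hsrc).2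
    have h3 : σ 0 = (D z, 0) := by
      change C (ι (γ 0)) = _
      rw [hγ0, (hCD _ hz).2]
    rw [h2, h3]
    simp
  rw [h1, ← ofReal_norm, ENNReal.ofReal_lt_ofReal_iff ha] at hfin
  rw [mem_ball_iff_norm]
  exact lt_of_le_of_lt (norm_fst_le (D (γ t₁) - D z, (0 : EuclideanSpace ℝ (Fin n)))) hfin

end TangentChart

/-! ### Uniform control near compact sets -/

section Control

/-- Only `x` is confined to the compact set, while `y` is any nearby point: the maps to be compared
with the identity may leave `K`. -/
theorem exists_dist_lt_of_continuousOn {X Y : Type*} [PseudoMetricSpace X] [PseudoMetricSpace Y]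
    {f : X → Y} {O : Set X} (hO : IsOpen O) (hf : ContinuousOn f O) {K : Set X} (hK : IsCompact K)
    (hKO : K ⊆ O) {ε : ℝ} (hε : 0 < ε) :
    ∃ δ : ℝ, 0 < δ ∧ ∀ x ∈ K, ∀ y, dist x y < δ → y ∈ O ∧ dist (f x) (f y) < ε := by
  obtain ⟨δ₁, hδ₁, h1⟩ := hK.exists_thickening_subset_open hO hKO
  have h2 := hK.uniformContinuousAt_of_continuousAt f
    (fun a ha => hf.continuousAt (hO.mem_nhds (hKO ha))) (Metric.dist_mem_uniformity hε)
  obtain ⟨δ₂, hδ₂, h3⟩ := Metric.mem_uniformity_dist.1 h2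
  refine ⟨min δ₁ δ₂, lt_min hδ₁ hδ₂, fun x hx y hxy => ⟨h1 ?_, ?_⟩⟩
  · exact mem_thickening_iff.2 ⟨x, hx, by rw [dist_comm]; exact hxy.trans_le (min_le_left _ _)⟩
  · exact h3 (hxy.trans_le (min_le_right _ _)) hx

/-- This form passes from closeness for `ρ` to closeness in a chart, and the next one goes back. The
distance `ρ` enters only through its topology, so compactness replaces any metric comparison. -/
theorem exists_dist_lt_of_edist_lt {X Y : Type*} [τ : TopologicalSpace X] [PseudoMetricSpace Y]
    (ρ : MetricSpace X) (hρ : ρ.toUniformSpace.toTopologicalSpace = τ)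
    {f : X → Y} {O : Set X} (hO : IsOpen O) (hf : ContinuousOn f O) {K : Set X} (hK : IsCompact K)
    (hKO : K ⊆ O) {ε : ℝ} (hε : 0 < ε) :
    ∃ δ : ℝ, 0 < δ ∧ ∀ x ∈ K, ∀ y, ρ.edist x y < ENNReal.ofReal δ →
      y ∈ O ∧ dist (f x) (f y) < ε := by
  subst hρ
  obtain ⟨δ, hδ, h⟩ := exists_dist_lt_of_continuousOn hO hf hK hKO hε
  exact ⟨δ, hδ, fun x hx y hxy => h x hx y (by rwa [← edist_lt_ofReal])⟩

theorem exists_edist_lt_of_dist_lt {X Y : Type*} [PseudoMetricSpace X] [τ : TopologicalSpace Y]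
    (ρ : MetricSpace Y) (hρ : ρ.toUniformSpace.toTopologicalSpace = τ)
    {f : X → Y} {O : Set X} (hO : IsOpen O) (hf : ContinuousOn f O) {K : Set X} (hK : IsCompact K)
    (hKO : K ⊆ O) {ε : ℝ} (hε : 0 < ε) :
    ∃ δ : ℝ, 0 < δ ∧ ∀ x ∈ K, ∀ y, dist x y < δ →
      y ∈ O ∧ ρ.edist (f x) (f y) < ENNReal.ofReal ε := by
  subst hρ
  obtain ⟨δ, hδ, h⟩ := exists_dist_lt_of_continuousOn hO hf hK hKO hε
  exact ⟨δ, hδ, fun x hx y hxy => ⟨(h x hx y hxy).1, edist_lt_ofReal.2 (h x hx y hxy).2⟩⟩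

end Control

/-! ### Extension by the identity of a map supported in a chart -/

section Glue

variable {m : ℕ} {M : Type*} [TopologicalSpace M] [ChartedSpace (EuclideanSpace ℝ (Fin m)) M]
  [IsManifold (𝓡 m) 1 M] {H : Type*} [NormedAddCommGroup H] [NormedSpace ℝ H]
  {C : OpenPartialHomeomorph M H} {g : H → H}

open Classical in
/-- The map given by `g` in the chart `C`, extended by the identity. -/
def extendChart (C : OpenPartialHomeomorph M H) (g : H → H) (x : M) : M :=
  if x ∈ C.source then C.symm (g (C x)) else x

theorem extendChart_of_mem {x : M} (hx : x ∈ C.source) :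
    extendChart C g x = C.symm (g (C x)) := if_pos hx

theorem extendChart_of_notMem {L : Set H} (hgL : ∀ y ∉ L, g y = y)
    {x : M} (hx : x ∉ C.symm '' L) : extendChart C g x = x := by
  by_cases h : x ∈ C.source
  · rw [extendChart_of_mem h, hgL _ fun h1 => hx ⟨C x, h1, C.left_inv h⟩, C.left_inv h]
  · exact if_neg h

theorem extendChart_comp {g' : H → H} (hg : MapsTo g C.target C.target)
    (h : ∀ y, g' (g y) = y) (x : M) : extendChart C g' (extendChart C g x) = x := by
  by_cases hx : x ∈ C.source
  · have h1 := hg (C.map_source hx)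
    rw [extendChart_of_mem hx, extendChart_of_mem (C.map_target h1), C.right_inv h1, h,
      C.left_inv hx]
  · have h1 : extendChart C g x = x := if_neg hx
    rw [h1]
    exact if_neg hx

/-- The image of the support is compact, hence closed in the Hausdorff space `M`; this is what makes
the extension `C¹` at the boundary of the chart domain. -/
theorem extendChart_eventuallyEq_id [T2Space M] {L : Set H} (hL : IsCompact L)
    (hLC : L ⊆ C.target) (hgL : ∀ y ∉ L, g y = y) {x : M} (hx : x ∉ C.symm '' L) :
    extendChart C g =ᶠ[𝓝 x] id := by
  have hcl : IsClosed (C.symm '' L) :=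
    (hL.image_of_continuousOn (C.continuousOn_symm.mono hLC)).isClosed
  filter_upwards [hcl.isOpen_compl.mem_nhds hx] with y hy
  exact extendChart_of_notMem hgL hy

theorem extendChart_eventuallyEq {x : M} (hx : x ∈ C.source) :
    extendChart C g =ᶠ[𝓝 x] C.symm ∘ (g ∘ C) := by
  filter_upwards [C.open_source.mem_nhds hx] with y hy
  exact extendChart_of_mem hy

theorem contMDiff_extendChart [T2Space M] (hC : ContMDiffOn (𝓡 m) 𝓘(ℝ, H) 1 C C.source)
    (hC' : ContMDiffOn 𝓘(ℝ, H) (𝓡 m) 1 C.symm C.target) (hg : ContDiff ℝ 1 g)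
    (hgC : MapsTo g C.target C.target) {L : Set H} (hL : IsCompact L)
    (hLC : L ⊆ C.target) (hgL : ∀ y ∉ L, g y = y) :
    ContMDiff (𝓡 m) (𝓡 m) 1 (extendChart C g) := by
  intro x
  by_cases hx : x ∈ C.source
  · refine ContMDiffAt.congr_of_eventuallyEq ?_ (extendChart_eventuallyEq hx)
    refine ContMDiffAt.comp x (I' := 𝓘(ℝ, H)) ?_ ?_
    · exact hC'.contMDiffAt (C.open_target.mem_nhds (hgC (C.map_source hx)))
    · exact ContMDiffAt.comp x (I' := 𝓘(ℝ, H)) hg.contMDiff.contMDiffAt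
        (hC.contMDiffAt (C.open_source.mem_nhds hx))
  · refine contMDiffAt_id.congr_of_eventuallyEq (extendChart_eventuallyEq_id hL hLC hgL ?_)
    rintro ⟨y, hy, rfl⟩
    exact hx (C.map_target (hLC hy))

theorem tangentMap_extendChart_of_notMem [T2Space M] {L : Set H} (hL : IsCompact L)
    (hLC : L ⊆ C.target) (hgL : ∀ y ∉ L, g y = y) {p : TangentBundle (𝓡 m) M}
    (hp : p.1 ∉ C.symm '' L) : tangentMap (𝓡 m) (𝓡 m) (extendChart C g) p = p := by
  have h := (extendChart_eventuallyEq_id hL hLC hgL hp).mfderiv_eq (I := 𝓡 m) (I' := 𝓡 m)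
  have h2 : ∀ (a b : M) (u w : EuclideanSpace ℝ (Fin m)), a = b → u = w →
      (⟨a, u⟩ : TangentBundle (𝓡 m) M) = ⟨b, w⟩ := by
    rintro a b u w rfl rfl
    rfl
  rw [mfderiv_id] at h
  exact h2 _ _ _ _ (extendChart_of_notMem hgL hp)
    (congrArg (fun L : EuclideanSpace ℝ (Fin m) →L[ℝ] EuclideanSpace ℝ (Fin m) => L p.2) h)

theorem tangentMap_extendChart (hC : ContMDiffOn (𝓡 m) 𝓘(ℝ, H) 1 C C.source)
    (hC' : ContMDiffOn 𝓘(ℝ, H) (𝓡 m) 1 C.symm C.target) (hg : ContDiff ℝ 1 g)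
    (hgC : MapsTo g C.target C.target) {p : TangentBundle (𝓡 m) M} (hp : p.1 ∈ C.source) :
    tangentMap (𝓡 m) (𝓡 m) (extendChart C g) p
      = tangentChartSymm C (g (C p.1), fderiv ℝ g (C p.1) (tangentChart C p).2) := by
  have h := (extendChart_eventuallyEq (g := g) hp).mfderiv_eq (I := 𝓡 m) (I' := 𝓡 m)
  have h1 : MDifferentiableAt (𝓡 m) 𝓘(ℝ, H) C p.1 :=
    (hC.contMDiffAt (C.open_source.mem_nhds hp)).mdifferentiableAt one_ne_zero
  have h2 : MDifferentiableAt 𝓘(ℝ, H) 𝓘(ℝ, H) g (C p.1) :=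
    hg.contMDiff.contMDiffAt.mdifferentiableAt one_ne_zero
  have h3 : MDifferentiableAt 𝓘(ℝ, H) (𝓡 m) C.symm (g (C p.1)) :=
    (hC'.contMDiffAt (C.open_target.mem_nhds (hgC (C.map_source hp)))).mdifferentiableAt
      one_ne_zero
  have h4 := mfderiv_comp p.1 h2 h1
  have h5 := mfderiv_comp p.1 (g := C.symm) (f := g ∘ C) h3 (h2.comp p.1 h1)
  rw [h5, h4, mfderiv_eq_fderiv] at h
  have h6 : ∀ (a b : M) (u w : EuclideanSpace ℝ (Fin m)), a = b → u = w →
      (⟨a, u⟩ : TangentBundle (𝓡 m) M) = ⟨b, w⟩ := by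
    rintro a b u w rfl rfl
    rfl
  exact h6 _ _ _ _ (extendChart_of_mem hp)
    (congrArg (fun L : EuclideanSpace ℝ (Fin m) →L[ℝ] EuclideanSpace ℝ (Fin m) => L p.2) h)

/-- A diffeomorphism supported in a chart, extended by the identity. -/
def extendChartDiffeomorph [T2Space M] (hC : ContMDiffOn (𝓡 m) 𝓘(ℝ, H) 1 C C.source)
    (hC' : ContMDiffOn 𝓘(ℝ, H) (𝓡 m) 1 C.symm C.target) (φ : H ≃ₜ H) (hφ : ContDiff ℝ 1 φ)
    (hφ' : ContDiff ℝ 1 φ.symm) (hφC : MapsTo φ C.target C.target)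
    (hφC' : MapsTo φ.symm C.target C.target) {L : Set H} (hL : IsCompact L)
    (hLC : L ⊆ C.target) (hφL : ∀ y ∉ L, φ y = y) (hφL' : ∀ y ∉ L, φ.symm y = y) :
    M ≃ₘ^1⟮𝓡 m, 𝓡 m⟯ M where
  toFun := extendChart C φ
  invFun := extendChart C φ.symm
  left_inv := extendChart_comp hφC φ.symm_apply_apply
  right_inv := extendChart_comp hφC' φ.apply_symm_apply
  contMDiff_toFun := contMDiff_extendChart hC hC' hφ hφC hL hLC hφL
  contMDiff_invFun := contMDiff_extendChart hC hC' hφ' hφC' hL hLC hφL'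

end Glue

/-! ### Extension of small perturbations of a Lagrangian submanifold -/

section Extension

variable {m : ℕ} {M : Type*} [TopologicalSpace M] [T2Space M]
  [ChartedSpace (EuclideanSpace ℝ (Fin m)) M] [IsManifold (𝓡 m) 1 M]
  [RiemannianBundle (fun x : M => TangentSpace (𝓡 m) x)]
  [IsContinuousRiemannianBundle (EuclideanSpace ℝ (Fin m))
    (fun x : M => TangentSpace (𝓡 m) x)]
  {V : Type*} [NormedAddCommGroup V] [InnerProductSpace ℝ V] [FiniteDimensional ℝ V]
  [MeasurableSpace V] [BorelSpace V] {C : OpenPartialHomeomorph M (V × V)}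

/-- A small `C¹` vector field on the zero section of a Darboux chart is the displacement of a
symplectomorphism of the manifold that is close to the identity. -/
theorem exists_symplecto_displacement {Ω : TwoForm m M}
    (ρ : MetricSpace (TangentBundle (𝓡 m) M)) (hρ : IsCompatibleDist ρ)
    (hC : ContMDiffOn (𝓡 m) 𝓘(ℝ, V × V) 1 C C.source)
    (hC' : ContMDiffOn 𝓘(ℝ, V × V) (𝓡 m) 1 C.symm C.target)
    (hCΩ : ∀ x ∈ C.source, ∀ u w : TangentSpace (𝓡 m) x,
      stdSymp (mfderiv (𝓡 m) 𝓘(ℝ, V × V) C x u) (mfderiv (𝓡 m) 𝓘(ℝ, V × V) C x w) = Ω x ![u, w])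
    {K : Set V} (hK : IsCompact K) (hKC : ∀ q ∈ K, (q, (0 : V)) ∈ C.target) {U : Set M}
    (hU : ∀ q ∈ K, U ∈ 𝓝 (C.symm (q, 0))) {ε : ℝ} (hε : 0 < ε) :
    ∃ δ : ℝ, 0 < δ ∧ ∀ v : V → V, ContDiff ℝ 1 v → (∀ q ∉ K, v q = 0) → (∀ q, ‖v q‖ ≤ δ) →
      (∀ q, ‖fderiv ℝ v q‖ ≤ δ) →
      ∃ φ : M ≃ₘ^1⟮𝓡 m, 𝓡 m⟯ M, IsSymplecto Ω φ ∧ (∀ x, x ∉ U → φ x = x) ∧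
        (∀ q ∈ K, φ (C.symm (q, 0)) = C.symm (q + v q, 0)) ∧
        c1EDist ρ (unitDiskBundle (m := m) M) φ id < ENNReal.ofReal ε := by
  have hO : IsOpen (C.target ∩ C.symm ⁻¹' interior U) :=
    C.continuousOn_symm.isOpen_inter_preimage C.open_target isOpen_interior
  have hK0 : IsCompact (K ×ˢ ({0} : Set V)) := hK.prod isCompact_singleton
  have hK0O : K ×ˢ ({0} : Set V) ⊆ C.target ∩ C.symm ⁻¹' interior U := by
    rintro ⟨q, p⟩ ⟨hq, hp⟩
    obtain rfl : p = 0 := hp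
    exact ⟨hKC q hq, mem_interior_iff_mem_nhds.2 (hU q hq)⟩
  -- The compact neighborhood `L` of the disk is fixed before the field; all supports lie in it, so
  -- the constants below depend on `L` only.
  obtain ⟨L, hL, hKL, hLO⟩ := exists_compact_between hK0 hO hK0O
  have hLC : L ⊆ C.target := fun y hy => (hLO hy).1
  obtain ⟨κ, hκ, hb⟩ := exists_norm_mfderiv_symm_bounds (m := m) hC hC' hL hLC
  -- Unit tangent vectors over `L` have norm at most `κ` in the chart. Half of `ε` is used because a
  -- supremum only inherits a weak inequality.
  obtain ⟨η, hη, hη'⟩ := exists_edist_lt_of_dist_lt ρ hρ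
    (C.open_target.prod isOpen_univ) (continuousOn_tangentChartSymm (m := m) hC')
    (hL.prod (isCompact_closedBall (0 : V × V) κ)) (prod_mono hLC (subset_univ _))
    (half_pos hε)
  -- `η / 2` controls base points; `η / (2 * κ)` controls derivatives applied to vectors of norm up
  -- to `κ`.
  obtain ⟨c, hcL, hc, δ, hδ, h⟩ := exists_symplectic_extension hK isOpen_interior
    (fun q hq => hKL ⟨hq, rfl⟩) (ε := min (η / 2) (η / (2 * κ))) (by positivity)
  refine ⟨δ, hδ, fun v hv hvK hvδ hvδ' => ?_⟩
  obtain ⟨φ, hφ, hφ', hsymp, hφc, hφq, hφε, hφε'⟩ := h v hv hvK hvδ hvδ'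
  have hcL' : c ⊆ L := hcL.trans interior_subset
  have hcC : c ⊆ C.target := hcL'.trans hLC
  have hφc' : ∀ y ∉ c, φ.symm y = y := fun y hy => by
    rw [Homeomorph.symm_apply_eq, hφc y hy]
  -- A bijection that fixes every point off `c` maps `c` to itself.
  have hmc : ∀ y ∈ c, φ y ∈ c := fun y hy => by
    by_contra h1
    have h2 := hφc _ h1
    exact h1 (by rwa [φ.injective h2])
  have hmc' : ∀ y ∈ c, φ.symm y ∈ c := fun y hy => by
    by_contra h1
    have h2 := hφc _ h1
    rw [φ.apply_symm_apply] at h2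
    exact h1 (by rwa [← h2])
  have hφC : MapsTo φ C.target C.target := fun y hy => by
    by_cases h1 : y ∈ c
    · exact hcC (hmc y h1)
    · rwa [hφc y h1]
  have hφC' : MapsTo φ.symm C.target C.target := fun y hy => by
    by_cases h1 : y ∈ c
    · exact hcC (hmc' y h1)
    · rwa [hφc' y h1]
  refine ⟨extendChartDiffeomorph hC hC' φ hφ hφ' hφC hφC' hc hcC hφc hφc', ?_, ?_, ?_, ?_⟩
  · intro x u w
    change Ω (extendChart C φ x) ![mfderiv (𝓡 m) (𝓡 m) (extendChart C φ) x u,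
      mfderiv (𝓡 m) (𝓡 m) (extendChart C φ) x w] = Ω x ![u, w]
    by_cases hx : x ∈ C.source
    · have hx' : extendChart C φ x ∈ C.source := by
        rw [extendChart_of_mem hx]
        exact C.map_target (hφC (C.map_source hx))
      have key : ∀ u : TangentSpace (𝓡 m) x,
          (mfderiv (𝓡 m) 𝓘(ℝ, V × V) C (extendChart C φ x)
            (mfderiv (𝓡 m) (𝓡 m) (extendChart C φ) x u) : V × V)
            = fderiv ℝ φ (C x) (mfderiv (𝓡 m) 𝓘(ℝ, V × V) C x u) := fun u => by
        have h1 := congrArg (tangentChart C)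
          (tangentMap_extendChart hC hC' hφ hφC (p := ⟨x, u⟩) hx)
        rw [tangentChart_tangentChartSymm hC hC' (hφC (C.map_source hx))] at h1
        exact congrArg Prod.snd h1
      rw [← hCΩ _ hx', ← hCΩ _ hx]
      refine (congrArg₂ stdSymp (key u) (key w)).trans ?_
      exact hsymp _ _ _
    · have hxc : x ∉ C.symm '' c := by
        rintro ⟨y, hy, rfl⟩
        exact hx (C.map_target (hcC hy))
      have key : mfderiv (𝓡 m) (𝓡 m) (extendChart C φ) x
          = ContinuousLinearMap.id ℝ (TangentSpace (𝓡 m) x) := by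
        rw [(extendChart_eventuallyEq_id hc hcC hφc hxc).mfderiv_eq]
        exact mfderiv_id
      refine (TwoForm.congr_base (extendChart_of_notMem hφc hxc) _).trans ?_
      congr 1
      ext i : 1
      fin_cases i
      · exact congrArg (fun L : EuclideanSpace ℝ (Fin m) →L[ℝ] EuclideanSpace ℝ (Fin m) => L u) key
      · exact congrArg (fun L : EuclideanSpace ℝ (Fin m) →L[ℝ] EuclideanSpace ℝ (Fin m) => L w) key
  · intro x hx
    refine extendChart_of_notMem hφc ?_
    rintro ⟨y, hy, rfl⟩
    exact hx (interior_subset (hLO (hcL' hy)).2)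
  · intro q hq
    change extendChart C φ (C.symm (q, 0)) = _
    rw [extendChart_of_mem (C.map_target (hKC q hq)), C.right_inv (hKC q hq), hφq]
  · refine lt_of_le_of_lt (b := ENNReal.ofReal (ε / 2)) ?_
      ((ENNReal.ofReal_lt_ofReal_iff hε).2 (half_lt_self hε))
    refine iSup₂_le fun p hp => ?_
    change ρ.edist (tangentMap (𝓡 m) (𝓡 m) (extendChart C φ) p) (tangentMap (𝓡 m) (𝓡 m) id p) ≤ _
    rw [tangentMap_id]
    by_cases hpc : p.1 ∈ C.symm '' c
    · have hps : p.1 ∈ C.source := by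
        obtain ⟨y, hy, h1⟩ := hpc
        rw [← h1]
        exact C.map_target (hcC hy)
      have hpL : C p.1 ∈ L := by
        obtain ⟨y, hy, h1⟩ := hpc
        rw [← h1, C.right_inv (hcC hy)]
        exact hcL' hy
      have hpS := tangentChartSymm_tangentChart hC hC' hps
      have hpn : ‖(tangentChart C p).2‖ ≤ κ := by
        have h1 := (hb _ hpL (tangentChart C p).2).2
        have h2 : ‖(tangentChartSymm (m := m) C (C p.1, (tangentChart C p).2)).2‖ = ‖p.2‖ :=
          congrArg (fun p : TangentBundle (𝓡 m) M => ‖p.2‖) hpS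
        rw [h2] at h1
        have h3 : ‖p.2‖ ≤ 1 := hp
        nlinarith
      rw [tangentMap_extendChart hC hC' hφ hφC hps]
      have hd : dist (tangentChart C p)
          (φ (C p.1), fderiv ℝ φ (C p.1) (tangentChart C p).2) < η := by
        rw [Prod.dist_eq]
        refine max_lt ?_ ?_
        · rw [dist_comm, dist_eq_norm]
          exact (hφε _).trans_lt ((min_le_left _ _).trans_lt (half_lt_self hη))
        · rw [dist_comm, dist_eq_norm]
          calc _ ≤ min (η / 2) (η / (2 * κ)) * ‖(tangentChart C p).2‖ := hφε' _ _
            _ ≤ η / (2 * κ) * κ := by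
              gcongr
              exact min_le_right _ _
            _ = η / 2 := by field_simp
            _ < η := half_lt_self hη
      have h1 := (hη' _ ⟨hpL, mem_closedBall_zero_iff.2 hpn⟩ _ hd).2.le
      rw [hpS] at h1
      exact (@edist_comm _ ρ.toPseudoMetricSpace.toPseudoEMetricSpace _ _).trans_le h1
    · rw [tangentMap_extendChart_of_notMem hc hcC hφc hpc]
      exact (@edist_self _ ρ.toPseudoMetricSpace.toPseudoEMetricSpace _).trans_le zero_le

end Extension

/-! ### The displacement of a diffeomorphism of a disk -/

section Displacement

variable {n : ℕ} {W : Type*} [TopologicalSpace W] [T2Space W]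
  [ChartedSpace (EuclideanSpace ℝ (Fin n)) W] [IsManifold (𝓡 n) 1 W]
  {V : Type*} [NormedAddCommGroup V] [NormedSpace ℝ V]
  {D : OpenPartialHomeomorph W V} {B : Set W} {ψ : W → W}

open Classical in
/-- The displacement, in the chart `D`, of a self-map `ψ` of `B`, extended by zero. -/
def displacement (D : OpenPartialHomeomorph W V) (B : Set W) (ψ : W → W) (q : V) : V :=
  if q ∈ D '' B then D (ψ (D.symm q)) - q else 0

theorem displacement_of_mem {q : V} (hq : q ∈ D '' B) :
    displacement D B ψ q = D (ψ (D.symm q)) - q := if_pos hq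

theorem displacement_of_notMem {q : V} (hq : q ∉ D '' B) : displacement D B ψ q = 0 := if_neg hq

theorem displacement_eventuallyEq {q : V} (hq : q ∈ D.target)
    (hqB : D.symm q ∈ interior B) :
    ∀ᶠ q' in 𝓝 q, D.symm q' ∈ B ∧ displacement D B ψ q' = D (ψ (D.symm q')) - q' := by
  filter_upwards [D.open_target.mem_nhds hq,
    (D.continuousAt_symm hq).eventually_mem (isOpen_interior.mem_nhds hqB)] with q' h1 h2
  exact ⟨interior_subset h2,
    displacement_of_mem ⟨D.symm q', interior_subset h2, D.right_inv h1⟩⟩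

/-- Condition (a) and closedness of `B` leave only two local situations, so no regularity of the
boundary of `B` is needed: off the interior the displacement is locally zero, and in the interior it
is a composition of `C¹` maps. -/
theorem displacement_eventuallyEq_zero_or (hB : IsCompact B) (hBD : B ⊆ D.source)
    (hψ : ∀ᶠ w in 𝓝ˢ (frontier B), w ∈ B → ψ w = w) (q : V) :
    displacement D B ψ =ᶠ[𝓝 q] 0 ∨ q ∈ D.target ∧ D.symm q ∈ interior B := by
  by_cases hq : q ∈ D '' B
  · obtain ⟨w, hw, rfl⟩ := hq
    have hwD := hBD hw
    by_cases hwi : w ∈ interior B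
    · exact Or.inr ⟨D.map_source hwD, by rwa [D.left_inv hwD]⟩
    · left
      have hwf : w ∈ frontier B := ⟨subset_closure hw, hwi⟩
      have h1 : ∀ᶠ w' in 𝓝 w, w' ∈ B → ψ w' = w' := hψ.filter_mono (nhds_le_nhdsSet hwf)
      have h2 : Tendsto D.symm (𝓝 (D w)) (𝓝 w) := by
        have := D.continuousAt_symm (D.map_source hwD)
        rwa [ContinuousAt, D.left_inv hwD] at this
      filter_upwards [h2.eventually h1] with q' hq'
      by_cases h3 : q' ∈ D '' B
      · rw [displacement_of_mem h3]
        obtain ⟨w', hw', rfl⟩ := h3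
        rw [D.left_inv (hBD hw')] at hq' ⊢
        rw [hq' hw', sub_self]
        rfl
      · exact displacement_of_notMem h3
  · left
    have hcl : IsClosed (D '' B) := (hB.image_of_continuousOn (D.continuousOn.mono hBD)).isClosed
    filter_upwards [hcl.isOpen_compl.mem_nhds hq] with q' hq'
    exact displacement_of_notMem hq'

theorem contDiff_displacement (hD : ContMDiffOn (𝓡 n) 𝓘(ℝ, V) 1 D D.source)
    (hD' : ContMDiffOn 𝓘(ℝ, V) (𝓡 n) 1 D.symm D.target)
    (hB : IsCompact B) (hBD : B ⊆ D.source) (hψB : MapsTo ψ B B)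
    (hψ1 : ContMDiffOn (𝓡 n) (𝓡 n) 1 ψ B)
    (hψ : ∀ᶠ w in 𝓝ˢ (frontier B), w ∈ B → ψ w = w) :
    ContDiff ℝ 1 (displacement D B ψ) := by
  rw [contDiff_iff_contDiffAt]
  intro q
  rcases displacement_eventuallyEq_zero_or hB hBD hψ q with h | ⟨hq, hqB⟩
  · exact contDiffAt_const.congr_of_eventuallyEq h
  · have h1 : ContMDiffAt 𝓘(ℝ, V) (𝓡 n) 1 D.symm q :=
      hD'.contMDiffAt (D.open_target.mem_nhds hq)
    have h2 : ContMDiffAt (𝓡 n) (𝓡 n) 1 ψ (D.symm q) :=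
      hψ1.contMDiffAt (mem_interior_iff_mem_nhds.1 hqB)
    have h3 : ContMDiffAt (𝓡 n) 𝓘(ℝ, V) 1 D (ψ (D.symm q)) :=
      hD.contMDiffAt (D.open_source.mem_nhds (hBD (hψB (interior_subset hqB))))
    have h4 : ContMDiffAt (𝓡 n) 𝓘(ℝ, V) 1 (D ∘ ψ) (D.symm q) := h3.comp _ h2
    have h5 : ContDiffAt ℝ 1 ((D ∘ ψ) ∘ D.symm) q := (h4.comp q h1).contDiffAt
    exact (h5.sub contDiffAt_id).congr_of_eventuallyEq
      ((displacement_eventuallyEq hq hqB).mono fun q' hq' => hq'.2)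

variable {m : ℕ} {M : Type*} [TopologicalSpace M]
  [ChartedSpace (EuclideanSpace ℝ (Fin m)) M] [IsManifold (𝓡 m) 1 M]
  {C : OpenPartialHomeomorph M (V × V)} {ι : W → M}

/-- Meant for `f = ι` with `g` the identity, and for `f = ι ∘ ψ` with `g` the identity plus the
displacement; comparing the two outcomes isolates the displacement and its derivative. -/
theorem tangentMap_tangentChartSymm (hC' : ContMDiffOn 𝓘(ℝ, V × V) (𝓡 m) 1 C.symm C.target)
    (hD' : ContMDiffOn 𝓘(ℝ, V) (𝓡 n) 1 D.symm D.target) {f : W → M} {g : V → V} {q : V}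
    (hq : q ∈ D.target) (hf : MDifferentiableAt (𝓡 n) (𝓡 m) f (D.symm q))
    (hg : DifferentiableAt ℝ g q) (hgq : (g q, (0 : V)) ∈ C.target)
    (hfg : ∀ᶠ q' in 𝓝 q, f (D.symm q') = C.symm (g q', 0)) (a : V) :
    tangentMap (𝓡 n) (𝓡 m) f (tangentChartSymm D (q, a))
      = tangentChartSymm C ((g q, 0), (fderiv ℝ g q a, 0)) := by
  have h1 : MDifferentiableAt 𝓘(ℝ, V) (𝓡 n) D.symm q :=
    (hD'.contMDiffAt (D.open_target.mem_nhds hq)).mdifferentiableAt one_ne_zero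
  have h2 := mfderiv_comp q hf h1
  let g' : V → V × V := fun q' => (g q', 0)
  have hg' : HasFDerivAt g' ((fderiv ℝ g q).prod (0 : V →L[ℝ] V)) q :=
    hg.hasFDerivAt.prodMk (hasFDerivAt_const _ _)
  have h3 : MDifferentiableAt 𝓘(ℝ, V × V) (𝓡 m) C.symm (g' q) :=
    (hC'.contMDiffAt (C.open_target.mem_nhds hgq)).mdifferentiableAt one_ne_zero
  have h4 := mfderiv_comp q h3 hg'.differentiableAt.mdifferentiableAt
  rw [mfderiv_eq_fderiv, hg'.fderiv] at h4
  have h5 : f ∘ D.symm =ᶠ[𝓝 q] C.symm ∘ g' := hfg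
  have h6 := h5.mfderiv_eq (I := 𝓘(ℝ, V)) (I' := 𝓡 m)
  have h7 := h2.symm.trans (h6.trans h4)
  have h8 : ∀ (a b : M) (u w : EuclideanSpace ℝ (Fin m)), a = b → u = w →
      (⟨a, u⟩ : TangentBundle (𝓡 m) M) = ⟨b, w⟩ := by
    rintro a b u w rfl rfl
    rfl
  exact h8 _ _ _ _ hfg.self_of_nhds
    (congrArg (fun L : V →L[ℝ] EuclideanSpace ℝ (Fin m) => L a) h7)

variable [FiniteDimensional ℝ V] [RiemannianBundle (fun x : M => TangentSpace (𝓡 m) x)]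
  [IsContinuousRiemannianBundle (EuclideanSpace ℝ (Fin m))
    (fun x : M => TangentSpace (𝓡 m) x)]

/-- The displacement of a map `C¹`-close to the identity is `C¹`-small. -/
theorem exists_displacement_le (ρ : MetricSpace (TangentBundle (𝓡 m) M)) (hρ : IsCompatibleDist ρ)
    (hι : ContMDiff (𝓡 n) (𝓡 m) 1 ι)
    (hC : ContMDiffOn (𝓡 m) 𝓘(ℝ, V × V) 1 C C.source)
    (hC' : ContMDiffOn 𝓘(ℝ, V × V) (𝓡 m) 1 C.symm C.target)
    (hD : ContMDiffOn (𝓡 n) 𝓘(ℝ, V) 1 D D.source)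
    (hD' : ContMDiffOn 𝓘(ℝ, V) (𝓡 n) 1 D.symm D.target)
    (hCD : ∀ w ∈ D.source, ι w ∈ C.source ∧ C (ι w) = (D w, 0))
    (hB : IsCompact B) (hBD : B ⊆ D.source) {δ' : ℝ} (hδ' : 0 < δ') :
    ∃ δ : ℝ, 0 < δ ∧ ∀ ψ : W → W, MapsTo ψ B B → ContMDiffOn (𝓡 n) (𝓡 n) 1 ψ B →
      (∀ᶠ w in 𝓝ˢ (frontier B), w ∈ B → ψ w = w) →
      c1EDist ρ (inducedUnitDiskBundle (m := m) (n := n) ι B) (ι ∘ ψ) ι < ENNReal.ofReal δ →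
      ∀ q, ‖displacement D B ψ q‖ ≤ δ' ∧ ‖fderiv ℝ (displacement D B ψ) q‖ ≤ δ' := by
  have hK : IsCompact ((D '' B) ×ˢ ({0} : Set V)) :=
    (hB.image_of_continuousOn (D.continuousOn.mono hBD)).prod isCompact_singleton
  have hsymm : ∀ w ∈ D.source, C.symm (D w, 0) = ι w := fun w hw => by
    rw [← (hCD w hw).2, C.left_inv (hCD w hw).1]
  have htgt : ∀ w ∈ D.source, (D w, (0 : V)) ∈ C.target := fun w hw => by
    rw [← (hCD w hw).2]
    exact C.map_source (hCD w hw).1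
  have hKC : (D '' B) ×ˢ ({0} : Set V) ⊆ C.target := by
    rintro ⟨q, p⟩ ⟨⟨w, hw, rfl⟩, hp⟩
    obtain rfl : p = 0 := hp
    exact htgt w (hBD hw)
  obtain ⟨κ, hκ, hb⟩ := exists_norm_mfderiv_symm_bounds (m := m) hC hC' hK hKC
  have hT : IsCompact (tangentChartSymm (m := m) C ''
      (((D '' B) ×ˢ ({0} : Set V)) ×ˢ closedBall (0 : V × V) κ⁻¹)) :=
    (hK.prod (isCompact_closedBall _ _)).image_of_continuousOn
      ((continuousOn_tangentChartSymm hC').mono (prod_mono hKC (subset_univ _)))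
  -- The derivative is tested on vectors of norm `κ⁻¹`, whose induced norm is at most `1`; rescaling
  -- multiplies the error by `κ`, hence `δ' / κ`.
  obtain ⟨δ, hδ, h⟩ := exists_dist_lt_of_edist_lt ρ hρ
    (C.open_source.preimage (FiberBundle.continuous_proj (EuclideanSpace ℝ (Fin m))
      (fun x : M => TangentSpace (𝓡 m) x)))
    (continuousOn_tangentChart (m := m) hC) hT (by
      rintro _ ⟨y, hy, rfl⟩
      exact C.map_target (hKC hy.1)) (ε := min δ' (δ' / κ)) (by positivity)
  refine ⟨δ, hδ, fun ψ hψB hψ1 hψ hψδ q => ?_⟩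
  rcases displacement_eventuallyEq_zero_or hB hBD hψ q with h0 | ⟨hq, hqB⟩
  · rw [h0.fderiv_eq, h0.self_of_nhds]
    simp [hδ'.le]
  have hv := contDiff_displacement hD hD' hB hBD hψB hψ1 hψ
  have hvd : DifferentiableAt ℝ (displacement D B ψ) q := hv.differentiable one_ne_zero q
  have hev := displacement_eventuallyEq (ψ := ψ) hq hqB
  have hqD := hBD (interior_subset hqB)
  have hψD := hBD (hψB (interior_subset hqB))
  have key : ∀ a : V, ‖a‖ ≤ κ⁻¹ → ‖displacement D B ψ q‖ < min δ' (δ' / κ) ∧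
      ‖fderiv ℝ (displacement D B ψ) q a‖ < min δ' (δ' / κ) := by
    intro a ha
    have e1 : tangentMap (𝓡 n) (𝓡 m) ι (tangentChartSymm D (q, a))
        = tangentChartSymm C ((q, 0), (a, 0)) := by
      have := tangentMap_tangentChartSymm hC' hD' hq ((hι _).mdifferentiableAt one_ne_zero)
        (g := fun q => q) differentiableAt_fun_id
        (by simpa only [D.right_inv hq] using htgt _ hqD)
        (by
          filter_upwards [D.open_target.mem_nhds hq] with q' hq'
          rw [← hsymm _ (D.map_target hq'), D.right_inv hq']) a
      simpa using this
    have e2 : tangentMap (𝓡 n) (𝓡 m) (ι ∘ ψ) (tangentChartSymm D (q, a))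
        = tangentChartSymm C ((q + displacement D B ψ q, 0),
          (a + fderiv ℝ (displacement D B ψ) q a, 0)) := by
      have := tangentMap_tangentChartSymm hC' hD' hq (f := ι ∘ ψ)
        (((hι _).comp _ (hψ1.contMDiffAt
          (mem_interior_iff_mem_nhds.1 hqB))).mdifferentiableAt one_ne_zero)
        (g := fun q => q + displacement D B ψ q) (differentiableAt_fun_id.add hvd)
        (by
          simp only [hev.self_of_nhds.2, add_sub_cancel]
          exact htgt _ hψD)
        (by
          filter_upwards [hev] with q' hq'
          rw [hq'.2, add_sub_cancel, hsymm _ (hBD (hψB hq'.1))]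
          rfl) a
      rw [this, fderiv_fun_add differentiableAt_fun_id hvd]
      simp
    have hqK : (q, (0 : V)) ∈ (D '' B) ×ˢ ({0} : Set V) :=
      ⟨⟨D.symm q, interior_subset hqB, D.right_inv hq⟩, rfl⟩
    have hn : ‖((a, 0) : V × V)‖ = ‖a‖ := by simp [Prod.norm_def]
    have hmem : tangentChartSymm D (q, a) ∈ inducedUnitDiskBundle (m := m) (n := n) ι B := by
      refine ⟨hqB, ?_⟩
      have h1 := (hb _ hqK (a, 0)).1
      rw [← e1, hn] at h1
      refine h1.trans ?_
      calc κ * ‖a‖ ≤ κ * κ⁻¹ := by gcongr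
        _ = 1 := mul_inv_cancel₀ hκ.ne'
    have hlt : ρ.edist (tangentMap (𝓡 n) (𝓡 m) (ι ∘ ψ) (tangentChartSymm D (q, a)))
        (tangentMap (𝓡 n) (𝓡 m) ι (tangentChartSymm D (q, a))) < ENNReal.ofReal δ :=
      lt_of_le_of_lt (le_iSup₂ (f := fun v (_ : v ∈ inducedUnitDiskBundle (m := m) (n := n) ι B) =>
        ρ.edist (tangentMap (𝓡 n) (𝓡 m) (ι ∘ ψ) v) (tangentMap (𝓡 n) (𝓡 m) ι v)) _ hmem) hψδ
    rw [e1, e2] at hlt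
    have h2 := (h _ ⟨((q, 0), (a, 0)), ⟨hqK, mem_closedBall_zero_iff.2 (hn.trans_le ha)⟩, rfl⟩ _
      ((@edist_comm _ ρ.toPseudoMetricSpace.toPseudoEMetricSpace _ _).trans_lt hlt)).2
    have hqv : (q + displacement D B ψ q, (0 : V)) ∈ C.target := by
      rw [hev.self_of_nhds.2, add_sub_cancel]
      exact htgt _ hψD
    rw [tangentChart_tangentChartSymm hC hC' (hKC hqK),
      tangentChart_tangentChartSymm hC hC' hqv, Prod.dist_eq, max_lt_iff, Prod.dist_eq,
      Prod.dist_eq, max_lt_iff, max_lt_iff] at h2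
    simpa [dist_eq_norm] using And.intro h2.1.1 h2.2.1
  -- The zero vector already gives the `C⁰` bound.
  refine ⟨((key 0 (by simp [hκ.le])).1.trans_le (min_le_left _ _)).le, ?_⟩
  refine ContinuousLinearMap.opNorm_le_of_unit_norm hδ'.le fun a ha => ?_
  have h1 := ((key (κ⁻¹ • a) (by simp [norm_smul, ha, abs_of_pos hκ])).2.trans_le
    (min_le_right _ _)).le
  rw [map_smul, norm_smul, norm_inv, Real.norm_of_nonneg hκ.le, inv_mul_le_iff₀ hκ,
    mul_div_cancel₀ _ hκ.ne'] at h1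
  exact h1

end Displacement

/-! ### Extension of `C¹`-small diffeomorphisms of Lagrangian disks -/

/-- Let `v` be the displacement of `ψ` in the adapted charts. On the disk, `φ (ι w)` has coordinates
`(D w + v (D w), 0) = (D (ψ w), 0)`, which are those of `ι (ψ w)`. -/
theorem exists_symplecto_extension_intrinsicDisk {n : ℕ} {M W : Type*}
    [TopologicalSpace M] [T2Space M]
    [ChartedSpace (EuclideanSpace ℝ (Fin (2 * n))) M] [IsManifold (𝓡 (2 * n)) 1 M]
    [RiemannianBundle (fun x : M => TangentSpace (𝓡 (2 * n)) x)]
    [IsContinuousRiemannianBundle (EuclideanSpace ℝ (Fin (2 * n)))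
      (fun x : M => TangentSpace (𝓡 (2 * n)) x)]
    {Ω : TwoForm (2 * n) M} (hΩ : Ω.IsSymplectic)
    (ρ : MetricSpace (TangentBundle (𝓡 (2 * n)) M)) (hρ : IsCompatibleDist ρ)
    [TopologicalSpace W] [T2Space W]
    [ChartedSpace (EuclideanSpace ℝ (Fin n)) W] [IsManifold (𝓡 n) 1 W]
    {ι : W → M} (hι : IsLagrangianSubmanifold Ω ι) (z : W) :
    ∃ R : ℝ, 0 < R ∧ ∀ r ≤ R, IsCompact (intrinsicDisk (m := 2 * n) (n := n) ι z r) ∧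
      ∀ U : Set M, U ∈ 𝓝ˢ (ι '' intrinsicDisk (m := 2 * n) (n := n) ι z r) →
        ∀ ε : ℝ, 0 < ε → ∃ δ : ℝ, 0 < δ ∧ ∀ ψ : W → W,
          IsC1DiffeoOfSet (n := n) (intrinsicDisk (m := 2 * n) (n := n) ι z r) ψ →
          (∀ᶠ w in 𝓝ˢ (frontier (intrinsicDisk (m := 2 * n) (n := n) ι z r)),
            w ∈ intrinsicDisk (m := 2 * n) (n := n) ι z r → ψ w = w) →
          c1EDist ρ (inducedUnitDiskBundle (m := 2 * n) (n := n) ι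
            (intrinsicDisk (m := 2 * n) (n := n) ι z r)) (ι ∘ ψ) ι < ENNReal.ofReal δ →
          ∃ φ : M ≃ₘ^1⟮𝓡 (2 * n), 𝓡 (2 * n)⟯ M, IsSymplecto Ω φ ∧ (∀ x, x ∉ U → φ x = x) ∧
            (∀ w ∈ intrinsicDisk (m := 2 * n) (n := n) ι z r, φ (ι w) = ι (ψ w)) ∧
            c1EDist ρ (unitDiskBundle (m := 2 * n) M) φ id < ENNReal.ofReal ε := by
  obtain ⟨C, D, hz, hC, hC', hD, hD', hCΩ, hCD⟩ := exists_adapted_charts hΩ hι z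
  obtain ⟨R, hR, u, hu, huD, hsub⟩ := exists_intrinsicDisk_subset hι.contMDiff hz hC hC' hCD
  refine ⟨R, hR, fun r hr => ?_⟩
  have hBu := hsub r hr
  have hBcl : IsClosed (intrinsicDisk (m := 2 * n) (n := n) ι z r) := isClosed_closure
  -- From here on it only matters that the disk is a closed subset of `u`.
  generalize intrinsicDisk (m := 2 * n) (n := n) ι z r = B at *
  have hB : IsCompact B := hu.of_isClosed_subset hBcl hBu
  have hBD : B ⊆ D.source := hBu.trans huD
  have hsymm : ∀ w ∈ D.source, C.symm (D w, 0) = ι w := fun w hw => by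
    rw [← (hCD w hw).2, C.left_inv (hCD w hw).1]
  refine ⟨hB, fun U hU ε hε => ?_⟩
  obtain ⟨δ', hδ', h⟩ := exists_symplecto_displacement (U := U) ρ hρ hC hC' hCΩ
    (hB.image_of_continuousOn (D.continuousOn.mono hBD))
    (by
      rintro _ ⟨w, hw, rfl⟩
      rw [← (hCD w (hBD hw)).2]
      exact C.map_source (hCD w (hBD hw)).1)
    (by
      rintro _ ⟨w, hw, rfl⟩
      rw [hsymm w (hBD hw)]
      exact mem_nhdsSet_iff_forall.1 hU _ (mem_image_of_mem _ hw)) hε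
  obtain ⟨δ, hδ, hdisp⟩ := exists_displacement_le ρ hρ hι.contMDiff hC hC' hD hD' hCD hB hBD hδ'
  refine ⟨δ, hδ, fun ψ hψB hψ hψδ => ?_⟩
  have hle := hdisp ψ hψB.1 hψB.2.1 hψ hψδ
  obtain ⟨φ, hφ, hφU, hφψ, hφε⟩ := h (displacement D B ψ)
    (contDiff_displacement hD hD' hB hBD hψB.1 hψB.2.1 hψ)
    (fun q hq => displacement_of_notMem hq) (fun q => (hle q).1) (fun q => (hle q).2)
  refine ⟨φ, hφ, hφU, fun w hw => ?_, hφε⟩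
  have h1 := hφψ (D w) ⟨w, hw, rfl⟩
  rw [displacement_of_mem ⟨w, hw, rfl⟩, hsymm w (hBD hw), D.left_inv (hBD hw), add_sub_cancel,
    hsymm _ (hBD (hψB.1 hw))] at h1
  exact h1

end

/-! ### The main theorem. -/

theorem mainTheorem7 {n : ℕ} {M W : Type*}
    [TopologicalSpace M] [T2Space M] [SecondCountableTopology M]
    [ChartedSpace (EuclideanSpace ℝ (Fin (2 * n))) M] [IsManifold (𝓡 (2 * n)) ∞ M]
    [RiemannianBundle (fun x : M => TangentSpace (𝓡 (2 * n)) x)]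
    [IsContinuousRiemannianBundle (EuclideanSpace ℝ (Fin (2 * n)))
      (fun x : M => TangentSpace (𝓡 (2 * n)) x)]
    (Ω : TwoForm (2 * n) M) (hΩ : Ω.IsSymplectic)
    (ρ : MetricSpace (TangentBundle (𝓡 (2 * n)) M))
    (hρ : IsCompatibleDist ρ)
    [TopologicalSpace W] [T2Space W] [SecondCountableTopology W]
    [ChartedSpace (EuclideanSpace ℝ (Fin n)) W] [IsManifold (𝓡 n) 1 W]
    (ι : W → M) (hι : IsLagrangianSubmanifold Ω ι) (z : W) :
    ∃ R : ℝ, 0 < R ∧ ∀ r₀ : ℝ, 0 < r₀ → r₀ ≤ R →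
      ∃ D : Set W, D = intrinsicDisk (m := 2 * n) (n := n) ι z r₀ ∧ IsCompact D ∧
        ∀ U : Set M, U ∈ 𝓝ˢ (ι '' D) → ∀ ε : ℝ, 0 < ε → ∃ δ : ℝ, 0 < δ ∧
          ∀ ψ : W → W, IsC1DiffeoOfSet (n := n) D ψ →
            (∀ᶠ w in 𝓝ˢ (frontier D), w ∈ D → ψ w = w) →
            c1EDist ρ (inducedUnitDiskBundle (m := 2 * n) (n := n) ι D) (ι ∘ ψ) ι
              < ENNReal.ofReal δ →
            ∃ φ : M ≃ₘ^1⟮𝓡 (2 * n), 𝓡 (2 * n)⟯ M, IsSymplecto Ω φ ∧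
              (∀ x, x ∉ U → φ x = x) ∧
              (∀ w ∈ D, φ (ι w) = ι (ψ w)) ∧
              c1EDist ρ (unitDiskBundle (m := 2 * n) M) φ id < ENNReal.ofReal ε := by
  -- The extension argument needs only the underlying `C¹` structure of `M`; the smoothness of `Ω`
  -- is already expressed in charts.
  have : IsManifold (𝓡 (2 * n)) 1 M :=
    IsManifold.of_le (n := ∞) (by exact_mod_cast le_top)
  obtain ⟨R, hR, h⟩ := exists_symplecto_extension_intrinsicDisk hΩ ρ hρ hι z
  exact ⟨R, hR, fun r₀ _ hr => ⟨_, rfl, h r₀ hr⟩⟩
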